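/- Let $1\le q,q'<\infty$ and $M,M'\ge 0$. There is a function $\alpha:[0,\infty)\to[0,\infty)$, depending only on $q,q',M,M'$, with the following property. If $X$ and $Y$ are separable infinite-dimensional (real) Banach lattices with $M_q(X)=M<\infty$ and $M_{q'}(Y)=M'<\infty$, then there is a uniform homeomorphism $F:S(X)\to S(Y)$ between the unit spheres such that $\alpha$ is a modulus of continuity for both $F$ and $F^{-1}$. Here $M_q(X)$, the $q$-concavity constant of $X$, is the smallest constant $C$ such that $$\Big(\sum_{i=1}^n\|x_i\|^q\Big)^{1/q}\le C\,\Big\|\Big(\sum_{i=1}^n|x_i|^q\Big)^{1/q}\Big\|$$ for all $n\in\mathbb N$ and $x_1,\dots,x_n\in X$ (and $M_q(X)=\infty$ if there is none), where $\big(\sum_{i=1}^n|x_i|^q\big)^{1/q}$ is the supremum in $X$ of all $\sum_{i=1}^n a_ix_i$ with $a$ in the unit ball of $\ell_{q^*}^n$, $\frac1q+\frac1{q^*}=1$. A modulus of continuity for a map $F:(A,d_1)\to(B,d_2)$ is a continuous function $\alpha:[0,\infty)\to[0,\infty)$ with $\alpha(0)=0$ and $d_2(F(a_1),F(a_2))\le\alpha(d_1(a_1,a_2))$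 for all $a_1,a_2\in A$. -/

import Mathlib

open scoped NNReal ENNReal

/-- The linear combinations `∑ aᵢ xᵢ` with `a` in the unit ball of `ℓ_{q*}ⁿ`, where `1/q + 1/q* = 1`
(`q* = ∞` if `q = 1`). -/
def dualBallCombinations {X : Type*} [NormedAddCommGroup X] [NormedSpace ℝ X]
    (q : ℝ) {n : ℕ} (x : Fin n → X) : Set X :=
  {y | ∃ a : Fin n → ℝ, ‖WithLp.toLp (ENNReal.conjExponent (ENNReal.ofReal q)) a‖ ≤ 1 ∧
    y = ∑ i, a i • x i}

section
variable {X : Type*} [NormedAddCommGroup X] [NormedSpace ℝ X] [CompleteSpace X]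
  [Lattice X] [IsOrderedAddMonoid X] [HasSolidNorm X] [IsOrderedModule ℝ X]

/-- In a Banach lattice the supremum that defines `(∑ |xᵢ|^q)^{1/q}` exists. -/
theorem exists_isLUB_dualBallCombinations (q : ℝ) {n : ℕ} (x : Fin n → X) :
    ∃ s : X, IsLUB (dualBallCombinations q x) s := by
  set p := ENNReal.conjExponent (ENNReal.ofReal q) with hp
  have : Fact (1 ≤ p) := ⟨by rw [hp, ENNReal.conjExponent]; exact le_self_add⟩
  set K : Set (Fin n → ℝ) := {a | ‖WithLp.toLp p a‖ ≤ 1} with hK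
  set L : (Fin n → ℝ) → X := fun a => ∑ i, a i • x i with hL
  set u : X := ∑ i, |x i| with hu
  have hcomb : dualBallCombinations q x = L '' K := by
    ext y; constructor
    · rintro ⟨a, ha, rfl⟩; exact ⟨a, ha, rfl⟩
    · rintro ⟨a, ha, rfl⟩; exact ⟨a, ha, rfl⟩
  have h0 : (0 : Fin n → ℝ) ∈ K := by simp [hK]
  have hu0 : 0 ≤ u := Finset.sum_nonneg fun i _ => abs_nonneg _
  have hKb : TotallyBounded K := by
    refine TotallyBounded.subset ?_ (isCompact_closedBall (0 : Fin n → ℝ) 1).totallyBounded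
    intro a ha
    rw [mem_closedBall_zero_iff, pi_norm_le_iff_of_nonneg zero_le_one]
    exact fun i => (PiLp.norm_apply_le (WithLp.toLp p a) i).trans ha
  have hLle : ∀ (a b : Fin n → ℝ) (ε : ℝ), dist a b ≤ ε → L a ≤ L b + ε • u := by
    intro a b ε hab
    rw [← sub_le_iff_le_add', hL, hu, Finset.smul_sum]
    simp only [← Finset.sum_sub_distrib, ← sub_smul]
    refine Finset.sum_le_sum fun i _ => ?_
    have h1 : |a i - b i| ≤ ε := (dist_le_pi_dist a b i).trans hab
    have h2 : (a i - b i) • x i ≤ |a i - b i| • |x i| := by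
      rcases le_total 0 (a i - b i) with h | h
      · rw [abs_of_nonneg h]; exact smul_le_smul_of_nonneg_left (le_abs_self _) h
      · rw [abs_of_nonpos h, ← neg_smul_neg (a i - b i) (x i)]
        exact smul_le_smul_of_nonneg_left (neg_le_abs (x i)) (neg_nonneg.2 h)
    exact h2.trans (smul_le_smul_of_nonneg_right h1 (abs_nonneg _))
  have key : ∀ m : ℕ, ∃ y : X, (∀ a ∈ K, L a ≤ y + (1 / ((m : ℝ) + 1)) • u) ∧
      ∀ z ∈ upperBounds (L '' K), y ≤ z := by
    intro m
    obtain ⟨t, htK, htf, ht⟩ := totallyBounded_iff_subset.1 hKb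
      _ (Metric.dist_mem_uniformity (Nat.one_div_pos_of_nat (α := ℝ) (n := m)))
    have htn : htf.toFinset.Nonempty := by
      have := ht h0
      simp only [Set.mem_iUnion] at this
      obtain ⟨b, hb, -⟩ := this
      exact ⟨b, by simpa using hb⟩
    refine ⟨htf.toFinset.sup' htn L, ?_, ?_⟩
    · intro a ha
      have := ht ha
      simp only [Set.mem_iUnion] at this
      obtain ⟨b, hb, hab⟩ := this
      have hab' : dist a b ≤ 1 / ((m : ℝ) + 1) := le_of_lt hab
      exact (hLle a b _ hab').trans
        (add_le_add_left (Finset.le_sup' L (by simpa using hb)) _)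
    · intro z hz
      refine Finset.sup'_le _ _ fun b hb => hz ⟨b, htK (by simpa using hb), rfl⟩
  choose y hy1 hy2 using key
  have hle : ∀ k m, y k ≤ y m + (1 / ((m : ℝ) + 1)) • u := fun k m =>
    hy2 k _ (by rintro _ ⟨a, ha, rfl⟩; exact hy1 m a ha)
  have hnn : ∀ m : ℕ, (0 : ℝ) ≤ 1 / ((m : ℝ) + 1) := fun m => by positivity
  have hanti : ∀ {m k : ℕ}, m ≤ k → (1 / ((k : ℝ) + 1)) ≤ 1 / ((m : ℝ) + 1) := fun h =>
    Nat.one_div_le_one_div h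
  have hlim : Filter.Tendsto (fun m : ℕ => 1 / ((m : ℝ) + 1)) Filter.atTop (nhds 0) :=
    tendsto_one_div_add_atTop_nhds_zero_nat
  have hC : CauchySeq y := by
    refine cauchySeq_of_le_tendsto_0' (fun m : ℕ => (1 / ((m : ℝ) + 1)) * ‖u‖) ?_
      (by simpa using hlim.mul_const ‖u‖)
    intro m k hmk
    rw [dist_eq_norm]
    have h3 : |y m - y k| ≤ |(1 / ((m : ℝ) + 1)) • u| := by
      rw [abs_of_nonneg (smul_nonneg (hnn m) hu0)]
      refine abs_le'.2 ⟨?_, ?_⟩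
      · rw [sub_le_iff_le_add']
        exact (hle m k).trans
          (add_le_add_right (smul_le_smul_of_nonneg_right (hanti hmk) hu0) _)
      · rw [neg_sub, sub_le_iff_le_add']
        exact hle k m
    refine (norm_le_norm_of_abs_le_abs h3).trans ?_
    rw [norm_smul, Real.norm_of_nonneg (hnn m)]
  obtain ⟨s, hs⟩ := cauchySeq_tendsto_of_complete hC
  refine ⟨s, ?_⟩
  rw [hcomb]
  refine ⟨?_, fun z hz => le_of_tendsto' hs fun m => hy2 m z hz⟩
  rintro _ ⟨a, ha, rfl⟩
  refine ge_of_tendsto' (f := fun m : ℕ => y m + (1 / ((m : ℝ) + 1)) • u) (x := Filter.atTop) ?_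
    fun m => hy1 m a ha
  simpa using hs.add (hlim.smul_const u)

/-- The element `(∑ |xᵢ|^q)^{1/q}` of a Banach lattice, for `1 ≤ q < ∞`: the supremum, in the order
of `X`, of all `∑ aᵢ xᵢ` with `a` in the unit ball of `ℓ_{q*}ⁿ`. -/
noncomputable def latticeLqSum (q : ℝ) {n : ℕ} (x : Fin n → X) : X :=
  Classical.choose (exists_isLUB_dualBallCombinations q x)

theorem isLUB_latticeLqSum (q : ℝ) {n : ℕ} (x : Fin n → X) :
    IsLUB (dualBallCombinations q x) (latticeLqSum q x) :=
  Classical.choose_spec (exists_isLUB_dualBallCombinations q x)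

end

/-- `X` satisfies the `q`-concavity inequality with constant `C`. -/
def IsConcaveWith (q : ℝ) (X : Type*) [NormedAddCommGroup X] [NormedSpace ℝ X] [CompleteSpace X]
    [Lattice X] [IsOrderedAddMonoid X] [HasSolidNorm X] [IsOrderedModule ℝ X] (C : ℝ≥0) : Prop :=
  ∀ (n : ℕ) (x : Fin n → X), (∑ i, ‖x i‖ ^ q) ^ (1 / q) ≤ C * ‖latticeLqSum q x‖

/-- The `q`-concavity constant `M_q(X)`; it is `∞` if `X` is not `q`-concave. -/
noncomputable def concavityConstant (q : ℝ) (X : Type*) [NormedAddCommGroup X] [NormedSpace ℝ X]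
    [CompleteSpace X] [Lattice X] [IsOrderedAddMonoid X] [HasSolidNorm X] [IsOrderedModule ℝ X] :
    ℝ≥0∞ :=
  ⨅ (C : ℝ≥0) (_ : IsConcaveWith q X C), (C : ℝ≥0∞)

/-- `f : [0, ∞) → [0, ∞)` is a modulus of continuity for the map `F`. -/
def IsModulusOfContinuity {A B : Type*} [PseudoMetricSpace A] [PseudoMetricSpace B]
    (f : ℝ≥0 → ℝ≥0) (F : A → B) : Prop :=
  Continuous f ∧ f 0 = 0 ∧ ∀ a₁ a₂ : A, nndist (F a₁) (F a₂) ≤ f (nndist a₁ a₂)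

/-! It is enough to map the sphere of a separable `q`-concave lattice `X` onto the sphere of `ℓ₂`,
with moduli depending only on `q` and the concavity constant; the theorem follows by composing
through `ℓ₂`. The map is a generalised Mazur map `x ↦ sgn(x) √ρ`, where `ρ` is the density of `w ↦
φ(|x| w)` for a positive norming functional `φ` of `|x|` (a Lozanovskii factorisation of `ρ`).

To make sense of this, `X` becomes a function space. The ideal generated by a quasi-interior point
`u` is a dense sublattice of some `C(K)` (Kakutani), so `X` is the completion of `C(K)` for a
lattice seminorm. This is renormed to a norm `N` with `q`-concavity constant `1`, and a norming
functional of the constant function is a measure `μ` that places `X` between `L_q(μ)` and `L_1(μ)`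
(`exists_isMeasureRep`). Bounded measurable functions then act on `X`, so indicators, logarithms and
signs are available.

Everything rests on two inequalities for the norming density `ρ` of `x` with `N(x) = 1`: for `w ≥
0`, `∫ ρ w ≤ N(x w)` by choice of `ρ`, and `N(x w)^q ≤ ∫ ρ w^q` because the concavity constant is
`1` (`concaveNorm_rpow_le_functional`). Let `σ` be the density of `y`.

Continuity of `x ↦ ρ`: `N(y (1 + t 1_B))` is at most `1 + t ∫_B σ + O(t²)` and at least `1 + t ∫_B ρ
- 2 N(x - y)`; take `t = √N(x - y)` (`IsNormingDensity.setIntegral_sub_le`).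

Continuity of the inverse: with `r = |y/x|`, the normalisations force `∫ min(ρ, σ) (r + 1/r - 2) ≤
‖ρ - σ‖₁`, so `r` is close to `1` where `ρ` lives (`IsNormingDensity.bmNorm_posPart_le`).

Dense range: a near-maximiser of the entropy `∫ k log x` over the positive sphere has norming
density close to `k` (`IsMeasureRep.exists_density_approx`).

Hence the map extends by completeness to a uniform homeomorphism onto the sphere of `L₂(μ)`.
Separability and infinite dimension pass through it, so `L₂(μ)` is isometric to `ℓ₂`. -/

open scoped NNReal ENNReal Pointwise

set_option linter.unusedSectionVars false

/-! ### Real lattice homomorphisms on a vector lattice with an order unit. -/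

section Characters

variable {E : Type*} [AddCommGroup E] [Module ℝ E] [Lattice E] [IsOrderedAddMonoid E]
  [IsOrderedModule ℝ E]

/-- Sublinear functionals on a vector lattice that preserve finite suprema and are normalised at
`u`. -/
structure IsMaxSublinear (u : E) (p : E → ℝ) : Prop where
  mono : ∀ x y, x ≤ y → p x ≤ p y
  add_le : ∀ x y, p (x + y) ≤ p x + p y
  smul : ∀ (c : ℝ) x, 0 ≤ c → p (c • x) = c * p x
  sup : ∀ x y, p (x ⊔ y) = max (p x) (p y)
  unit : p u = 1
  neg_unit : p (-u) = -1

namespace IsMaxSublinear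

variable {u : E} {p : E → ℝ}

theorem zero (hp : IsMaxSublinear u p) : p 0 = 0 := by
  simpa using hp.smul 0 0 le_rfl

theorem smul_unit (hp : IsMaxSublinear u p) (c : ℝ) : p (c • u) = c := by
  rcases le_total 0 c with hc | hc
  · rw [hp.smul c u hc, hp.unit, mul_one]
  · have := hp.smul (-c) (-u) (by linarith)
    rw [neg_smul_neg, hp.neg_unit] at this
    linarith

/-- Subadditivity with `c • u` gives one inequality and with `(-c) • u` the other, since `p` is
linear on the line through `u`. -/
theorem add_smul_unit (hp : IsMaxSublinear u p) (x : E) (c : ℝ) : p (x + c • u) = p x + c := by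
  have h1 := hp.add_le x (c • u)
  have h2 := hp.add_le (x + c • u) ((-c) • u)
  rw [hp.smul_unit] at h1 h2
  have : x + c • u + (-c) • u = x := by rw [neg_smul]; abel
  rw [this] at h2
  linarith

theorem neg_le (hp : IsMaxSublinear u p) (x : E) : -p (-x) ≤ p x := by
  have := hp.add_le x (-x)
  rw [add_neg_cancel, hp.zero] at this
  linarith

theorem abs_le_of_abs_le (hp : IsMaxSublinear u p) {x : E} {c : ℝ} (hx : |x| ≤ c • u) :
    |p x| ≤ c := by
  have h1 := hp.mono _ _ ((le_abs_self x).trans hx)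
  have h2 := hp.mono _ _ ((neg_le_abs x).trans hx)
  rw [hp.smul_unit] at h1 h2
  have := hp.neg_le x
  exact abs_le.2 ⟨by linarith, h1⟩

/-- Restricting to the set where `w` vanishes. -/
theorem exists_le_of_neg_eq_zero (hp : IsMaxSublinear u p) (hu : ∀ x : E, ∃ c : ℝ, |x| ≤ c • u)
    {w : E} (hw : 0 ≤ w) (hpw : p (-w) = 0) :
    ∃ p' : E → ℝ, IsMaxSublinear u p' ∧ p' ≤ p ∧ ∀ z, p' z ≤ p (z - w) := by
  -- Think of `p` as a maximum over a closed set of characters; `p (-w) = 0` says that `w` vanishes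
  -- somewhere on it. Penalising by `n • w` and letting `n → ∞` leaves the maximum over the part
  -- where `w` vanishes, and `p (-(n • w)) = 0` keeps the decreasing limit finite.
  have hn : ∀ n : ℕ, p (-((n : ℝ) • w)) = 0 := fun n => by
    rw [← smul_neg, hp.smul _ _ n.cast_nonneg, hpw, mul_zero]
  have hanti : ∀ z, Antitone fun n : ℕ => p (z - (n : ℝ) • w) := fun z m n hmn =>
    hp.mono _ _ (sub_le_sub_left (smul_le_smul_of_nonneg_right (by exact_mod_cast hmn) hw) _)
  have hbdd : ∀ z, BddBelow (Set.range fun n : ℕ => p (z - (n : ℝ) • w)) := fun z => by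
    obtain ⟨c, hc⟩ := hu z
    refine ⟨-c, ?_⟩
    rintro _ ⟨n, rfl⟩
    have h1 := hp.add_le (z - (n : ℝ) • w) (-z)
    have : z - (n : ℝ) • w + -z = -((n : ℝ) • w) := by abel
    rw [this, hn] at h1
    have h2 := abs_le.1 (hp.abs_le_of_abs_le (x := -z) (c := c) (by rwa [abs_neg]))
    dsimp only
    linarith [h2.2]
  have hlim : ∀ z, Filter.Tendsto (fun n : ℕ => p (z - (n : ℝ) • w)) Filter.atTop
      (nhds (⨅ n : ℕ, p (z - (n : ℝ) • w))) := fun z =>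
    tendsto_atTop_ciInf (hanti z) (hbdd z)
  refine ⟨fun z => ⨅ n : ℕ, p (z - (n : ℝ) • w), ⟨?_, ?_, ?_, ?_, ?_, ?_⟩, ?_, ?_⟩
  · intro x y hxy
    exact le_of_tendsto_of_tendsto' (hlim x) (hlim y) fun n => hp.mono _ _ (sub_le_sub_right hxy _)
  · intro x y
    -- Along even indices the penalty splits equally between `x` and `y`.
    have h2 : Filter.Tendsto (fun n : ℕ => p (x + y - ((n + n : ℕ) : ℝ) • w)) Filter.atTop
        (nhds (⨅ n : ℕ, p (x + y - (n : ℝ) • w))) :=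
      (hlim (x + y)).comp (Filter.tendsto_atTop_mono (fun n => Nat.le_add_right n n) Filter.tendsto_id)
    refine le_of_tendsto_of_tendsto' h2 ((hlim x).add (hlim y)) fun n => ?_
    have : x + y - ((n + n : ℕ) : ℝ) • w = (x - (n : ℝ) • w) + (y - (n : ℝ) • w) := by
      push_cast; rw [add_smul]; abel
    rw [this]
    exact hp.add_le _ _
  · intro c x hc
    rcases hc.eq_or_lt with rfl | hc'
    · simp [hn]
    -- Scaling by `c` turns the penalty `n` into `c * n`, not an integer in general; it is rounded
    -- up, which only lowers the value.
    refine le_antisymm ?_ ?_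
    · refine ge_of_tendsto' ((hlim x).const_mul c) fun n => ?_
      obtain ⟨m, hm⟩ := exists_nat_ge (c * n)
      refine (ciInf_le (hbdd _) m).trans ?_
      rw [← hp.smul _ _ hc, smul_sub, smul_smul]
      exact hp.mono _ _ (sub_le_sub_left (smul_le_smul_of_nonneg_right hm hw) _)
    · refine ge_of_tendsto' (hlim (c • x)) fun n => ?_
      obtain ⟨m, hm⟩ := exists_nat_ge (c⁻¹ * n)
      have h1 := ciInf_le (hbdd x) m
      refine (mul_le_mul_of_nonneg_left h1 hc).trans ?_
      rw [← hp.smul _ _ hc, smul_sub, smul_smul]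
      refine hp.mono _ _ (sub_le_sub_left (smul_le_smul_of_nonneg_right ?_ hw) _)
      calc (n : ℝ) = c * (c⁻¹ * n) := by field_simp
        _ ≤ c * m := mul_le_mul_of_nonneg_left hm hc
  · intro x y
    refine tendsto_nhds_unique (hlim (x ⊔ y)) (((hlim x).max (hlim y)).congr fun n => ?_)
    rw [← hp.sup]
    congr 1
    simp only [sub_eq_add_neg, sup_add]
  · have : ∀ n : ℕ, p (u - (n : ℝ) • w) = 1 := fun n => by
      have := hp.add_smul_unit (-((n : ℝ) • w)) 1
      rw [hn, one_smul, zero_add] at this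
      rw [← this]; congr 1; abel
    simp [this]
  · have : ∀ n : ℕ, p (-u - (n : ℝ) • w) = -1 := fun n => by
      have := hp.add_smul_unit (-((n : ℝ) • w)) (-1)
      rw [hn, neg_smul, one_smul, zero_add] at this
      rw [← this]; congr 1; abel
    simp [this]
  · intro z
    simpa using ciInf_le (hbdd z) 0
  · intro z
    simpa using ciInf_le (hbdd z) 1

/-- Put `a = y - p y • u`, so `p a = 0` and the positive part in question is `a⁻`. Preservation of
suprema gives `p (a⁺) = 0`, and then `0 = p a ≤ p (a⁺) + p (-a⁻)`. This supplies the `w` for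
`exists_le_of_neg_eq_zero`: restricting to its zeros means restricting to where `y` attains its
maximum `p y`. -/
theorem neg_posPart_eq_zero (hp : IsMaxSublinear u p) (y : E) : p (-(p y • u - y)⁺) = 0 := by
  refine le_antisymm ?_ ?_
  · rw [← hp.zero]
    exact hp.mono _ _ (neg_nonpos.2 (posPart_nonneg _))
  · set a := y - p y • u with ha
    have h0 : p a = 0 := by
      have := hp.add_smul_unit y (-p y)
      rw [neg_smul, ← sub_eq_add_neg] at this
      rw [ha, this]; ring
    have h1 : (p y • u - y)⁺ = a⁻ := by
      rw [← posPart_neg, ha, neg_sub]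
    have h2 : p (a⁺) = 0 := by
      rw [posPart_def, hp.sup, h0, hp.zero, max_self]
    have h3 := hp.add_le (a⁺) (-a⁻)
    rw [← sub_eq_add_neg, posPart_sub_negPart, h0, h2, zero_add] at h3
    rwa [h1]

/-- Zorn's lemma: a chain has its pointwise infimum as lower bound. The infimum is finite because
the order unit bounds all values, and it keeps subadditivity and maxima because a chain is directed
downwards. -/
theorem exists_minimal_le (hp : IsMaxSublinear u p) (hu : ∀ x : E, ∃ c : ℝ, |x| ≤ c • u) :
    ∃ m, IsMaxSublinear u m ∧ m ≤ p ∧ ∀ p', IsMaxSublinear u p' → p' ≤ m → p' = m := by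
  have hchain : ∀ c ⊆ {p : (E → ℝ)ᵒᵈ | IsMaxSublinear u (OrderDual.ofDual p)},
      IsChain (· ≤ ·) c → ∀ y ∈ c,
        ∃ ub ∈ {p : (E → ℝ)ᵒᵈ | IsMaxSublinear u (OrderDual.ofDual p)}, ∀ z ∈ c, z ≤ ub := by
    intro c hc hch y hy
    have : Nonempty c := ⟨⟨y, hy⟩⟩
    let P : c → E → ℝ := fun i => OrderDual.ofDual i.1
    have hP : ∀ i, IsMaxSublinear u (P i) := fun i => hc i.2
    have hbdd : ∀ z, BddBelow (Set.range fun i => P i z) := fun z => by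
      obtain ⟨b, hb⟩ := hu z
      refine ⟨-b, ?_⟩
      rintro _ ⟨i, rfl⟩
      exact (abs_le.1 ((hP i).abs_le_of_abs_le hb)).1
    have hdir : ∀ i j, ∃ k, P k ≤ P i ∧ P k ≤ P j := fun i j => by
      rcases hch.total i.2 j.2 with h | h
      · exact ⟨j, h, le_rfl⟩
      · exact ⟨i, le_rfl, h⟩
    refine ⟨OrderDual.toDual fun z => ⨅ i, P i z, ⟨?_, ?_, ?_, ?_, ?_, ?_⟩, ?_⟩
    · intro x y hxy
      exact ciInf_mono (hbdd x) fun i => (hP i).mono _ _ hxy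
    · intro x y
      refine le_ciInf_add_ciInf fun i j => ?_
      obtain ⟨k, hi, hj⟩ := hdir i j
      exact (ciInf_le (hbdd _) k).trans (((hP k).add_le x y).trans (add_le_add (hi x) (hj y)))
    · intro a x ha
      change (⨅ i, P i (a • x)) = a * ⨅ i, P i x
      rw [Real.mul_iInf_of_nonneg ha]
      exact iInf_congr fun i => (hP i).smul a x ha
    · intro x y
      change (⨅ i, P i (x ⊔ y)) = max (⨅ i, P i x) (⨅ i, P i y)
      refine le_antisymm ?_ (max_le (ciInf_mono (hbdd x) fun i => (hP i).mono _ _ le_sup_left)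
        (ciInf_mono (hbdd y) fun i => (hP i).mono _ _ le_sup_right))
      refine le_of_forall_pos_lt_add fun ε hε => ?_
      obtain ⟨i, hi⟩ := exists_lt_of_ciInf_lt (lt_add_of_pos_right (⨅ i, P i x) hε)
      obtain ⟨j, hj⟩ := exists_lt_of_ciInf_lt (lt_add_of_pos_right (⨅ i, P i y) hε)
      obtain ⟨k, hki, hkj⟩ := hdir i j
      refine (ciInf_le (hbdd _) k).trans_lt ?_
      rw [(hP k).sup, ← max_add_add_right]
      exact max_lt_max ((hki x).trans_lt hi) ((hkj y).trans_lt hj)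
    · change (⨅ i, P i u) = 1
      simp [(hP _).unit]
    · change (⨅ i, P i (-u)) = -1
      simp [(hP _).neg_unit]
    · intro z hz x
      exact ciInf_le (hbdd x) ⟨z, hz⟩
  obtain ⟨m, hpm, hm⟩ := zorn_le_nonempty₀ _ hchain (OrderDual.toDual p) hp
  exact ⟨OrderDual.ofDual m, hm.1, hpm, fun p' hp' hle => le_antisymm hle (hm.2 hp' hle)⟩

end IsMaxSublinear

/-- Real lattice homomorphisms on `E` that take the value `1` at `u`. -/
def latticeCharacters (u : E) : Set (E → ℝ) :=
  {φ | (∀ x y, φ (x + y) = φ x + φ y) ∧ (∀ (c : ℝ) x, φ (c • x) = c * φ x) ∧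
    (∀ x y, φ (x ⊔ y) = max (φ x) (φ y)) ∧ φ u = 1}

/-- A minimal `p` is unchanged by restriction to where `y` attains its maximum. With `z = p y • u -
y` this reads `p z ≤ p (z - z⁺) ≤ 0`, that is `p (-y) ≤ -p y`. So `p` is odd, and an odd sublinear
functional is linear. -/
theorem IsMaxSublinear.mem_latticeCharacters {u : E} {p : E → ℝ} (hp : IsMaxSublinear u p)
    (hu : ∀ x : E, ∃ c : ℝ, |x| ≤ c • u)
    (hmin : ∀ p', IsMaxSublinear u p' → p' ≤ p → p' = p) : p ∈ latticeCharacters u := by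
  have hneg : ∀ y, p (-y) = -p y := by
    intro y
    refine le_antisymm ?_ (by linarith [hp.neg_le (-y), congrArg p (neg_neg y)])
    obtain ⟨p', hp', hle, hw⟩ :=
      hp.exists_le_of_neg_eq_zero hu (posPart_nonneg (p y • u - y)) (hp.neg_posPart_eq_zero y)
    have h1 := hw (p y • u - y)
    rw [hmin p' hp' hle] at h1
    have h2 : p (p y • u - y - (p y • u - y)⁺) ≤ 0 := by
      rw [← hp.zero]
      exact hp.mono _ _ (sub_nonpos.2 (le_posPart _))
    have h3 := hp.add_smul_unit (-y) (p y)
    rw [show -y + p y • u = p y • u - y by abel] at h3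
    linarith
  refine ⟨fun x y => le_antisymm (hp.add_le x y) ?_, fun c x => ?_, hp.sup, hp.unit⟩
  · have := hp.add_le (x + y) (-y)
    rw [add_neg_cancel_right, hneg] at this
    linarith
  · rcases le_total 0 c with hc | hc
    · exact hp.smul c x hc
    · have := hp.smul (-c) x (by linarith)
      rw [neg_smul, hneg] at this
      linarith

/-- The one-sided gauge of `u`, which plays the role of the maximum over all characters and starts
the minimisation. Since `u ≠ 0`, the order on `ℝ u` is that of `ℝ`, so the gauge is exact there. -/
theorem isMaxSublinear_sInf {u : E} (hu0 : 0 ≤ u) (hu1 : u ≠ 0)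
    (hu : ∀ x : E, ∃ c : ℝ, |x| ≤ c • u) :
    IsMaxSublinear u fun x => sInf {c : ℝ | x ≤ c • u} := by
  have hlt : ∀ a b : ℝ, a • u ≤ b • u → a ≤ b := fun a b h => by
    by_contra hab
    push Not at hab
    have h1 : (a - b) • u ≤ 0 := by rw [sub_smul]; exact sub_nonpos.2 h
    have h2 : 0 ≤ (a - b) • u := smul_nonneg (by linarith) hu0
    exact (smul_ne_zero (by linarith) hu1) (le_antisymm h1 h2)
  have hne : ∀ x, {c : ℝ | x ≤ c • u}.Nonempty := fun x => by
    obtain ⟨c, hc⟩ := hu x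
    exact ⟨c, (le_abs_self x).trans hc⟩
  have hbdd : ∀ x, BddBelow {c : ℝ | x ≤ c • u} := fun x => by
    obtain ⟨c, hc⟩ := hu x
    refine ⟨-c, fun a ha => hlt _ _ ?_⟩
    rw [neg_smul]
    exact (neg_le_neg hc).trans ((neg_le.1 (neg_le_abs x)).trans ha)
  have hup : ∀ x (a b : ℝ), a ≤ b → x ≤ a • u → x ≤ b • u := fun x a b hab h =>
    h.trans (smul_le_smul_of_nonneg_right hab hu0)
  have hval : ∀ a : ℝ, sInf {c : ℝ | a • u ≤ c • u} = a := fun a =>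
    IsLeast.csInf_eq ⟨le_rfl, fun c hc => hlt _ _ hc⟩
  refine ⟨?_, ?_, ?_, ?_, ?_, ?_⟩
  · intro x y hxy
    exact csInf_le_csInf (hbdd x) (hne y) fun c hc => hxy.trans hc
  · intro x y
    refine le_of_forall_pos_le_add fun ε hε => ?_
    obtain ⟨a, ha, ha'⟩ := exists_lt_of_csInf_lt (hne x) (lt_add_of_pos_right _ (half_pos hε))
    obtain ⟨b, hb, hb'⟩ := exists_lt_of_csInf_lt (hne y) (lt_add_of_pos_right _ (half_pos hε))
    refine (csInf_le (hbdd _) (show x + y ≤ (a + b) • u from ?_)).trans (by linarith)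
    rw [add_smul]
    exact add_le_add ha hb
  · intro c x hc
    rcases hc.eq_or_lt with rfl | hc
    · have := hval 0
      simp only [zero_smul] at this
      simp [this]
    · have : {a : ℝ | c • x ≤ a • u} = c • {a : ℝ | x ≤ a • u} := by
        ext a
        rw [Set.mem_smul_set_iff_inv_smul_mem₀ hc.ne']
        simp only [Set.mem_ofPred_eq, smul_assoc]
        exact (le_inv_smul_iff_of_pos hc).symm
      rw [this, Real.sInf_smul_of_nonneg hc.le, smul_eq_mul]
  · intro x y
    refine le_antisymm ?_ (max_le (csInf_le_csInf (hbdd x) (hne _) fun c hc => le_sup_left.trans hc)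
      (csInf_le_csInf (hbdd y) (hne _) fun c hc => le_sup_right.trans hc))
    refine le_of_forall_pos_le_add fun ε hε => ?_
    obtain ⟨a, ha, ha'⟩ := exists_lt_of_csInf_lt (hne x) (lt_add_of_pos_right _ hε)
    obtain ⟨b, hb, hb'⟩ := exists_lt_of_csInf_lt (hne y) (lt_add_of_pos_right _ hε)
    refine (csInf_le (hbdd _) (show x ⊔ y ≤ (max a b) • u from ?_)).trans ?_
    · exact sup_le (hup _ _ _ (le_max_left _ _) ha) (hup _ _ _ (le_max_right _ _) hb)
    · rw [← max_add_add_right]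
      exact max_le_max ha'.le hb'.le
  · simpa using hval 1
  · simpa using hval (-1)

/-- The characters of a vector lattice with an order unit are norming. -/
theorem exists_latticeCharacter_ge {u : E} (hu0 : 0 ≤ u) (hu1 : u ≠ 0)
    (hu : ∀ x : E, ∃ c : ℝ, |x| ≤ c • u) (x : E) :
    ∃ φ ∈ latticeCharacters u, ∀ c : ℝ, φ x < c → x ≤ c • u := by
  have hp := isMaxSublinear_sInf hu0 hu1 hu
  set p : E → ℝ := fun x => sInf {c : ℝ | x ≤ c • u} with hpdef
  -- Restrict the gauge to where `x` attains its maximum before minimising; every functional below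
  -- `p'` then still takes at least the value `p x` at `x`.
  obtain ⟨p', hp', -, hw⟩ :=
    hp.exists_le_of_neg_eq_zero hu (posPart_nonneg (p x • u - x)) (hp.neg_posPart_eq_zero x)
  obtain ⟨m, hm, hle, hmin⟩ := hp'.exists_minimal_le hu
  have hmc := hm.mem_latticeCharacters hu hmin
  refine ⟨m, hmc, fun c hc => ?_⟩
  have h1 : m (p x • u - x) ≤ 0 := by
    refine (hm.mono _ _ (le_posPart _)).trans ((hle _).trans ((hw _).trans ?_))
    rw [sub_self, hp.zero]
  have h2 : m (p x • u - x) + m x = p x := by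
    rw [← hmc.1, sub_add_cancel, hm.smul_unit]
  have h3 : p x < c := by linarith
  obtain ⟨a, ha, hac⟩ := exists_lt_of_csInf_lt
    (by obtain ⟨b, hb⟩ := hu x; exact ⟨b, (le_abs_self x).trans hb⟩) h3
  exact le_trans ha (smul_le_smul_of_nonneg_right hac.le hu0)

end Characters

/-! ### A separable Banach lattice as a completion of `C(K)`. -/

section Representation

variable {X : Type*} [NormedAddCommGroup X] [NormedSpace ℝ X] [Lattice X] [IsOrderedAddMonoid X]
  [HasSolidNorm X] [IsOrderedModule ℝ X]

theorem abs_smul_le_abs_smul_abs {X : Type*} [AddCommGroup X] [Module ℝ X] [Lattice X]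
    [IsOrderedAddMonoid X] [IsOrderedModule ℝ X] (a : ℝ) (x : X) : |a • x| ≤ |a| • |x| := by
  have key : ∀ y : X, |y| ≤ |x| → -|x| ≤ y → a • y ≤ |a| • |x| := by
    intro y hy hy'
    rcases le_total 0 a with h | h
    · rw [abs_of_nonneg h]
      exact smul_le_smul_of_nonneg_left ((le_abs_self y).trans hy) h
    · rw [abs_of_nonpos h, ← neg_smul_neg a y]
      exact smul_le_smul_of_nonneg_left (neg_le.1 hy') (neg_nonneg.2 h)
  refine abs_le'.2 ⟨key x le_rfl (neg_le.1 (neg_le_abs x)), ?_⟩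
  rw [← smul_neg]
  exact key (-x) (by rw [abs_neg]) (neg_le_neg (le_abs_self x))

/-- The order ideal generated by `u`. -/
def orderIdeal (u : X) : Submodule ℝ X where
  carrier := {x | ∃ c : ℝ, |x| ≤ c • u}
  add_mem' := by
    rintro x y ⟨a, ha⟩ ⟨b, hb⟩
    exact ⟨a + b, (abs_add_le x y).trans (by rw [add_smul]; exact add_le_add ha hb)⟩
  zero_mem' := ⟨0, by simp⟩
  smul_mem' := by
    rintro c x ⟨a, ha⟩
    refine ⟨|c| * a, (abs_smul_le_abs_smul_abs c x).trans ?_⟩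
    rw [mul_smul]
    exact smul_le_smul_of_nonneg_left ha (abs_nonneg c)

theorem sup_mem_orderIdeal {u : X} {x y : X} (hx : x ∈ orderIdeal u)
    (hy : y ∈ orderIdeal u) : x ⊔ y ∈ orderIdeal u := by
  obtain ⟨a, ha⟩ := hx
  obtain ⟨b, hb⟩ := hy
  refine ⟨a + b, ?_⟩
  rw [add_smul]
  refine le_trans ?_ (add_le_add ha hb)
  refine abs_le'.2 ⟨sup_le ?_ ?_, ?_⟩
  · exact (le_abs_self x).trans (le_add_of_nonneg_right (abs_nonneg y))
  · exact (le_abs_self y).trans (le_add_of_nonneg_left (abs_nonneg x))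
  · exact (neg_le_neg le_sup_left).trans
      ((neg_le_abs x).trans (le_add_of_nonneg_right (abs_nonneg y)))

theorem inf_mem_orderIdeal {u : X} {x y : X} (hx : x ∈ orderIdeal u)
    (hy : y ∈ orderIdeal u) : x ⊓ y ∈ orderIdeal u := by
  have := Submodule.neg_mem _ (sup_mem_orderIdeal (Submodule.neg_mem _ hx) (Submodule.neg_mem _ hy))
  rwa [neg_sup, neg_neg, neg_neg] at this

instance orderIdeal.instLattice (u : X) : Lattice (orderIdeal u) :=
  Subtype.lattice (fun _ _ => sup_mem_orderIdeal) (fun _ _ => inf_mem_orderIdeal)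

instance orderIdeal.instIsOrderedAddMonoid (u : X) :
    IsOrderedAddMonoid (orderIdeal u) where
  add_le_add_left a b h c := add_le_add_left (show (a : X) ≤ b from h) (c : X)

instance orderIdeal.instIsOrderedModule (u : X) :
    IsOrderedModule ℝ (orderIdeal u) where
  smul_le_smul_of_nonneg_left c hc a b h := by
    change c • (a : X) ≤ c • (b : X)
    exact smul_le_smul_of_nonneg_left (show (a : X) ≤ b from h) hc
  smul_le_smul_of_nonneg_right a ha c d h := by
    change c • (a : X) ≤ d • (a : X)
    exact smul_le_smul_of_nonneg_right h (show (0 : X) ≤ a from ha)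

/-- A quasi-interior point: a convergent sum of positive multiples of `|d n|`, for a dense sequence
`d`, dominates a positive multiple of each `|d n|`. -/
theorem exists_dense_orderIdeal [CompleteSpace X] [TopologicalSpace.SeparableSpace X] :
    ∃ u : X, 0 ≤ u ∧ Dense (orderIdeal u : Set X) := by
  set d := TopologicalSpace.denseSeq X
  set c : ℕ → ℝ := fun n => (1 / 2) ^ n * (1 + ‖d n‖)⁻¹ with hc
  have hcpos : ∀ n, 0 < c n := fun n => by positivity
  have hsum : Summable fun n => c n • |d n| := by
    refine Summable.of_norm_bounded summable_geometric_two fun n => ?_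
    rw [norm_smul, norm_abs_eq_norm, Real.norm_of_nonneg (hcpos n).le, hc, mul_assoc]
    refine mul_le_of_le_one_right (by positivity) ?_
    rw [inv_mul_le_iff₀ (by positivity)]
    linarith
  have hnn : ∀ n, 0 ≤ c n • |d n| := fun n => smul_nonneg (hcpos n).le (abs_nonneg _)
  refine ⟨∑' n, c n • |d n|, tsum_nonneg hnn, ?_⟩
  refine (TopologicalSpace.denseRange_denseSeq X).mono ?_
  rintro _ ⟨n, rfl⟩
  refine ⟨(c n)⁻¹, ?_⟩
  rw [le_inv_smul_iff_of_pos (hcpos n)]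
  exact hsum.le_tsum n fun j _ => hnn j

section

variable {E : Type*} [AddCommGroup E] [Module ℝ E] [Lattice E] [IsOrderedAddMonoid E]
  [IsOrderedModule ℝ E]

/-- Characters are monotone, so the order unit confines them to a product of compact intervals, in
which their defining equations are closed. -/
theorem compactSpace_latticeCharacters {u : E} (hu : ∀ x : E, ∃ c : ℝ, |x| ≤ c • u) :
    CompactSpace (latticeCharacters u) := by
  rw [← isCompact_iff_compactSpace]
  choose c hc using hu
  have hsub : latticeCharacters u ⊆ Set.univ.pi fun x => Set.Icc (-c x) (c x) := by
    rintro φ ⟨hadd, hsmul, hsup, hone⟩ x -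
    have hmono : ∀ x y, x ≤ y → φ x ≤ φ y := fun x y h => by
      rw [← sup_eq_right.2 h, hsup]; exact le_max_left _ _
    have h1 := hmono _ _ ((le_abs_self x).trans (hc x))
    have h2 := hmono _ _ ((neg_le_abs x).trans (hc x))
    rw [hsmul, hone] at h1 h2
    have h3 := hsmul (-1) x
    rw [neg_one_smul] at h3
    exact ⟨by linarith, by linarith⟩
  refine (isCompact_univ_pi fun x => isCompact_Icc).of_isClosed_subset ?_ hsub
  simp only [latticeCharacters, Set.ofPred_and, Set.ofPred_forall]
  refine IsClosed.inter ?_ (IsClosed.inter ?_ (IsClosed.inter ?_ ?_))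
  · exact isClosed_iInter fun x => isClosed_iInter fun y =>
      isClosed_eq (continuous_apply _) ((continuous_apply x).add (continuous_apply y))
  · exact isClosed_iInter fun a => isClosed_iInter fun y =>
      isClosed_eq (continuous_apply _) (continuous_const.mul (continuous_apply _))
  · exact isClosed_iInter fun x => isClosed_iInter fun y =>
      isClosed_eq (continuous_apply _) ((continuous_apply x).max (continuous_apply y))
  · exact isClosed_eq (continuous_apply _) continuous_const

/-- Evaluation of elements of `E` at the characters. -/
def latticeEval (u : E) : E →ₗ[ℝ] C(latticeCharacters u, ℝ) where
  toFun x := ⟨fun φ => φ.1 x, (continuous_apply x).comp continuous_subtype_val⟩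
  map_add' x y := by ext φ; exact φ.2.1 x y
  map_smul' c x := by ext φ; exact φ.2.2.1 c x

@[simp] theorem latticeEval_apply (u x : E) (φ : latticeCharacters u) :
    latticeEval u x φ = φ.1 x := rfl

theorem latticeEval_sup (u x y : E) :
    latticeEval u (x ⊔ y) = latticeEval u x ⊔ latticeEval u y := by
  ext φ; exact φ.2.2.2.1 x y

theorem latticeEval_inf (u x y : E) :
    latticeEval u (x ⊓ y) = latticeEval u x ⊓ latticeEval u y := by
  rw [← neg_neg (x ⊓ y), neg_inf, map_neg, latticeEval_sup, map_neg, map_neg, neg_sup, neg_neg,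
    neg_neg]

theorem latticeEval_abs (u x : E) : latticeEval u |x| = |latticeEval u x| := by
  rw [abs, abs, latticeEval_sup, map_neg]

/-- Lattice form of Stone–Weierstrass: the range is a sublattice, and two prescribed values at
distinct characters are interpolated by `u` and an element separating them. -/
theorem denseRange_latticeEval {u : E} (hu : ∀ x : E, ∃ c : ℝ, |x| ≤ c • u) :
    DenseRange (latticeEval u) := by
  have := compactSpace_latticeCharacters hu
  rw [DenseRange, dense_iff_closure_eq]
  refine ContinuousMap.sublattice_closure_eq_top _ ⟨_, 0, rfl⟩ ?_ ?_ ?_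
  · rintro _ ⟨x, rfl⟩ _ ⟨y, rfl⟩
    exact ⟨x ⊓ y, latticeEval_inf u x y⟩
  · rintro _ ⟨x, rfl⟩ _ ⟨y, rfl⟩
    exact ⟨x ⊔ y, latticeEval_sup u x y⟩
  · intro v φ ψ
    by_cases h : φ = ψ
    · subst h
      refine ⟨_, ⟨v φ • u, rfl⟩, ?_⟩
      simp [φ.2.2.2.2]
    · obtain ⟨x, hx⟩ : ∃ x, φ.1 x ≠ ψ.1 x := by
        by_contra! hcon
        exact h (Subtype.ext (funext hcon))
      have hx' : φ.1 x - ψ.1 x ≠ 0 := sub_ne_zero.2 hx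
      set a := (v φ - v ψ) / (φ.1 x - ψ.1 x) with ha
      have ha' : a * (φ.1 x - ψ.1 x) = v φ - v ψ := by rw [ha]; field_simp
      refine ⟨_, ⟨a • x + (v φ - a * φ.1 x) • u, rfl⟩, ?_, ?_⟩
      · simp [φ.2.2.2.2]
      · simp only [map_add, map_smul, ContinuousMap.add_apply, ContinuousMap.smul_apply,
          latticeEval_apply, ψ.2.2.2.2, smul_eq_mul, mul_one]
        linarith

end

/-- Since characters are norming, `|x|` lies below any multiple of `u` larger than the sup norm of
its evaluation; solidity of the norm finishes. -/
theorem norm_le_norm_latticeEval {u : X} (hu : 0 ≤ u) (hu1 : u ≠ 0)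
    [CompactSpace (latticeCharacters (⟨u, 1, by simp [abs_of_nonneg hu]⟩ : orderIdeal u))]
    (x : orderIdeal u) :
    ‖(x : X)‖ ≤ ‖u‖ * ‖latticeEval (⟨u, 1, by simp [abs_of_nonneg hu]⟩ : orderIdeal u) x‖ := by
  set e : orderIdeal u := ⟨u, 1, by simp [abs_of_nonneg hu]⟩ with he
  have hunit : ∀ x : orderIdeal u, ∃ c : ℝ, |x| ≤ c • e := fun x => x.2
  have he0 : 0 ≤ e := hu
  have he1 : e ≠ 0 := fun h => hu1 (congrArg Subtype.val h)
  obtain ⟨φ, hφ, hc⟩ := exists_latticeCharacter_ge he0 he1 hunit |x|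
  have h1 : φ |x| ≤ ‖latticeEval e x‖ := by
    have := (latticeEval e x).norm_coe_le_norm ⟨φ, hφ⟩
    have h2 : latticeEval e |x| ⟨φ, hφ⟩ = |latticeEval e x| ⟨φ, hφ⟩ := by rw [latticeEval_abs]
    rw [ContinuousMap.abs_apply] at h2
    exact (le_of_eq h2).trans this
  refine le_of_forall_pos_le_add fun ε hε => ?_
  have hu' : 0 < ‖u‖ := norm_pos_iff.2 hu1
  have h3 : |x| ≤ (‖latticeEval e x‖ + ε / ‖u‖) • e :=
    hc _ (h1.trans_lt (lt_add_of_pos_right _ (by positivity)))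
  have h4 : |(x : X)| ≤ (‖latticeEval e x‖ + ε / ‖u‖) • u := h3
  have h5 : (0 : ℝ) ≤ ‖latticeEval e x‖ + ε / ‖u‖ := by positivity
  have h6 := norm_le_norm_of_abs_le_abs (h4.trans (le_abs_self _))
  rw [norm_smul, Real.norm_of_nonneg h5] at h6
  refine h6.trans (le_of_eq ?_)
  rw [add_mul, div_mul_cancel₀ _ hu'.ne', mul_comm]

/-- A separable Banach lattice is the completion of a space of continuous functions under a
lattice seminorm. -/
theorem exists_continuousMap_latticeHom.{u} (X : Type u) [NormedAddCommGroup X] [NormedSpace ℝ X]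
    [CompleteSpace X] [Lattice X] [IsOrderedAddMonoid X] [HasSolidNorm X] [IsOrderedModule ℝ X]
    [TopologicalSpace.SeparableSpace X] [Nontrivial X] :
    ∃ (K : Type u) (_ : TopologicalSpace K) (_ : CompactSpace K) (_ : T2Space K)
      (T : C(K, ℝ) →L[ℝ] X), (∀ f, T |f| = |T f|) ∧ DenseRange T := by
  obtain ⟨u, hu, hd⟩ := exists_dense_orderIdeal (X := X)
  have hu1 : u ≠ 0 := by
    rintro rfl
    obtain ⟨x, hx⟩ := exists_ne (0 : X)
    have hbot : (orderIdeal (0 : X) : Set X) ⊆ {0} := by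
      rintro y ⟨c, hc⟩
      rw [smul_zero] at hc
      exact norm_eq_zero.1 (by
        rw [← norm_abs_eq_norm, le_antisymm hc (abs_nonneg y), norm_zero])
    have := (hd.mono hbot) x
    rw [closure_singleton] at this
    exact hx this
  set e : orderIdeal u := ⟨u, 1, by simp [abs_of_nonneg hu]⟩ with he
  have hunit : ∀ x : orderIdeal u, ∃ c : ℝ, |x| ≤ c • e := fun x => x.2
  have hK := compactSpace_latticeCharacters hunit
  have hdense := denseRange_latticeEval hunit
  have hnorm : ∃ C, ∀ x, ‖(orderIdeal u).subtype x‖ ≤ C * ‖latticeEval e x‖ :=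
    ⟨‖u‖, fun x => norm_le_norm_latticeEval hu hu1 x⟩
  -- `T` inverts evaluation on its dense range and is extended by continuity. The identity `T |f| =
  -- |T f|` then also passes from evaluations to all of `C(K)`.
  set T := (orderIdeal u).subtype.extendOfNorm (latticeEval e) with hT
  have hTe : ∀ x : orderIdeal u, T (latticeEval e x) = x :=
    LinearMap.extendOfNorm_eq hdense hnorm
  refine ⟨latticeCharacters e, inferInstance, hK, inferInstance, T, ?_, ?_⟩
  · have habs : Continuous fun f : C(latticeCharacters e, ℝ) => |f| := by
      refine LipschitzWith.continuous (K := 1) (LipschitzWith.of_dist_le_mul fun f g => ?_)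
      rw [NNReal.coe_one, one_mul, ContinuousMap.dist_le dist_nonneg]
      intro φ
      simp only [ContinuousMap.abs_apply]
      exact (abs_abs_sub_abs_le _ _).trans (ContinuousMap.dist_apply_le_dist (f := f) (g := g) φ)
    have habs' : Continuous fun x : X => |x| := by
      have : Continuous fun x : X => x ⊔ -x := continuous_id.sup continuous_neg
      exact this
    intro f
    refine hdense.induction_on f (isClosed_eq (T.continuous.comp habs)
      (habs'.comp T.continuous)) fun x => ?_
    rw [← latticeEval_abs, hTe, hTe]
    rfl
  · refine Dense.mono ?_ hd
    intro x hx
    exact ⟨latticeEval e ⟨x, hx⟩, hTe _⟩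

end Representation

/-! ### Renorming to `q`-concavity constant one. -/

section ConcaveNorm

variable {Ω X : Type*} [NormedAddCommGroup X] [NormedSpace ℝ X]

/-- A linear map `T` on a space `A` of bounded functions, closed under continuous operations, such
that `f ↦ ‖T f‖` is a `q`-concave lattice seminorm with constant `C`. -/
structure IsConcaveRep (A : Submodule ℝ (Ω → ℝ)) (T : (Ω → ℝ) →ₗ[ℝ] X) (q C : ℝ) : Prop where
  comp : ∀ f ∈ A, ∀ g ∈ A, ∀ Φ : ℝ → ℝ → ℝ, Continuous (Function.uncurry Φ) →
    (fun ω => Φ (f ω) (g ω)) ∈ A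
  bdd : ∀ f ∈ A, ∃ c : ℝ, ∀ ω, |f ω| ≤ c
  one_le_q : 1 ≤ q
  one_le_C : 1 ≤ C
  mono : ∀ f ∈ A, ∀ g ∈ A, (∀ ω, |f ω| ≤ |g ω|) → ‖T f‖ ≤ ‖T g‖
  concave : ∀ (n : ℕ) (g : Fin n → Ω → ℝ), (∀ i, g i ∈ A) → ∀ f ∈ A,
    (∀ ω, ∑ i, |g i ω| ^ q ≤ |f ω| ^ q) → ∑ i, ‖T (g i)‖ ^ q ≤ (C * ‖T f‖) ^ q

/-- The sums whose supremum is the `q`-th power of the `q`-concave renorming. -/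
def concaveSums (A : Submodule ℝ (Ω → ℝ)) (T : (Ω → ℝ) →ₗ[ℝ] X) (q : ℝ) (f : Ω → ℝ) : Set ℝ :=
  {r | ∃ (n : ℕ) (g : Fin n → Ω → ℝ), (∀ i, g i ∈ A) ∧ (∀ ω, ∑ i, |g i ω| ^ q ≤ |f ω| ^ q) ∧
    r = ∑ i, ‖T (g i)‖ ^ q}

/-- An equivalent norm whose `q`-concavity constant is `1`. -/
noncomputable def concaveNorm (A : Submodule ℝ (Ω → ℝ)) (T : (Ω → ℝ) →ₗ[ℝ] X) (q : ℝ)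
    (f : Ω → ℝ) : ℝ :=
  sSup (concaveSums A T q f) ^ (1 / q)

/-- Bernoulli applied to `(1 - s)⁻¹ = 1 + s / (1 - s)` bounds `(1 - s) ^ (-1/q)` by `1 + y` with `y
= (s + 2 s²) / q`, and `1 - y ≤ 1 / (1 + y)` when `y > -1`. It is a first-order expansion with
explicit quadratic error, for the supergradient inequality below. -/
theorem one_sub_rpow_inv_ge {q s : ℝ} (hq : 1 ≤ q) (hs : |s| ≤ 1 / 2) :
    1 - (s + 2 * s ^ 2) / q ≤ (1 - s) ^ (1 / q) := by
  obtain ⟨h1, h2⟩ := abs_le.1 hs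
  have hq0 : 0 < q := by linarith
  have hpos : 0 < 1 - s := by linarith
  have hinv : (1 - s)⁻¹ = 1 + s / (1 - s) := by field_simp; ring
  have hle : s / (1 - s) ≤ s + 2 * s ^ 2 := by
    rw [div_le_iff₀ hpos]
    nlinarith [sq_nonneg s, mul_nonneg (sq_nonneg s) (by linarith : 0 ≤ 1 - 2 * s)]
  have hge : -1 ≤ s / (1 - s) := by
    rw [le_div_iff₀ hpos]; linarith
  have hB : ((1 - s)⁻¹) ^ (1 / q) ≤ 1 + (s / (1 - s)) / q := by
    have := rpow_one_add_le_one_add_mul_self hge (p := 1 / q) (by positivity)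
      (by rw [div_le_one hq0]; exact hq)
    rw [hinv]
    refine this.trans (le_of_eq ?_)
    ring
  rw [Real.inv_rpow hpos.le] at hB
  have hz : 0 < (1 - s) ^ (1 / q) := Real.rpow_pos_of_pos hpos _
  have hy : (s / (1 - s)) / q ≤ (s + 2 * s ^ 2) / q := by gcongr
  have h3 : 1 ≤ (1 + (s + 2 * s ^ 2) / q) * (1 - s) ^ (1 / q) := by
    rw [inv_le_iff_one_le_mul₀ hz] at hB
    refine hB.trans ?_
    gcongr
  set y := (s + 2 * s ^ 2) / q
  nlinarith [sq_nonneg y, mul_nonneg (sq_nonneg y) hz.le, mul_le_mul_of_nonneg_left h3 zero_le_one,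
    mul_self_nonneg (y * (1 - s) ^ (1 / q))]

namespace IsConcaveRep

variable {A : Submodule ℝ (Ω → ℝ)} {T : (Ω → ℝ) →ₗ[ℝ] X} {q C : ℝ}

theorem q_pos (h : IsConcaveRep A T q C) : 0 < q := zero_lt_one.trans_le h.one_le_q

theorem comp_one (h : IsConcaveRep A T q C) {f : Ω → ℝ} (hf : f ∈ A) {Φ : ℝ → ℝ}
    (hΦ : Continuous Φ) : (fun ω => Φ (f ω)) ∈ A :=
  h.comp f hf f hf (fun a _ => Φ a) (by fun_prop)

theorem const_mem (h : IsConcaveRep A T q C) (c : ℝ) : (fun _ => c) ∈ A :=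
  h.comp_one A.zero_mem (Φ := fun _ => c) continuous_const

theorem mul_mem (h : IsConcaveRep A T q C) {f g : Ω → ℝ} (hf : f ∈ A) (hg : g ∈ A) :
    f * g ∈ A :=
  h.comp f hf g hg (fun a b => a * b) (by fun_prop)

theorem rpow_mem (h : IsConcaveRep A T q C) {f : Ω → ℝ} (hf : f ∈ A) {r : ℝ} (hr : 0 ≤ r) :
    (fun ω => f ω ^ r) ∈ A :=
  h.comp_one hf (Φ := fun a => a ^ r) (Real.continuous_rpow_const hr)

theorem zero_mem_concaveSums (_ : IsConcaveRep A T q C) (f : Ω → ℝ) :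
    0 ∈ concaveSums A T q f :=
  ⟨0, Fin.elim0, fun i => i.elim0, fun ω => by simp; positivity, by simp⟩

theorem concaveSums_le (h : IsConcaveRep A T q C) {f : Ω → ℝ} (hf : f ∈ A) :
    ∀ r ∈ concaveSums A T q f, r ≤ (C * ‖T f‖) ^ q := by
  rintro r ⟨n, g, hg, hle, rfl⟩
  exact h.concave n g hg f hf hle

theorem bddAbove (h : IsConcaveRep A T q C) {f : Ω → ℝ} (hf : f ∈ A) :
    BddAbove (concaveSums A T q f) :=
  ⟨_, h.concaveSums_le hf⟩

theorem sSup_nonneg (_ : IsConcaveRep A T q C) (f : Ω → ℝ) :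
    0 ≤ sSup (concaveSums A T q f) := by
  refine Real.sSup_nonneg ?_
  rintro r ⟨n, g, hg, hle, rfl⟩
  positivity

theorem concaveNorm_nonneg (h : IsConcaveRep A T q C) (f : Ω → ℝ) : 0 ≤ concaveNorm A T q f :=
  Real.rpow_nonneg (h.sSup_nonneg f) _

theorem concaveNorm_rpow (h : IsConcaveRep A T q C) (f : Ω → ℝ) :
    concaveNorm A T q f ^ q = sSup (concaveSums A T q f) := by
  rw [concaveNorm, ← Real.rpow_mul (h.sSup_nonneg f), one_div, inv_mul_cancel₀ h.q_pos.ne',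
    Real.rpow_one]

theorem concaveNorm_le_iff (h : IsConcaveRep A T q C) {f : Ω → ℝ} {c : ℝ} (hc : 0 ≤ c)
    (hle : ∀ (n : ℕ) (g : Fin n → Ω → ℝ), (∀ i, g i ∈ A) →
      (∀ ω, ∑ i, |g i ω| ^ q ≤ |f ω| ^ q) → ∑ i, ‖T (g i)‖ ^ q ≤ c ^ q) :
    concaveNorm A T q f ≤ c := by
  rw [← Real.rpow_le_rpow_iff (h.concaveNorm_nonneg f) hc h.q_pos, h.concaveNorm_rpow]
  refine csSup_le ⟨0, h.zero_mem_concaveSums f⟩ ?_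
  rintro r ⟨n, g, hg, hle', rfl⟩
  exact hle n g hg hle'

theorem sum_le_concaveNorm_rpow (h : IsConcaveRep A T q C) {f : Ω → ℝ} (hf : f ∈ A) {n : ℕ}
    {g : Fin n → Ω → ℝ} (hg : ∀ i, g i ∈ A) (hle : ∀ ω, ∑ i, |g i ω| ^ q ≤ |f ω| ^ q) :
    ∑ i, ‖T (g i)‖ ^ q ≤ concaveNorm A T q f ^ q := by
  rw [h.concaveNorm_rpow]
  exact le_csSup (h.bddAbove hf) ⟨n, g, hg, hle, rfl⟩

theorem concaveNorm_le (h : IsConcaveRep A T q C) {f : Ω → ℝ} (hf : f ∈ A) :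
    concaveNorm A T q f ≤ C * ‖T f‖ :=
  h.concaveNorm_le_iff (mul_nonneg (zero_le_one.trans h.one_le_C) (norm_nonneg _))
    fun n g hg hle => h.concave n g hg f hf hle

theorem le_concaveNorm (h : IsConcaveRep A T q C) {f : Ω → ℝ} (hf : f ∈ A) :
    ‖T f‖ ≤ concaveNorm A T q f := by
  rw [← Real.rpow_le_rpow_iff (norm_nonneg _) (h.concaveNorm_nonneg f) h.q_pos]
  have := h.sum_le_concaveNorm_rpow hf (n := 1) (g := fun _ => f) (fun _ => hf) (by simp)
  simpa using this

theorem concaveNorm_mono (h : IsConcaveRep A T q C) {f g : Ω → ℝ} (hg : g ∈ A)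
    (hle : ∀ ω, |f ω| ≤ |g ω|) : concaveNorm A T q f ≤ concaveNorm A T q g :=
  h.concaveNorm_le_iff (h.concaveNorm_nonneg g) fun _ _ hk hk' =>
    h.sum_le_concaveNorm_rpow hg hk fun ω =>
      (hk' ω).trans (Real.rpow_le_rpow (abs_nonneg _) (hle ω) h.q_pos.le)

theorem concaveNorm_zero (h : IsConcaveRep A T q C) : concaveNorm A T q (0 : Ω → ℝ) = 0 := by
  refine le_antisymm ?_ (h.concaveNorm_nonneg _)
  simpa using h.concaveNorm_le A.zero_mem

theorem concaveNorm_smul (h : IsConcaveRep A T q C) {f : Ω → ℝ} (hf : f ∈ A) (c : ℝ) :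
    concaveNorm A T q (c • f) = |c| * concaveNorm A T q f := by
  have key : ∀ (c : ℝ) (f : Ω → ℝ), f ∈ A →
      concaveNorm A T q (c • f) ≤ |c| * concaveNorm A T q f := by
    intro c f hf
    rcases eq_or_ne c 0 with rfl | hc
    · simp [h.concaveNorm_zero]
    have hc' : 0 < |c| := abs_pos.2 hc
    refine h.concaveNorm_le_iff (mul_nonneg hc'.le (h.concaveNorm_nonneg f)) ?_
    intro n g hg hle
    have := h.sum_le_concaveNorm_rpow hf (g := fun i => c⁻¹ • g i)
      (fun i => A.smul_mem _ (hg i)) (fun ω => by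
        simp only [Pi.smul_apply, smul_eq_mul, abs_mul, abs_inv]
        have h1 := hle ω
        simp only [Pi.smul_apply, smul_eq_mul, abs_mul] at h1
        simp_rw [Real.mul_rpow (inv_nonneg.2 hc'.le) (abs_nonneg _)]
        rw [Real.mul_rpow hc'.le (abs_nonneg _)] at h1
        rw [← Finset.mul_sum, Real.inv_rpow hc'.le,
          inv_mul_le_iff₀ (Real.rpow_pos_of_pos hc' q)]
        exact h1)
    simp_rw [map_smul, norm_smul, norm_inv, Real.norm_eq_abs] at this
    simp_rw [Real.mul_rpow (inv_nonneg.2 hc'.le) (norm_nonneg _)] at this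
    rw [← Finset.mul_sum, Real.inv_rpow hc'.le,
          inv_mul_le_iff₀ (Real.rpow_pos_of_pos hc' q)] at this
    rwa [Real.mul_rpow hc'.le (h.concaveNorm_nonneg f)]
  refine le_antisymm (key c f hf) ?_
  rcases eq_or_ne c 0 with rfl | hc
  · simp [h.concaveNorm_zero]
  have := key c⁻¹ (c • f) (A.smul_mem _ hf)
  rw [inv_smul_smul₀ hc, abs_inv, le_inv_mul_iff₀ (abs_pos.2 hc)] at this
  exact this

/-- `q`-concavity with constant `1`. -/
theorem concaveNorm_superadd (h : IsConcaveRep A T q C) {f₁ f₂ f : Ω → ℝ} (hf₁ : f₁ ∈ A)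
    (hf₂ : f₂ ∈ A) (hf : f ∈ A) (hle : ∀ ω, |f₁ ω| ^ q + |f₂ ω| ^ q ≤ |f ω| ^ q) :
    concaveNorm A T q f₁ ^ q + concaveNorm A T q f₂ ^ q ≤ concaveNorm A T q f ^ q := by
  rw [h.concaveNorm_rpow f₁, h.concaveNorm_rpow f₂,
    ← csSup_add ⟨0, h.zero_mem_concaveSums f₁⟩ (h.bddAbove hf₁) ⟨0, h.zero_mem_concaveSums f₂⟩
      (h.bddAbove hf₂)]
  refine csSup_le (Set.Nonempty.add ⟨0, h.zero_mem_concaveSums f₁⟩ ⟨0, h.zero_mem_concaveSums f₂⟩) ?_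
  rintro _ ⟨_, ⟨n, g, hg, hgle, rfl⟩, _, ⟨m, k, hk, hkle, rfl⟩, rfl⟩
  -- Concatenating a family admissible for `f₁` with one admissible for `f₂` gives one admissible
  -- for `f`.
  have := h.sum_le_concaveNorm_rpow hf (g := Fin.append g k)
    (fun i => by
      refine Fin.addCases (fun i => ?_) (fun i => ?_) i
      · rw [Fin.append_left]; exact hg i
      · rw [Fin.append_right]; exact hk i)
    (fun ω => by
      simp only [Fin.sum_univ_add, Fin.append_left, Fin.append_right]
      exact (add_le_add (hgle ω) (hkle ω)).trans (hle ω))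
  simpa only [Fin.sum_univ_add, Fin.append_left, Fin.append_right] using this

/-- Split each member of a family admissible for `f + g` in the ratio `|f| : |g|`. The pieces are
admissible for `f` and for `g`, and Minkowski's inequality in `ℓ_q` adds the two bounds. An `ε` in
the denominator keeps the ratios continuous where `f` and `g` both vanish. -/
theorem concaveNorm_add_le (h : IsConcaveRep A T q C) {f g : Ω → ℝ} (hf : f ∈ A) (hg : g ∈ A) :
    concaveNorm A T q (f + g) ≤ concaveNorm A T q f + concaveNorm A T q g := by
  have hNf := h.concaveNorm_nonneg f
  have hNg := h.concaveNorm_nonneg g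
  refine h.concaveNorm_le_iff (by positivity) ?_
  intro n k hk hle
  have hq0 := h.q_pos
  have hroot : ∀ {a b : ℝ}, 0 ≤ a → 0 ≤ b → (a ≤ b ^ q ↔ a ^ (1 / q) ≤ b) := fun ha hb => by
    rw [one_div, Real.rpow_inv_le_iff_of_pos ha hb hq0]
  rw [hroot (by positivity) (by positivity)]
  have hone := h.const_mem 1
  have key : ∀ ε : ℝ, 0 < ε → (∑ i, ‖T (k i)‖ ^ q) ^ (1 / q) ≤
      concaveNorm A T q f + concaveNorm A T q g +
        ε * (∑ i : Fin n, ‖T (fun _ => 1)‖ ^ q) ^ (1 / q) := by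
    intro ε hε
    set a : Fin n → Ω → ℝ := fun i ω => k i ω * (|f ω| / (|f ω| + |g ω| + ε)) with ha
    set b : Fin n → Ω → ℝ := fun i ω => k i ω * (|g ω| / (|f ω| + |g ω| + ε)) with hb
    set r : Fin n → Ω → ℝ := fun i ω => k i ω * (ε / (|f ω| + |g ω| + ε)) with hr
    have hden : ∀ s t : ℝ, |s| + |t| + ε ≠ 0 := fun s t => by positivity
    have haA : ∀ i, a i ∈ A := fun i => h.mul_mem (hk i)
      (h.comp f hf g hg (fun s t => |s| / (|s| + |t| + ε)) (by
        refine Continuous.div (by fun_prop) (by fun_prop) fun p => hden _ _))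
    have hbA : ∀ i, b i ∈ A := fun i => h.mul_mem (hk i)
      (h.comp f hf g hg (fun s t => |t| / (|s| + |t| + ε)) (by
        refine Continuous.div (by fun_prop) (by fun_prop) fun p => hden _ _))
    have hrA : ∀ i, r i ∈ A := fun i => h.mul_mem (hk i)
      (h.comp f hf g hg (fun s t => ε / (|s| + |t| + ε)) (by
        refine Continuous.div (by fun_prop) (by fun_prop) fun p => hden _ _))
    have hsplit : ∀ i, k i = a i + b i + r i := fun i => by
      ext ω
      simp only [ha, hb, hr, Pi.add_apply]
      have := hden (f ω) (g ω)
      field_simp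
    have hcoef : ∀ (c : Ω → ℝ), (∀ ω, 0 ≤ c ω) → ∀ ω,
        ∑ i, |k i ω * (c ω / (|f ω| + |g ω| + ε))| ^ q ≤ |c ω| ^ q := by
      intro c hc ω
      have hD : 0 < |f ω| + |g ω| + ε := by positivity
      have h0 : 0 ≤ c ω / (|f ω| + |g ω| + ε) := div_nonneg (hc ω) hD.le
      simp_rw [abs_mul, abs_of_nonneg h0, Real.mul_rpow (abs_nonneg _) h0]
      rw [← Finset.sum_mul]
      refine (mul_le_mul_of_nonneg_right (hle ω) (by positivity)).trans ?_
      rw [← Real.mul_rpow (abs_nonneg _) h0, abs_of_nonneg (hc ω)]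
      refine Real.rpow_le_rpow (by positivity) ?_ hq0.le
      rw [mul_div_left_comm]
      refine mul_le_of_le_one_right (hc ω) ?_
      rw [div_le_one hD]
      exact (abs_add_le _ _).trans (by linarith)
    have hNa := h.sum_le_concaveNorm_rpow hf haA (fun ω => by
      simpa only [abs_abs] using hcoef (fun ω => |f ω|) (fun ω => abs_nonneg _) ω)
    have hNb := h.sum_le_concaveNorm_rpow hg hbA (fun ω => by
      simpa only [abs_abs] using hcoef (fun ω => |g ω|) (fun ω => abs_nonneg _) ω)
    -- The remainder is bounded only term by term; this is enough because `n` stays fixed as `ε →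
    -- 0`.
    have hNr : ∀ i, ‖T (r i)‖ ≤ ε * ‖T (fun _ => 1)‖ := fun i => by
      have h1 : ‖T (r i)‖ ≤ ‖T (ε • fun _ => (1 : ℝ))‖ := by
        refine h.mono _ (hrA i) _ (A.smul_mem _ hone) fun ω => ?_
        have h2 := hcoef (fun _ => ε) (fun _ => hε.le) ω
        have h3 : |r i ω| ^ q ≤ |ε| ^ q :=
          (Finset.single_le_sum (f := fun i => |r i ω| ^ q) (fun j _ => by positivity)
            (Finset.mem_univ i)).trans h2
        simpa using (Real.rpow_le_rpow_iff (abs_nonneg _) (abs_nonneg _) hq0).1 h3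
      rwa [map_smul, norm_smul, Real.norm_of_nonneg hε.le] at h1
    rw [hroot (by positivity) hNf] at hNa
    rw [hroot (by positivity) hNg] at hNb
    have h1 : (∑ i, ‖T (k i)‖ ^ q) ^ (1 / q) ≤
        (∑ i, (‖T (a i)‖ + (‖T (b i)‖ + ε * ‖T (fun _ => 1)‖)) ^ q) ^ (1 / q) := by
      refine Real.rpow_le_rpow (by positivity) (Finset.sum_le_sum fun i _ => ?_) (by positivity)
      refine Real.rpow_le_rpow (norm_nonneg _) ?_ hq0.le
      rw [hsplit i, map_add, map_add, ← add_assoc]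
      exact (norm_add_le _ _).trans (add_le_add (norm_add_le _ _) (hNr i))
    have h2 := Real.Lp_add_le_of_nonneg (s := Finset.univ) (f := fun i => ‖T (a i)‖)
      (g := fun i => ‖T (b i)‖ + ε * ‖T (fun _ => 1)‖) h.one_le_q
      (fun i _ => norm_nonneg _) (fun i _ => by positivity)
    have h3 := Real.Lp_add_le_of_nonneg (s := Finset.univ) (f := fun i => ‖T (b i)‖)
      (g := fun _ : Fin n => ε * ‖T (fun _ => 1)‖) h.one_le_q
      (fun i _ => norm_nonneg _) (fun i _ => by positivity)
    have h4 : (∑ i : Fin n, (ε * ‖T (fun _ => 1)‖) ^ q) ^ (1 / q) =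
        ε * (∑ i : Fin n, ‖T (fun _ => 1)‖ ^ q) ^ (1 / q) := by
      simp_rw [Real.mul_rpow hε.le (norm_nonneg _)]
      rw [← Finset.mul_sum, Real.mul_rpow (by positivity) (by positivity), ← Real.rpow_mul hε.le,
        mul_one_div_cancel hq0.ne', Real.rpow_one]
    linarith
  have hlim : Filter.Tendsto (fun ε : ℝ => concaveNorm A T q f + concaveNorm A T q g +
      ε * (∑ i : Fin n, ‖T (fun _ => 1)‖ ^ q) ^ (1 / q)) (nhdsWithin 0 (Set.Ioi 0))
      (nhds (concaveNorm A T q f + concaveNorm A T q g +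
        0 * (∑ i : Fin n, ‖T (fun _ => 1)‖ ^ q) ^ (1 / q))) :=
    ((continuous_const.add (continuous_id.mul continuous_const)).tendsto 0).mono_left
      nhdsWithin_le_nhds
  rw [zero_mul, add_zero] at hlim
  exact ge_of_tendsto hlim (Filter.eventually_of_mem self_mem_nhdsWithin fun ε hε => key ε hε)

end IsConcaveRep

end ConcaveNorm

/-! ### Positive norming functionals and the supergradient inequality. -/

section NormingFunctional

variable {Ω X : Type*} [NormedAddCommGroup X] [NormedSpace ℝ X]

/-- `π w = φ (x * w)` for a positive norming functional `φ` of `x` for the `q`-concave norm. -/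
structure IsNorming (A : Submodule ℝ (Ω → ℝ)) (T : (Ω → ℝ) →ₗ[ℝ] X) (q : ℝ) (x : Ω → ℝ)
    (π : (Ω → ℝ) →ₗ[ℝ] ℝ) : Prop where
  nonneg : ∀ w ∈ A, (∀ ω, 0 ≤ w ω) → 0 ≤ π w
  one : π (fun _ => 1) = 1
  le : ∀ w ∈ A, (∀ ω, 0 ≤ w ω) → π w ≤ concaveNorm A T q (x * w)
  ge : ∀ w ∈ A, (∀ ω, 0 ≤ w ω) → concaveNorm A T q (x * w) ^ q ≤ π (fun ω => w ω ^ q)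

namespace IsConcaveRep

variable {A : Submodule ℝ (Ω → ℝ)} {T : (Ω → ℝ) →ₗ[ℝ] X} {q C : ℝ}

/-- Hahn–Banach from the constants, under the sublinear majorant `w ↦ N(x w⁺)`. Positivity is
automatic: the majorant vanishes at `-w` when `w ≥ 0`. -/
theorem exists_functional (h : IsConcaveRep A T q C) {x : Ω → ℝ} (hx : x ∈ A)
    (hN : concaveNorm A T q x = 1) :
    ∃ π : (Ω → ℝ) →ₗ[ℝ] ℝ, (∀ w ∈ A, (∀ ω, 0 ≤ w ω) → 0 ≤ π w) ∧ π (fun _ => 1) = 1 ∧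
      ∀ w ∈ A, (∀ ω, 0 ≤ w ω) → π w ≤ concaveNorm A T q (x * w) := by
  set e : A := ⟨fun _ => 1, h.const_mem 1⟩ with he
  have he0 : e ≠ 0 := by
    intro h0
    have h1 : (fun _ : Ω => (1 : ℝ)) = 0 := congrArg Subtype.val h0
    have h2 : x = 0 := by
      ext ω
      exact absurd (congrFun h1 ω) one_ne_zero
    rw [h2, h.concaveNorm_zero] at hN
    exact zero_ne_one hN
  have hpos : ∀ w ∈ A, (fun ω => max (w ω) 0) ∈ A := fun w hw =>
    h.comp_one hw (Φ := fun a => max a 0) (by fun_prop)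
  let p : A → ℝ := fun w => concaveNorm A T q (x * fun ω => max (w.1 ω) 0)
  obtain ⟨g, hg1, hg2⟩ := exists_extension_of_le_sublinear
    (LinearPMap.mkSpanSingleton e (1 : ℝ) he0) p (fun c hc w => by
      have : (x * fun ω => max ((c • w).1 ω) 0) = c • (x * fun ω => max (w.1 ω) 0) := by
        ext ω
        simp only [Submodule.coe_smul, Pi.mul_apply, Pi.smul_apply, smul_eq_mul]
        have h1 : max (c * w.1 ω) 0 = c * max (w.1 ω) 0 := by
          rw [mul_max_of_nonneg _ _ hc.le, mul_zero]
        rw [h1]; ring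
      simp only [p]
      rw [this, h.concaveNorm_smul (h.mul_mem hx (hpos _ w.2)), abs_of_pos hc])
    (fun v w => by
      have hv := h.mul_mem hx (hpos _ v.2)
      have hw := h.mul_mem hx (hpos _ w.2)
      refine le_trans ?_ (h.concaveNorm_add_le hv hw)
      refine h.concaveNorm_mono (A.add_mem hv hw) fun ω => ?_
      have h0 : 0 ≤ max (v.1 ω) 0 + max (w.1 ω) 0 := by positivity
      have h1 : max ((v + w).1 ω) 0 ≤ max (v.1 ω) 0 + max (w.1 ω) 0 :=
        max_le (add_le_add (le_max_left _ _) (le_max_left _ _)) h0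
      simp only [Pi.mul_apply, Pi.add_apply]
      rw [← mul_add, abs_mul, abs_mul, abs_of_nonneg h0,
        abs_of_nonneg (le_max_right ((v + w).1 ω) 0)]
      exact mul_le_mul_of_nonneg_left h1 (abs_nonneg _))
    (fun w => by
      obtain ⟨c, hc⟩ := Submodule.mem_span_singleton.1 w.2
      have hw : w = ⟨c • e, Submodule.mem_span_singleton.2 ⟨c, rfl⟩⟩ := Subtype.ext hc.symm
      have hs : (LinearPMap.mkSpanSingleton e (1 : ℝ) he0) w = c := by
        rw [hw]
        refine (LinearPMap.mkSpanSingleton'_apply e (1 : ℝ) _ c _).trans ?_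
        rw [smul_eq_mul, mul_one, RingHom.id_apply]
      rw [hs, ← hc]
      rcases le_total c 0 with hc0 | hc0
      · exact hc0.trans (h.concaveNorm_nonneg _)
      · have : (x * fun ω => max ((c • e).1 ω) 0) = c • x := by
          ext ω
          simp [he, hc0, mul_comm]
        simp only [p]
        rw [this, h.concaveNorm_smul hx, hN, mul_one, abs_of_nonneg hc0])
  -- An arbitrary linear extension from `A` to all functions; only the values on `A` matter.
  obtain ⟨π, hπ⟩ := LinearMap.exists_extend g
  have hval : ∀ w (hw : w ∈ A), π w = g ⟨w, hw⟩ := fun w hw => by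
    rw [← hπ]; rfl
  refine ⟨π, fun w hw hw0 => ?_, ?_, fun w hw hw0 => ?_⟩
  · have h1 := hg2 (-⟨w, hw⟩)
    rw [map_neg, ← hval] at h1
    have h2 : (x * fun ω => max ((-⟨w, hw⟩ : A).1 ω) 0) = 0 := by
      ext ω
      simp [hw0 ω]
    simp only [p] at h1
    rw [h2, h.concaveNorm_zero] at h1
    linarith
  · have h1 := hg1 ⟨e, Submodule.mem_span_singleton_self e⟩
    rw [hval _ (h.const_mem 1)]
    refine h1.trans ?_
    exact LinearPMap.mkSpanSingleton_apply ℝ ℝ he0 (1 : ℝ)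
  · have h1 := hg2 ⟨w, hw⟩
    rw [← hval] at h1
    have h2 : (fun ω => max (w ω) 0) = w := funext fun ω => max_eq_left (hw0 ω)
    simp only [p] at h1
    rwa [h2] at h1

theorem functional_mono {π : (Ω → ℝ) →ₗ[ℝ] ℝ}
    (hπ : ∀ w ∈ A, (∀ ω, 0 ≤ w ω) → 0 ≤ π w) {v w : Ω → ℝ} (hv : v ∈ A) (hw : w ∈ A)
    (hle : ∀ ω, v ω ≤ w ω) : π v ≤ π w := by
  have := hπ (w - v) (A.sub_mem hw hv) fun ω => sub_nonneg.2 (hle ω)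
  rw [map_sub] at this
  linarith

/-- A positive norming functional is also a supergradient, because the norm is `q`-concave with
constant `1`. -/
theorem concaveNorm_rpow_le_functional (h : IsConcaveRep A T q C) {x : Ω → ℝ} (hx : x ∈ A)
    (hN : concaveNorm A T q x = 1) {π : (Ω → ℝ) →ₗ[ℝ] ℝ}
    (hnn : ∀ w ∈ A, (∀ ω, 0 ≤ w ω) → 0 ≤ π w) (hone : π (fun _ => 1) = 1)
    (hle : ∀ w ∈ A, (∀ ω, 0 ≤ w ω) → π w ≤ concaveNorm A T q (x * w)) {w : Ω → ℝ} (hw : w ∈ A)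
    (hw0 : ∀ ω, 0 ≤ w ω) : concaveNorm A T q (x * w) ^ q ≤ π (fun ω => w ω ^ q) := by
  have hq0 := h.q_pos
  have hconst : ∀ c : ℝ, π (fun _ => c) = c := fun c => by
    have : (fun _ : Ω => c) = c • fun _ => (1 : ℝ) := by ext; simp
    rw [this, map_smul, hone, smul_eq_mul, mul_one]
  have hwq := h.rpow_mem hw hq0.le
  set v : Ω → ℝ := fun ω => w ω ^ q - 1 with hv
  have hvA : v ∈ A := A.sub_mem hwq (h.const_mem 1)
  have hπv : π v = π (fun ω => w ω ^ q) - 1 := by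
    have : v = (fun ω => w ω ^ q) - fun _ => 1 := rfl
    rw [this, map_sub, hone]
  obtain ⟨b, hb⟩ := h.bdd v hvA
  set B : ℝ := |b| + 1 with hB
  have hBpos : 0 < B := by positivity
  have hvB : ∀ ω, |v ω| ≤ B := fun ω => (hb ω).trans (by rw [hB]; linarith [le_abs_self b])
  have key : ∀ t : ℝ, 0 < t → t * B ≤ 1 / 2 →
      concaveNorm A T q (x * w) ^ q ≤ π (fun ω => w ω ^ q) + 2 * t * B ^ 2 := by
    intro t ht htB
    have hsmall : ∀ ω, |t * v ω| ≤ 1 / 2 := fun ω => by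
      rw [abs_mul, abs_of_pos ht]
      exact (mul_le_mul_of_nonneg_left (hvB ω) ht.le).trans htB
    have hpos : ∀ ω, 0 ≤ 1 - t * v ω := fun ω => by linarith [(abs_le.1 (hsmall ω)).2]
    -- Chosen so that `t w^q + a^q = 1 + t`. Superadditivity then gives `t N(x w)^q + N(x a)^q ≤ 1 +
    -- t`.
    set a : Ω → ℝ := fun ω => (1 - t * v ω) ^ (1 / q) with ha
    have haA : a ∈ A := h.rpow_mem (f := fun ω => 1 - t * v ω)
      (A.sub_mem (h.const_mem 1) (A.smul_mem t hvA)) (by positivity)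
    have ha0 : ∀ ω, 0 ≤ a ω := fun ω => Real.rpow_nonneg (hpos ω) _
    have haq : ∀ ω, a ω ^ q = 1 - t * v ω := fun ω => by
      rw [ha]; dsimp only
      rw [← Real.rpow_mul (hpos ω), one_div, inv_mul_cancel₀ hq0.ne', Real.rpow_one]
    have htq : ((t ^ (1 / q)) ^ q : ℝ) = t := by
      rw [← Real.rpow_mul ht.le, one_div, inv_mul_cancel₀ hq0.ne', Real.rpow_one]
    have hcq : (((1 + t) ^ (1 / q)) ^ q : ℝ) = 1 + t := by
      rw [← Real.rpow_mul (by positivity), one_div, inv_mul_cancel₀ hq0.ne', Real.rpow_one]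
    have hxw := h.mul_mem hx hw
    have hxa := h.mul_mem hx haA
    have h1 := h.concaveNorm_superadd (A.smul_mem (t ^ (1 / q)) hxw) hxa
      (A.smul_mem ((1 + t) ^ (1 / q)) hx) (fun ω => by
        simp only [Pi.smul_apply, Pi.mul_apply, smul_eq_mul, abs_mul]
        rw [abs_of_nonneg (show (0 : ℝ) ≤ t ^ (1 / q) by positivity),
          abs_of_nonneg (show (0 : ℝ) ≤ (1 + t) ^ (1 / q) by positivity),
          abs_of_nonneg (hw0 ω), abs_of_nonneg (ha0 ω),
          Real.mul_rpow (by positivity) (mul_nonneg (abs_nonneg _) (hw0 ω)),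
          Real.mul_rpow (abs_nonneg _) (hw0 ω), Real.mul_rpow (abs_nonneg _) (ha0 ω),
          Real.mul_rpow (by positivity) (abs_nonneg _), htq, hcq, haq]
        rw [hv]
        apply le_of_eq
        ring)
    rw [h.concaveNorm_smul hxw, h.concaveNorm_smul hx, hN, mul_one,
      abs_of_nonneg (show (0 : ℝ) ≤ t ^ (1 / q) by positivity),
      abs_of_nonneg (show (0 : ℝ) ≤ (1 + t) ^ (1 / q) by positivity),
      Real.mul_rpow (by positivity) (h.concaveNorm_nonneg _), htq, hcq] at h1
    have hv2 : (fun ω => v ω ^ 2) ∈ A :=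
      h.comp_one hvA (Φ := fun a => a ^ 2) (by fun_prop)
    set l : Ω → ℝ := fun ω => 1 - (t * v ω + 2 * (t * v ω) ^ 2) / q with hl
    have hl' : l = (fun _ => 1) - (t / q) • v - (2 * t ^ 2 / q) • fun ω => v ω ^ 2 := by
      ext ω
      simp only [hl, Pi.sub_apply, Pi.smul_apply, smul_eq_mul]
      ring
    have hlA : l ∈ A := by
      rw [hl']
      exact A.sub_mem (A.sub_mem (h.const_mem 1) (A.smul_mem _ hvA)) (A.smul_mem _ hv2)
    have hπ2 : π (fun ω => v ω ^ 2) ≤ B ^ 2 := by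
      rw [← hconst (B ^ 2)]
      refine functional_mono hnn hv2 (h.const_mem _) fun ω => ?_
      rw [← sq_abs]
      exact pow_le_pow_left₀ (abs_nonneg _) (hvB ω) 2
    have hπv' : π v ≤ B := by
      rw [← hconst B]
      exact functional_mono hnn hvA (h.const_mem _) fun ω => (le_abs_self _).trans (hvB ω)
    -- Here the norming property enters: `N(x a) ≥ π a`, and `a` is expanded to first order in `t`.
    -- After raising to the power `q`, the linear term is `-t π v = t - t π(w^q)`, so dividing by
    -- `t` and letting `t → 0` gives the claim.
    have h2 : 1 - (t * π v + 2 * t ^ 2 * B ^ 2) / q ≤ concaveNorm A T q (x * a) := by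
      refine le_trans ?_ (hle a haA ha0)
      refine le_trans ?_ (functional_mono hnn hlA haA fun ω => one_sub_rpow_inv_ge h.one_le_q
        (hsmall ω))
      rw [hl', map_sub, map_sub, map_smul, map_smul, hone, smul_eq_mul, smul_eq_mul]
      have h3 : 2 * t ^ 2 / q * π (fun ω => v ω ^ 2) ≤ 2 * t ^ 2 / q * B ^ 2 := by gcongr
      have h4 : (t * π v + 2 * t ^ 2 * B ^ 2) / q = t / q * π v + 2 * t ^ 2 / q * B ^ 2 := by ring
      linarith
    set y : ℝ := (t * π v + 2 * t ^ 2 * B ^ 2) / q with hy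
    have hy1 : y ≤ 1 := by
      rw [hy, div_le_one hq0]
      have : t * π v ≤ 1 / 2 := (mul_le_mul_of_nonneg_left hπv' ht.le).trans htB
      have h5 : 2 * t ^ 2 * B ^ 2 ≤ 1 / 2 := by
        have := mul_le_mul htB htB (by positivity) (by norm_num)
        nlinarith
      linarith [h.one_le_q]
    have h6 : 1 - q * y ≤ concaveNorm A T q (x * a) ^ q := by
      have := one_add_mul_self_le_rpow_one_add (s := -y) (by linarith) h.one_le_q
      refine le_trans (by linarith) (this.trans ?_)
      exact Real.rpow_le_rpow (by linarith) (by linarith) hq0.le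
    have h7 : q * y = t * π v + 2 * t ^ 2 * B ^ 2 := by rw [hy]; field_simp
    have h8 : t * concaveNorm A T q (x * w) ^ q ≤ t * (π (fun ω => w ω ^ q) + 2 * t * B ^ 2) := by
      rw [hπv] at h7
      nlinarith
    exact le_of_mul_le_mul_left h8 ht
  have hlim : Filter.Tendsto (fun t : ℝ => π (fun ω => w ω ^ q) + 2 * t * B ^ 2)
      (nhdsWithin 0 (Set.Ioi 0)) (nhds (π (fun ω => w ω ^ q) + 2 * 0 * B ^ 2)) :=
    (Continuous.tendsto (by fun_prop) 0).mono_left nhdsWithin_le_nhds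
  rw [mul_zero, zero_mul, add_zero] at hlim
  refine ge_of_tendsto hlim ?_
  have hmem : Set.Ioo (0 : ℝ) (1 / (2 * B)) ∈ nhdsWithin (0 : ℝ) (Set.Ioi 0) :=
    Ioo_mem_nhdsGT (by positivity)
  filter_upwards [hmem] with t ht
  refine key t ht.1 ?_
  have := ht.2.le
  rw [le_div_iff₀ (by positivity)] at this
  linarith

theorem exists_isNorming (h : IsConcaveRep A T q C) {x : Ω → ℝ} (hx : x ∈ A)
    (hN : concaveNorm A T q x = 1) : ∃ π, IsNorming A T q x π := by
  obtain ⟨π, h1, h2, h3⟩ := h.exists_functional hx hN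
  exact ⟨π, h1, h2, h3, fun w hw hw0 => h.concaveNorm_rpow_le_functional hx hN h1 h2 h3 hw hw0⟩

end IsConcaveRep

end NormingFunctional

/-! ### Concavity of lattice homomorphisms, and measures from positive functionals. -/

section ConcaveLattice

variable {X : Type*} [NormedAddCommGroup X] [NormedSpace ℝ X] [CompleteSpace X]
  [Lattice X] [IsOrderedAddMonoid X] [HasSolidNorm X] [IsOrderedModule ℝ X]

/-- Hölder's inequality; `q = 1` is separate because the dual norm is then the maximum norm. -/
theorem sum_mul_le_of_norm_toLp_le_one {q : ℝ} (hq : 1 ≤ q) {n : ℕ} {a b : Fin n → ℝ} {c : ℝ}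
    (ha : ‖WithLp.toLp (ENNReal.conjExponent (ENNReal.ofReal q)) a‖ ≤ 1)
    (hb : ∑ i, |b i| ^ q ≤ |c| ^ q) : ∑ i, a i * b i ≤ |c| := by
  have hq0 : 0 < q := by linarith
  have : Fact (1 ≤ ENNReal.conjExponent (ENNReal.ofReal q)) :=
    ⟨by rw [ENNReal.conjExponent]; exact le_self_add⟩
  rcases hq.eq_or_lt with rfl | hq1
  · simp only [Real.rpow_one] at hb
    refine (Finset.sum_le_sum fun i _ => ?_).trans hb
    have h1 : |a i| ≤ 1 := (PiLp.norm_apply_le (WithLp.toLp _ a) i).trans ha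
    calc a i * b i ≤ |a i| * |b i| := by rw [← abs_mul]; exact le_abs_self _
      _ ≤ 1 * |b i| := by gcongr
      _ = |b i| := one_mul _
  · have hconj : Real.HolderConjugate q (Real.conjExponent q) := .conjExponent hq1
    have hp : (ENNReal.conjExponent (ENNReal.ofReal q)).toReal = Real.conjExponent q := by
      have h1 : ENNReal.ofReal q - 1 = ENNReal.ofReal (q - 1) := by
        rw [ENNReal.ofReal_sub _ zero_le_one, ENNReal.ofReal_one]
      rw [ENNReal.conjExponent, h1, ← ENNReal.ofReal_inv_of_pos (by linarith),
        ← ENNReal.ofReal_one, ← ENNReal.ofReal_add zero_le_one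
          (inv_nonneg.2 (by linarith)), ENNReal.toReal_ofReal
          (add_nonneg zero_le_one (inv_nonneg.2 (by linarith))), Real.conjExponent]
      have : q - 1 ≠ 0 := by linarith
      field_simp
      ring
    have hp0 := hconj.symm.pos
    rw [PiLp.norm_eq_sum (by rw [hp]; exact hp0), hp] at ha
    have h2 := Real.inner_le_Lp_mul_Lq Finset.univ a b hconj.symm
    refine h2.trans ?_
    simp only [Real.norm_eq_abs] at ha
    refine (mul_le_of_le_one_left (by positivity) ha).trans ?_
    rwa [one_div, Real.rpow_inv_le_iff_of_pos (by positivity) (abs_nonneg _) hq0]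

/-- Any upper bound may replace the supremum: the supremum is nonnegative (take `a = 0`), so the
solid norm is monotone between the two. -/
theorem IsConcaveWith.sum_norm_rpow_le {q : ℝ} {C : ℝ≥0} (hC : IsConcaveWith q X C) (hq : 1 ≤ q)
    {n : ℕ} {x : Fin n → X} {y : X} (hy : y ∈ upperBounds (dualBallCombinations q x)) :
    ∑ i, ‖x i‖ ^ q ≤ (C * ‖y‖) ^ q := by
  have hq0 : 0 < q := by linarith
  have : Fact (1 ≤ ENNReal.conjExponent (ENNReal.ofReal q)) :=
    ⟨by rw [ENNReal.conjExponent]; exact le_self_add⟩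
  have hlub := isLUB_latticeLqSum q x
  have h0 : 0 ≤ latticeLqSum q x := hlub.1 ⟨0, by simp, by simp⟩
  have hle : latticeLqSum q x ≤ y := hlub.2 hy
  have hnorm : ‖latticeLqSum q x‖ ≤ ‖y‖ := by
    refine norm_le_norm_of_abs_le_abs ?_
    rw [abs_of_nonneg h0, abs_of_nonneg (h0.trans hle)]
    exact hle
  have := (hC n x).trans (mul_le_mul_of_nonneg_left hnorm C.coe_nonneg)
  rwa [one_div, Real.rpow_inv_le_iff_of_pos (by positivity) (by positivity) hq0] at this

/-- Commuting with absolute values makes `T` monotone on `A`. By pointwise Hölder, `T |f|` is then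
an upper bound of all the combinations of the `T (g i)` that define their lattice `ℓ_q`-sum. -/
theorem isConcaveRep_of_latticeHom {Ω : Type*} {A : Submodule ℝ (Ω → ℝ)}
    {T : (Ω → ℝ) →ₗ[ℝ] X} {q : ℝ} (hq : 1 ≤ q) {C : ℝ≥0} (hC1 : 1 ≤ C)
    (hC : IsConcaveWith q X C)
    (hcomp : ∀ f ∈ A, ∀ g ∈ A, ∀ Φ : ℝ → ℝ → ℝ, Continuous (Function.uncurry Φ) →
      (fun ω => Φ (f ω) (g ω)) ∈ A)
    (hbdd : ∀ f ∈ A, ∃ c : ℝ, ∀ ω, |f ω| ≤ c)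
    (hT : ∀ f ∈ A, T (fun ω => |f ω|) = |T f|) : IsConcaveRep A T q C := by
  have habs : ∀ f ∈ A, (fun ω => |f ω|) ∈ A := fun f hf =>
    hcomp f hf f hf (fun a _ => |a|) (by fun_prop)
  have hmono : ∀ f ∈ A, ∀ g ∈ A, (∀ ω, f ω ≤ g ω) → T f ≤ T g := by
    intro f hf g hg hle
    have h1 := hT (g - f) (A.sub_mem hg hf)
    have h2 : (fun ω => |(g - f) ω|) = g - f :=
      funext fun ω => abs_of_nonneg (sub_nonneg.2 (hle ω))
    rw [h2] at h1
    have h3 : 0 ≤ T (g - f) := by rw [h1]; exact abs_nonneg _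
    rw [map_sub] at h3
    exact sub_nonneg.1 h3
  refine ⟨hcomp, hbdd, hq, hC1, ?_, ?_⟩
  · intro f hf g hg hle
    refine norm_le_norm_of_abs_le_abs ?_
    rw [← hT f hf, ← hT g hg]
    exact hmono _ (habs f hf) _ (habs g hg) hle
  · intro n g hg f hf hle
    rw [← norm_abs_eq_norm (T f), ← hT f hf]
    refine hC.sum_norm_rpow_le hq ?_
    rintro _ ⟨a, ha, rfl⟩
    have h1 : ∑ i, a i • T (g i) = T (∑ i, a i • g i) := by simp [map_sum]
    rw [h1]
    refine hmono _ (A.sum_mem fun i _ => A.smul_mem _ (hg i)) _ (habs f hf) fun ω => ?_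
    simp only [Finset.sum_apply, Pi.smul_apply, smul_eq_mul]
    exact sum_mul_le_of_norm_toLp_le_one hq ha (hle ω)

/-- The continuous real functions, as a space of functions. -/
def continuousFunctions (K : Type*) [TopologicalSpace K] : Submodule ℝ (K → ℝ) where
  carrier := {f | Continuous f}
  add_mem' hf hg := Continuous.add hf hg
  zero_mem' := continuous_const
  smul_mem' c _ hf := Continuous.const_smul hf c

/-- The bounded measurable real functions. -/
def boundedMeasurable (Ω : Type*) [MeasurableSpace Ω] : Submodule ℝ (Ω → ℝ) where
  carrier := {f | Measurable f ∧ ∃ c : ℝ, ∀ ω, |f ω| ≤ c}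
  add_mem' := by
    rintro f g ⟨hf, a, ha⟩ ⟨hg, b, hb⟩
    exact ⟨hf.add hg, a + b, fun ω => (abs_add_le _ _).trans (add_le_add (ha ω) (hb ω))⟩
  zero_mem' := ⟨measurable_const, 0, by simp⟩
  smul_mem' := by
    rintro c f ⟨hf, a, ha⟩
    refine ⟨hf.const_smul c, |c| * a, fun ω => ?_⟩
    rw [Pi.smul_apply, smul_eq_mul, abs_mul]
    exact mul_le_mul_of_nonneg_left (ha ω) (abs_nonneg c)

theorem comp_mem_boundedMeasurable {Ω : Type*} [MeasurableSpace Ω] {f g : Ω → ℝ}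
    (hf : f ∈ boundedMeasurable Ω) (hg : g ∈ boundedMeasurable Ω) {Φ : ℝ → ℝ → ℝ}
    (hΦ : Continuous (Function.uncurry Φ)) : (fun ω => Φ (f ω) (g ω)) ∈ boundedMeasurable Ω := by
  obtain ⟨hfm, a, ha⟩ := hf
  obtain ⟨hgm, b, hb⟩ := hg
  refine ⟨hΦ.measurable.comp (hfm.prodMk hgm), ?_⟩
  obtain ⟨c, hc⟩ := ((isCompact_Icc (a := -a) (b := a)).prod
    (isCompact_Icc (a := -b) (b := b))).exists_bound_of_continuousOn hΦ.continuousOn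
  exact ⟨c, fun ω => hc (f ω, g ω) ⟨abs_le.1 (ha ω), abs_le.1 (hb ω)⟩⟩

open MeasureTheory

/-- Riesz–Markov–Kakutani. Weak regularity is recorded because density of `C(K)` in `L_q(μ)` needs
it. -/
theorem exists_measure_of_positive {K : Type*} [TopologicalSpace K] [CompactSpace K] [T2Space K]
    [MeasurableSpace K] [BorelSpace K] {π : (K → ℝ) →ₗ[ℝ] ℝ}
    (hπ : ∀ w ∈ continuousFunctions K, (∀ k, 0 ≤ w k) → 0 ≤ π w) (hone : π (fun _ => 1) = 1) :
    ∃ μ : Measure K, IsProbabilityMeasure μ ∧ μ.WeaklyRegular ∧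
      ∀ w ∈ continuousFunctions K, ∫ k, w k ∂μ = π w := by
  let Λ₀ : CompactlySupportedContinuousMap K ℝ →ₗ[ℝ] ℝ :=
    { toFun := fun f => π f
      map_add' := fun f g => by rw [CompactlySupportedContinuousMap.coe_add, map_add]
      map_smul' := fun c f => by rw [CompactlySupportedContinuousMap.coe_smul, map_smul]; rfl }
  let Λ : CompactlySupportedContinuousMap K ℝ →ₚ[ℝ] ℝ :=
    PositiveLinearMap.mk₀ Λ₀ fun f hf => hπ f f.continuous fun k => hf k
  have hint : ∀ w ∈ continuousFunctions K, ∫ k, w k ∂(RealRMK.rieszMeasure Λ) = π w := by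
    intro w hw
    exact RealRMK.integral_rieszMeasure Λ
      ⟨⟨w, hw⟩, HasCompactSupport.of_compactSpace w⟩
  refine ⟨RealRMK.rieszMeasure Λ, ⟨?_⟩, inferInstance, hint⟩
  have h1 := hint (fun _ => 1) continuous_const
  rw [hone, integral_const, smul_eq_mul, mul_one, Measure.real] at h1
  exact (ENNReal.toReal_eq_one_iff _).1 h1

end ConcaveLattice

/-! ### Placing the lattice between `L_q(μ)` and `L_1(μ)`. -/

section MeasureRepresentation

open MeasureTheory

theorem memLp_of_mem_boundedMeasurable {Ω : Type*} [MeasurableSpace Ω] {μ : Measure Ω}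
    [IsFiniteMeasure μ] {f : Ω → ℝ} (hf : f ∈ boundedMeasurable Ω) (p : ℝ≥0∞) : MemLp f p μ := by
  obtain ⟨hm, c, hc⟩ := hf
  exact MemLp.of_bound hm.aestronglyMeasurable c (Filter.Eventually.of_forall hc)

theorem integrable_of_mem_boundedMeasurable {Ω : Type*} [MeasurableSpace Ω] {μ : Measure Ω}
    [IsFiniteMeasure μ] {f : Ω → ℝ} (hf : f ∈ boundedMeasurable Ω) : Integrable f μ :=
  memLp_one_iff_integrable.1 (memLp_of_mem_boundedMeasurable hf 1)

theorem norm_toLp_eq_integral {Ω : Type*} [MeasurableSpace Ω] {μ : Measure Ω} {f : Ω → ℝ} {q : ℝ}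
    (hq : 0 < q) (hf : MemLp f (ENNReal.ofReal q) μ) :
    ‖hf.toLp f‖ = (∫ ω, |f ω| ^ q ∂μ) ^ (1 / q) := by
  have hq0 : ENNReal.ofReal q ≠ 0 := by simpa using hq
  rw [Lp.norm_toLp, hf.eLpNorm_eq_integral_rpow_norm hq0 ENNReal.ofReal_ne_top,
    ENNReal.toReal_ofReal hq.le, ENNReal.toReal_ofReal, one_div]
  · rfl
  · exact Real.rpow_nonneg (integral_nonneg fun ω => Real.rpow_nonneg (norm_nonneg _) _) _

theorem integral_abs_le_norm_Lp {Ω : Type*} [MeasurableSpace Ω] {μ : Measure Ω}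
    [IsProbabilityMeasure μ] {q : ℝ} (hq : 1 ≤ q) (F : Lp ℝ (ENNReal.ofReal q) μ) :
    ∫ ω, |F ω| ∂μ ≤ ‖F‖ := by
  have h1 : eLpNorm F 1 μ ≤ eLpNorm F (ENNReal.ofReal q) μ :=
    eLpNorm_le_eLpNorm_of_exponent_le (by simpa using hq) (Lp.aestronglyMeasurable F)
  have h2 : ∫ ω, |F ω| ∂μ = (eLpNorm F 1 μ).toReal := by
    rw [eLpNorm_one_eq_lintegral_enorm]
    exact integral_norm_eq_lintegral_enorm (Lp.aestronglyMeasurable F)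
  rw [h2, Lp.norm_def]
  exact ENNReal.toReal_mono (Lp.eLpNorm_ne_top F) h1

/-- A separable `q`-concave Banach lattice, as a completion of the bounded measurable functions on
a probability space, between `L_q` and `L_1`. -/
structure IsMeasureRep {Ω X : Type*} [MeasurableSpace Ω] (μ : Measure Ω) [NormedAddCommGroup X]
    [NormedSpace ℝ X] (T : (Ω → ℝ) →ₗ[ℝ] X) (q C : ℝ) : Prop where
  isConcaveRep : IsConcaveRep (boundedMeasurable Ω) T q C
  norm_le : ∀ f ∈ boundedMeasurable Ω, ‖T f‖ ≤ (∫ ω, |f ω| ^ q ∂μ) ^ (1 / q)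
  integral_le : ∀ f ∈ boundedMeasurable Ω, ∫ ω, |f ω| ∂μ ≤ C * ‖T f‖
  dense : Dense (T '' boundedMeasurable Ω)

/-- The measure `μ` represents a norming functional of the normalised constant function. The two
inequalities of `IsNorming`, read for this functional, are the bound by the `L_q`-norm and the
control of the `L_1`-norm. The first extends the map from `C(K)` to `L_q(μ)`, hence to bounded
measurable functions, and the second survives the extension by density. -/
theorem exists_isMeasureRep.{u} (X : Type u) [NormedAddCommGroup X] [NormedSpace ℝ X]
    [CompleteSpace X] [Lattice X] [IsOrderedAddMonoid X] [HasSolidNorm X] [IsOrderedModule ℝ X]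
    [TopologicalSpace.SeparableSpace X] [Nontrivial X] {q : ℝ} (hq : 1 ≤ q) {C : ℝ≥0}
    (hC1 : 1 ≤ C) (hC : IsConcaveWith q X C) :
    ∃ (Ω : Type u) (_ : MeasurableSpace Ω) (μ : Measure Ω) (_ : IsProbabilityMeasure μ)
      (T : (Ω → ℝ) →ₗ[ℝ] X), IsMeasureRep μ T q C := by
  obtain ⟨K, _, _, _, T, hTabs, hTdense⟩ := exists_continuousMap_latticeHom X
  have hq0 : 0 < q := by linarith
  have hC0 : (0 : ℝ) < C := lt_of_lt_of_le one_pos (by exact_mod_cast hC1)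
  let A := continuousFunctions K
  let S₀ : A →ₗ[ℝ] X :=
    { toFun := fun f => T ⟨f.1, f.2⟩
      map_add' := fun f g => by rw [← map_add]; rfl
      map_smul' := fun c f => by rw [RingHom.id_apply, ← map_smul]; rfl }
  -- Values outside the continuous functions are arbitrary and never used.
  obtain ⟨S, hS⟩ := LinearMap.exists_extend S₀
  have hSval : ∀ f (hf : f ∈ A), S f = T ⟨f, hf⟩ := fun f hf =>
    LinearMap.congr_fun hS ⟨f, hf⟩
  have hrep : IsConcaveRep A S q C := by
    refine isConcaveRep_of_latticeHom hq hC1 hC ?_ ?_ ?_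
    · intro f hf g hg Φ hΦ
      exact hΦ.comp (Continuous.prodMk hf hg)
    · intro f hf
      exact ⟨‖(⟨f, hf⟩ : C(K, ℝ))‖, fun k => (⟨f, hf⟩ : C(K, ℝ)).norm_coe_le_norm k⟩
    · intro f hf
      rw [hSval f hf, hSval _ (Continuous.abs hf), ← hTabs]
      rfl
  set c := concaveNorm A S q (fun _ => 1) with hc
  -- If the constant function had norm zero, monotonicity would force `T = 0`, against the dense
  -- range in a nontrivial space.
  have hcpos : 0 < c := by
    refine (hrep.concaveNorm_nonneg (fun _ => 1)).lt_of_ne ?_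
    intro h0
    obtain ⟨x, hx⟩ := exists_ne (0 : X)
    have hzero : ∀ f, T f = 0 := by
      intro f
      obtain ⟨b, hb⟩ := hrep.bdd f f.continuous
      have h1 := hrep.mono f f.continuous (b • fun _ => 1) (A.smul_mem _ (hrep.const_mem 1))
        (fun k => (hb k).trans (by simpa using le_abs_self b))
      have h2 := hrep.le_concaveNorm (hrep.const_mem 1)
      rw [← h0] at h2
      rw [map_smul, norm_le_zero_iff.1 h2, smul_zero, norm_zero, hSval f f.continuous] at h1
      exact norm_le_zero_iff.1 h1
    have h3 : Set.range T ⊆ {0} := by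
      rintro _ ⟨f, rfl⟩
      exact hzero f
    have h4 := (hTdense.mono h3) x
    rw [closure_singleton] at h4
    exact hx h4
  have hxA : c⁻¹ • (fun _ : K => (1 : ℝ)) ∈ A := A.smul_mem _ (hrep.const_mem 1)
  obtain ⟨π, hπ⟩ := hrep.exists_isNorming hxA (by
    rw [hrep.concaveNorm_smul (hrep.const_mem 1), ← hc, abs_of_pos (inv_pos.2 hcpos),
      inv_mul_cancel₀ hcpos.ne'])
  have hmul : ∀ w : K → ℝ, c⁻¹ • (fun _ : K => (1 : ℝ)) * w = c⁻¹ • w := fun w => by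
    ext k; simp
  let _ : MeasurableSpace K := borel K
  have : BorelSpace K := ⟨rfl⟩
  obtain ⟨μ, hμ, hreg, hint⟩ := exists_measure_of_positive hπ.nonneg hπ.one
  have : Fact (1 ≤ ENNReal.ofReal q) := ⟨by simpa using hq⟩
  have hSq : ∀ f ∈ A, ‖c⁻¹ • S f‖ ≤ (∫ k, |f k| ^ q ∂μ) ^ (1 / q) := by
    intro f hf
    have hf' : (fun k => |f k|) ∈ A := Continuous.abs hf
    have h1 := hπ.ge _ hf' (fun k => abs_nonneg _)
    rw [hmul, ← hint _ (hrep.rpow_mem hf' hq0.le)] at h1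
    have h2 : ‖c⁻¹ • S f‖ ≤ concaveNorm A S q (c⁻¹ • fun k => |f k|) := by
      rw [← map_smul]
      refine (hrep.le_concaveNorm (A.smul_mem _ hf)).trans
        (hrep.concaveNorm_mono (A.smul_mem _ hf') fun k => ?_)
      simp [abs_mul]
    rw [one_div, Real.le_rpow_inv_iff_of_pos (norm_nonneg _)
      (integral_nonneg fun k => Real.rpow_nonneg (abs_nonneg _) _) hq0]
    exact (Real.rpow_le_rpow (norm_nonneg _) h2 hq0.le).trans h1
  have hS1 : ∀ f ∈ A, ∫ k, |f k| ∂μ ≤ C * ‖c⁻¹ • S f‖ := by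
    intro f hf
    have hf' : (fun k => |f k|) ∈ A := Continuous.abs hf
    have h1 := hπ.le _ hf' (fun k => abs_nonneg _)
    rw [hmul, ← hint _ hf'] at h1
    refine h1.trans ?_
    rw [← map_smul]
    refine le_trans (hrep.concaveNorm_mono (A.smul_mem c⁻¹ hf) fun k => ?_)
      (hrep.concaveNorm_le (A.smul_mem _ hf))
    simp [abs_mul]
  let e : C(K, ℝ) →L[ℝ] Lp ℝ (ENNReal.ofReal q) μ := ContinuousMap.toLp (ENNReal.ofReal q) μ ℝ
  have hed : DenseRange e := ContinuousMap.toLp_denseRange ℝ μ ℝ ENNReal.ofReal_ne_top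
  have hemem : ∀ f : C(K, ℝ), MemLp f (ENNReal.ofReal q) μ := fun f =>
    (memLp_congr_ae (ContinuousMap.coeFn_toLp μ f)).1 (Lp.memLp (e f))
  have heq : ∀ f : C(K, ℝ), e f = (hemem f).toLp f := fun f => by
    refine Lp.ext ((ContinuousMap.coeFn_toLp μ f).trans (MemLp.coeFn_toLp _).symm)
  have henorm : ∀ f : C(K, ℝ), ‖e f‖ = (∫ k, |f k| ^ q ∂μ) ^ (1 / q) := fun f => by
    rw [heq, norm_toLp_eq_integral hq0]
  set R := (c⁻¹ • T.toLinearMap).extendOfNorm e.toLinearMap with hR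
  have hbound : ∀ f : C(K, ℝ), ‖(c⁻¹ • T.toLinearMap) f‖ ≤ 1 * ‖e.toLinearMap f‖ := fun f => by
    have := hSq f f.continuous
    rw [hSval f f.continuous, ← henorm] at this
    rw [one_mul]
    exact this
  have hRe : ∀ f : C(K, ℝ), R (e f) = c⁻¹ • T f :=
    LinearMap.extendOfNorm_eq (e := e.toLinearMap) hed ⟨1, hbound⟩
  have hRnorm : ∀ F, ‖R F‖ ≤ ‖F‖ := fun F => by
    have := LinearMap.norm_extendOfNorm_apply_le (e := e.toLinearMap) hed 1 hbound F
    rwa [one_mul] at this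
  have hcont : ∀ {Z : Type u} [NormedAddCommGroup Z] [Lattice Z] [IsOrderedAddMonoid Z]
      [HasSolidNorm Z], Continuous fun z : Z => |z| := by
    intro Z _ _ _ _
    have : Continuous fun z : Z => z ⊔ -z := continuous_id.sup continuous_neg
    exact this
  have heabs : ∀ f : C(K, ℝ), e |f| = |e f| := fun f => by
    refine Lp.ext ((ContinuousMap.coeFn_toLp μ |f|).trans ?_)
    filter_upwards [Lp.coeFn_abs (e f), ContinuousMap.coeFn_toLp μ (𝕜 := ℝ) (p := ENNReal.ofReal q) f]
      with k h1 h2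
    rw [h1, ContinuousMap.abs_apply]
    exact congrArg _ h2.symm
  have hRabs : ∀ F, R |F| = |R F| := fun F => by
    refine hed.induction_on F (isClosed_eq (R.continuous.comp hcont)
      (hcont.comp R.continuous)) fun f => ?_
    rw [← heabs, hRe, hRe, hTabs]
    refine le_antisymm ?_ ?_
    · rw [inv_smul_le_iff_of_pos hcpos]
      have := abs_smul_le_abs_smul_abs c (c⁻¹ • T f)
      rwa [smul_inv_smul₀ hcpos.ne', abs_of_pos hcpos] at this
    · have := abs_smul_le_abs_smul_abs c⁻¹ (T f)
      rwa [abs_of_pos (inv_pos.2 hcpos)] at this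
  have hR1 : ∀ F : Lp ℝ (ENNReal.ofReal q) μ, ∫ k, |F k| ∂μ ≤ C * ‖R F‖ := by
    intro F
    refine le_of_forall_pos_le_add fun ε hε => ?_
    -- Replacing `F` by `e f` costs `‖F - e f‖` in `L_1` and `C` times as much on the right, hence
    -- the factor `1 + C`.
    obtain ⟨f, hf⟩ := Metric.denseRange_iff.1 hed F (ε / (1 + C)) (by positivity)
    rw [dist_eq_norm] at hf
    have hi : ∀ G : Lp ℝ (ENNReal.ofReal q) μ, Integrable G μ := fun G =>
      (Lp.memLp G).integrable (by simpa using hq)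
    have h1 : ∫ k, |F k| ∂μ ≤ ∫ k, |(F - e f) k| ∂μ + ∫ k, |e f k| ∂μ := by
      rw [← integral_add (hi _).abs (hi _).abs]
      refine integral_mono_ae (hi _).abs ((hi _).abs.add (hi _).abs) ?_
      filter_upwards [Lp.coeFn_sub F (e f)] with k hk
      rw [hk, Pi.sub_apply]
      calc |F k| = |(F k - e f k) + e f k| := by ring_nf
        _ ≤ _ := abs_add_le _ _
    have h2 := integral_abs_le_norm_Lp hq (F - e f)
    have h3 : ∫ k, |e f k| ∂μ ≤ C * ‖R (e f)‖ := by
      have h5 := hS1 f f.continuous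
      rw [hSval f f.continuous] at h5
      rw [hRe]
      refine le_trans (le_of_eq ?_) h5
      refine integral_congr_ae ?_
      filter_upwards [ContinuousMap.coeFn_toLp μ (𝕜 := ℝ) (p := ENNReal.ofReal q) f] with k hk
      exact congrArg _ hk
    have h4 : ‖R (e f)‖ ≤ ‖R F‖ + ‖F - e f‖ := by
      have h5 := hRnorm (F - e f)
      have h6 := norm_sub_norm_le (R (e f)) (R F)
      rw [norm_sub_rev, ← map_sub] at h6
      linarith
    have h7 : C * ‖R (e f)‖ ≤ C * (‖R F‖ + ‖F - e f‖) := mul_le_mul_of_nonneg_left h4 hC0.le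
    have h8 : (1 + C) * ‖F - e f‖ ≤ ε := by
      have := mul_le_mul_of_nonneg_left hf.le (by positivity : (0 : ℝ) ≤ 1 + C)
      rwa [mul_div_cancel₀ _ (by positivity)] at this
    nlinarith
  let U₀ : boundedMeasurable K →ₗ[ℝ] X :=
    { toFun := fun f => R ((memLp_of_mem_boundedMeasurable f.2 _).toLp f.1)
      map_add' := fun f g => by rw [← map_add]; rfl
      map_smul' := fun a f => by rw [RingHom.id_apply, ← map_smul]; rfl }
  obtain ⟨U, hU⟩ := LinearMap.exists_extend U₀
  have hUval : ∀ f (hf : f ∈ boundedMeasurable K),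
      U f = R ((memLp_of_mem_boundedMeasurable hf _).toLp f) := fun f hf =>
    LinearMap.congr_fun hU ⟨f, hf⟩
  refine ⟨K, inferInstance, μ, hμ, U, ?_, ?_, ?_, ?_⟩
  · refine isConcaveRep_of_latticeHom hq hC1 hC
      (fun f hf g hg Φ hΦ => comp_mem_boundedMeasurable hf hg hΦ) (fun f hf => hf.2) ?_
    intro f hf
    have hf' : (fun k => |f k|) ∈ boundedMeasurable K :=
      comp_mem_boundedMeasurable hf hf (Φ := fun a _ => |a|) (by fun_prop)
    rw [hUval f hf, hUval _ hf', ← hRabs]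
    congr 1
  · intro f hf
    rw [hUval f hf, ← norm_toLp_eq_integral hq0 (memLp_of_mem_boundedMeasurable hf _)]
    exact hRnorm _
  · intro f hf
    rw [hUval f hf]
    refine le_trans (le_of_eq (integral_congr_ae ?_)) (hR1 _)
    filter_upwards [MemLp.coeFn_toLp
      (memLp_of_mem_boundedMeasurable (μ := μ) hf (ENNReal.ofReal q))] with k hk
    rw [hk]
  · refine Dense.mono ?_ hTdense
    rintro _ ⟨f, rfl⟩
    have hb : ∀ g : C(K, ℝ), (g : K → ℝ) ∈ boundedMeasurable K := fun g =>
      ⟨g.continuous.measurable, ‖g‖, fun k => g.norm_coe_le_norm k⟩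
    -- The factor `c` undoes the normalisation `c⁻¹` built into `R`.
    refine ⟨c • f, Submodule.smul_mem _ _ (hb f), ?_⟩
    rw [map_smul, hUval f (hb f)]
    have := hRe f
    rw [heq] at this
    rw [this, smul_inv_smul₀ hcpos.ne']

end MeasureRepresentation

/-! ### Norming densities. -/

section Density

open MeasureTheory

variable {Ω X : Type*} [MeasurableSpace Ω] {μ : Measure Ω} [NormedAddCommGroup X]
  [NormedSpace ℝ X] {T : (Ω → ℝ) →ₗ[ℝ] X} {q C : ℝ}

/-- The renorming of the bounded measurable functions with `q`-concavity constant `1`. -/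
noncomputable abbrev bmNorm (T : (Ω → ℝ) →ₗ[ℝ] X) (q : ℝ) (f : Ω → ℝ) : ℝ :=
  concaveNorm (boundedMeasurable Ω) T q f

/-- `ρ` is the density of `w ↦ φ (|x| w)`, where `φ` is the norming functional of `|x|`. -/
structure IsNormingDensity (μ : Measure Ω) (T : (Ω → ℝ) →ₗ[ℝ] X) (q : ℝ) (x ρ : Ω → ℝ) :
    Prop where
  measurable : Measurable ρ
  nonneg : ∀ ω, 0 ≤ ρ ω
  integrable : Integrable ρ μ
  integral_eq_one : ∫ ω, ρ ω ∂μ = 1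
  le : ∀ w ∈ boundedMeasurable Ω, (∀ ω, 0 ≤ w ω) → ∫ ω, ρ ω * w ω ∂μ ≤ bmNorm T q (x * w)
  ge : ∀ w ∈ boundedMeasurable Ω, (∀ ω, 0 ≤ w ω) →
    bmNorm T q (x * w) ^ q ≤ ∫ ω, ρ ω * w ω ^ q ∂μ

theorem indicator_mem_boundedMeasurable {B : Set Ω} (hB : MeasurableSet B) (c : ℝ) :
    B.indicator (fun _ => c) ∈ boundedMeasurable Ω := by
  refine ⟨measurable_const.indicator hB, |c|, fun ω => ?_⟩
  by_cases h : ω ∈ B <;> simp [h]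

/-- Round `w` down to multiples of `ε`; boundedness leaves finitely many values. -/
theorem exists_simple_approx {w : Ω → ℝ} (hw : w ∈ boundedMeasurable Ω) {ε : ℝ} (hε : 0 < ε) :
    ∃ (I : Finset ℤ) (c : ℤ → ℝ) (B : ℤ → Set Ω), (∀ k, MeasurableSet (B k)) ∧
      ∀ ω, (∑ k ∈ I, c k • (B k).indicator fun _ => (1 : ℝ)) ω ≤ w ω ∧
        w ω ≤ (∑ k ∈ I, c k • (B k).indicator fun _ => (1 : ℝ)) ω + ε := by
  obtain ⟨hm, b, hb⟩ := hw
  have hfl : Measurable fun ω => ⌊w ω / ε⌋ := (hm.div_const ε).floor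
  set n : ℤ := ⌈b / ε⌉ + 1 with hn
  refine ⟨Finset.Icc (-n) n, fun k => ε * k, fun k => {ω | ⌊w ω / ε⌋ = k},
    fun k => hfl (measurableSet_singleton k), fun ω => ?_⟩
  have hval : (∑ k ∈ Finset.Icc (-n) n,
      (ε * (k : ℝ)) • Set.indicator {ω | ⌊w ω / ε⌋ = k} fun _ => (1 : ℝ)) ω =
      ε * ⌊w ω / ε⌋ := by
    rw [Finset.sum_apply, Finset.sum_eq_single ⌊w ω / ε⌋]
    · simp
    · intro k _ hk
      have : ω ∉ {ω | ⌊w ω / ε⌋ = k} := fun h => hk h.symm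
      simp only [Pi.smul_apply, Set.indicator_of_notMem this, smul_zero]
    · intro hk
      exfalso
      apply hk
      obtain ⟨h1, h2⟩ := abs_le.1 (hb ω)
      have h3 : w ω / ε ≤ b / ε := by gcongr
      have h4 : -(b / ε) ≤ w ω / ε := by rw [← neg_div]; gcongr
      rw [Finset.mem_Icc]
      have h5 := Int.le_ceil (b / ε)
      refine ⟨Int.le_floor.2 ?_, ?_⟩
      · rw [hn]; push_cast; linarith
      · have h6 := Int.floor_le (w ω / ε)
        have : (⌊w ω / ε⌋ : ℝ) ≤ (n : ℝ) := by rw [hn]; push_cast; linarith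
        exact_mod_cast this
  rw [hval]
  have h1 := Int.floor_le (w ω / ε)
  have h2 := Int.lt_floor_add_one (w ω / ε)
  rw [le_div_iff₀ hε] at h1
  rw [div_lt_iff₀ hε] at h2
  constructor <;> nlinarith

/-- A positive functional on the bounded measurable functions that is dominated by an `L_q`-norm
is integration against a density. -/
theorem exists_density_of_positive [IsProbabilityMeasure μ] {π : (Ω → ℝ) →ₗ[ℝ] ℝ}
    (hnn : ∀ w ∈ boundedMeasurable Ω, (∀ ω, 0 ≤ w ω) → 0 ≤ π w) {D r : ℝ} (hr : 0 < r)
    (hle : ∀ B, MeasurableSet B → π (B.indicator fun _ => 1) ≤ D * μ.real B ^ r) :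
    ∃ ρ : Ω → ℝ, Measurable ρ ∧ (∀ ω, 0 ≤ ρ ω) ∧ Integrable ρ μ ∧
      ∀ w ∈ boundedMeasurable Ω, ∫ ω, ρ ω * w ω ∂μ = π w := by
  set m : Set Ω → ℝ := fun B => π (B.indicator fun _ => 1) with hm
  have hm0 : ∀ B, MeasurableSet B → 0 ≤ m B := fun B hB =>
    hnn _ (indicator_mem_boundedMeasurable hB 1) fun ω => Set.indicator_nonneg (by simp) ω
  have hempty : m ∅ = 0 := by
    simp only [hm, Set.indicator_empty]
    exact map_zero π
  have hunion : ∀ A B : Set Ω, Disjoint A B → m (A ∪ B) = m A + m B := fun A B hAB => by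
    simp only [hm]
    rw [Set.indicator_union_of_disjoint hAB, ← map_add]
    rfl
  have hfin : ∀ (B : ℕ → Set Ω), Pairwise (Function.onFun Disjoint B) → ∀ n,
      m (⋃ i ∈ Finset.range n, B i) = ∑ i ∈ Finset.range n, m (B i) := by
    intro B hB n
    simp only [hm]
    rw [← map_sum]
    congr 1
    ext ω
    rw [Finset.indicator_biUnion _ _ (fun i _ j _ hij => hB hij), Finset.sum_apply]
  -- Countable additivity of `m`: the tails of a disjoint union have `μ`-measure tending to zero,
  -- and `m ≤ D μ^r` carries this to `m`. The same bound gives absolute continuity, so Radon–Nikodym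
  -- applies.
  have hsum : ∀ (B : ℕ → Set Ω), (∀ i, MeasurableSet (B i)) →
      Pairwise (Function.onFun Disjoint B) → HasSum (fun i => m (B i)) (m (⋃ i, B i)) := by
    intro B hBm hB
    rw [hasSum_iff_tendsto_nat_of_nonneg (fun i => hm0 _ (hBm i))]
    set V : ℕ → Set Ω := fun n => ⋃ i ∈ Finset.range n, B i with hV
    have hVm : ∀ n, MeasurableSet (V n) := fun n =>
      Finset.measurableSet_biUnion _ fun i _ => hBm i
    have hVsub : ∀ n, V n ⊆ ⋃ i, B i := fun n =>
      Set.iUnion₂_subset fun i _ => Set.subset_iUnion B i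
    have hUm : MeasurableSet (⋃ i, B i) := MeasurableSet.iUnion hBm
    have hsplit : ∀ n, m (⋃ i, B i) = ∑ i ∈ Finset.range n, m (B i) + m ((⋃ i, B i) \ V n) := by
      intro n
      rw [← hfin B hB n, ← hunion _ _ disjoint_sdiff_self_right, Set.union_sdiff_cancel (hVsub n)]
    have hVmono : Monotone V := fun a b hab =>
      Set.biUnion_subset_biUnion_left fun i hi =>
        Finset.mem_coe.2 (Finset.range_mono hab hi)
    have htail : Filter.Tendsto (fun n => μ.real ((⋃ i, B i) \ V n)) Filter.atTop (nhds 0) := by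
      have h1 : Filter.Tendsto (fun n => μ ((⋃ i, B i) \ V n)) Filter.atTop
          (nhds (μ (⋂ n, (⋃ i, B i) \ V n))) :=
        tendsto_measure_iInter_atTop (fun n => (hUm.diff (hVm n)).nullMeasurableSet)
          (fun a b hab => Set.sdiff_subset_sdiff_right (hVmono hab)) ⟨0, measure_ne_top _ _⟩
      have h2 : (⋂ n, (⋃ i, B i) \ V n) = ∅ := by
        ext ω
        simp only [Set.mem_iInter, Set.mem_empty_iff_false, iff_false, not_forall]
        by_contra! hcon
        obtain ⟨i, hi⟩ := Set.mem_iUnion.1 (hcon 0).1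
        refine (hcon (i + 1)).2 ?_
        exact Set.mem_iUnion₂.2 ⟨i, by simp, hi⟩
      rw [h2, measure_empty] at h1
      have := (ENNReal.tendsto_toReal ENNReal.zero_ne_top).comp h1
      rw [ENNReal.toReal_zero] at this
      exact this
    have hbound : Filter.Tendsto (fun n => D * μ.real ((⋃ i, B i) \ V n) ^ r) Filter.atTop
        (nhds 0) := by
      have := (htail.rpow_const (p := r) (Or.inr hr.le)).const_mul D
      rwa [Real.zero_rpow hr.ne', mul_zero] at this
    have hz : Filter.Tendsto (fun n => m ((⋃ i, B i) \ V n)) Filter.atTop (nhds 0) :=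
      squeeze_zero (fun n => hm0 _ (hUm.diff (hVm n))) (fun n => hle _ (hUm.diff (hVm n))) hbound
    have h3 : (fun n => ∑ i ∈ Finset.range n, m (B i)) =
        fun n => m (⋃ i, B i) - m ((⋃ i, B i) \ V n) := by
      ext n; linarith [hsplit n]
    rw [h3]
    simpa using hz.const_sub (m (⋃ i, B i))
  let ν : Measure Ω := Measure.ofMeasurable (fun B _ => ENNReal.ofReal (m B))
    (by simp [hempty]) (by
      intro B hBm hB
      have h1 := hsum B hBm hB
      rw [← h1.tsum_eq, ENNReal.ofReal_tsum_of_nonneg (fun i => hm0 _ (hBm i)) h1.summable])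
  have hν : ∀ B, MeasurableSet B → ν B = ENNReal.ofReal (m B) := fun B hB =>
    Measure.ofMeasurable_apply B hB
  have hνfin : IsFiniteMeasure ν := ⟨by rw [hν _ MeasurableSet.univ]; exact ENNReal.ofReal_lt_top⟩
  have hac : ν ≪ μ := by
    refine Measure.AbsolutelyContinuous.mk fun B hB h0 => ?_
    rw [hν B hB, ENNReal.ofReal_eq_zero]
    refine (hle B hB).trans ?_
    rw [Measure.real, h0, ENNReal.toReal_zero, Real.zero_rpow hr.ne', mul_zero]
  have hmono : ∀ v ∈ boundedMeasurable Ω, ∀ w ∈ boundedMeasurable Ω, (∀ ω, v ω ≤ w ω) →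
      π v ≤ π w := fun v hv w hw hvw => IsConcaveRep.functional_mono hnn hv hw hvw
  have hint : ∀ w ∈ boundedMeasurable Ω, ∫ ω, w ω ∂ν = π w := by
    intro w hw
    have hclose : ∀ ε : ℝ, 0 < ε → |∫ ω, w ω ∂ν - π w| ≤ ε * m Set.univ := by
      intro ε hε
      obtain ⟨I, c, B, hB, happ⟩ := exists_simple_approx hw hε
      set g : Ω → ℝ := ∑ k ∈ I, c k • (B k).indicator fun _ => (1 : ℝ) with hg
      have hgm : g ∈ boundedMeasurable Ω := Submodule.sum_mem _ fun k _ =>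
        Submodule.smul_mem _ _ (indicator_mem_boundedMeasurable (hB k) 1)
      have hπg : ∫ ω, g ω ∂ν = π g := by
        rw [hg, map_sum]
        simp only [Finset.sum_apply]
        rw [integral_finsetSum]
        · refine Finset.sum_congr rfl fun k _ => ?_
          simp only [Pi.smul_apply]
          rw [integral_smul, map_smul, integral_indicator_const _ (hB k), Measure.real, hν _ (hB k),
            ENNReal.toReal_ofReal (hm0 _ (hB k))]
          simp [hm]
        · intro k _
          exact integrable_of_mem_boundedMeasurable (Submodule.smul_mem _ _
            (indicator_mem_boundedMeasurable (hB k) 1))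
      have huniv := indicator_mem_boundedMeasurable (Ω := Ω) MeasurableSet.univ 1
      have hgε : g + ε • (Set.univ.indicator fun _ => (1 : ℝ)) ∈ boundedMeasurable Ω :=
        Submodule.add_mem _ hgm (Submodule.smul_mem _ _ huniv)
      have h1 := hmono g hgm w hw fun ω => (happ ω).1
      have h2 := hmono w hw _ hgε fun ω => by simpa using (happ ω).2
      rw [map_add, map_smul, smul_eq_mul] at h2
      have hgi := integrable_of_mem_boundedMeasurable (μ := ν) hgm
      have hwi := integrable_of_mem_boundedMeasurable (μ := ν) hw
      have h3 : ∫ ω, g ω ∂ν ≤ ∫ ω, w ω ∂ν := integral_mono hgi hwi fun ω => (happ ω).1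
      have h4 : ∫ ω, w ω ∂ν ≤ ∫ ω, g ω ∂ν + ε * m Set.univ := by
        have h5 : ∫ ω, w ω ∂ν ≤ ∫ ω, (g ω + ε) ∂ν :=
          integral_mono hwi (hgi.add (integrable_const ε)) fun ω => (happ ω).2
        rw [integral_add hgi (integrable_const ε), integral_const, Measure.real,
          hν _ MeasurableSet.univ, ENNReal.toReal_ofReal (hm0 _ MeasurableSet.univ), smul_eq_mul,
          mul_comm] at h5
        exact h5
      change π w ≤ π g + ε * m Set.univ at h2
      rw [abs_le]
      constructor <;> linarith
    have hlim : Filter.Tendsto (fun ε : ℝ => ε * m Set.univ) (nhdsWithin 0 (Set.Ioi 0))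
        (nhds (0 * m Set.univ)) :=
      (Continuous.tendsto (by fun_prop) 0).mono_left nhdsWithin_le_nhds
    rw [zero_mul] at hlim
    have h6 := ge_of_tendsto hlim (Filter.eventually_of_mem self_mem_nhdsWithin
      fun ε hε => hclose ε hε)
    exact sub_eq_zero.1 (abs_nonpos_iff.1 h6)
  refine ⟨fun ω => (ν.rnDeriv μ ω).toReal, (Measure.measurable_rnDeriv ν μ).ennreal_toReal,
    fun ω => ENNReal.toReal_nonneg, Measure.integrable_toReal_rnDeriv, fun w hw => ?_⟩
  rw [← hint w hw]
  exact integral_rnDeriv_smul hac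

/-- If `|x| ≤ b`, then `π 1_B ≤ N(x 1_B) ≤ C b ‖T 1_B‖ ≤ C b μ(B)^(1/q)`, so the norming functional
is absolutely continuous. -/
theorem IsMeasureRep.exists_isNormingDensity [IsProbabilityMeasure μ] (h : IsMeasureRep μ T q C)
    {x : Ω → ℝ} (hx : x ∈ boundedMeasurable Ω) (hN : bmNorm T q x = 1) :
    ∃ ρ, IsNormingDensity μ T q x ρ := by
  have hr := h.isConcaveRep
  have hq0 := hr.q_pos
  obtain ⟨π, hπ⟩ := hr.exists_isNorming hx hN
  obtain ⟨b, hb⟩ := hx.2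
  have hC0 : 0 ≤ C := zero_le_one.trans hr.one_le_C
  obtain ⟨ρ, h1, h2, h3, h4⟩ := exists_density_of_positive (μ := μ) hπ.nonneg (D := C * |b|)
    (r := 1 / q) (by positivity) (fun B hB => by
      have hI := indicator_mem_boundedMeasurable hB 1
      refine (hπ.le _ hI fun ω => Set.indicator_nonneg (by simp) ω).trans ?_
      refine (hr.concaveNorm_le (hr.mul_mem hx hI)).trans ?_
      have h5 := hr.mono _ (hr.mul_mem hx hI) _ (Submodule.smul_mem _ |b| hI) (fun ω => by
        rw [Pi.mul_apply, Pi.smul_apply, smul_eq_mul, abs_mul, abs_mul, abs_abs]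
        exact mul_le_mul_of_nonneg_right ((hb ω).trans (le_abs_self b)) (abs_nonneg _))
      rw [map_smul, norm_smul, Real.norm_of_nonneg (abs_nonneg b)] at h5
      have h6 := h.norm_le _ hI
      have h7 : (fun ω => |B.indicator (fun _ => (1 : ℝ)) ω| ^ q) = B.indicator fun _ => 1 := by
        ext ω
        by_cases hω : ω ∈ B <;> simp [hω, hq0.ne']
      rw [h7, integral_indicator_const _ hB, smul_eq_mul, mul_one] at h6
      rw [mul_assoc]
      exact mul_le_mul_of_nonneg_left
        (h5.trans (mul_le_mul_of_nonneg_left h6 (abs_nonneg b))) hC0)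
  refine ⟨ρ, h1, h2, h3, ?_, ?_, ?_⟩
  · have := h4 _ (hr.const_mem 1)
    simpa [hπ.one] using this
  · intro w hw hw0
    rw [h4 w hw]
    exact hπ.le w hw hw0
  · intro w hw hw0
    rw [h4 _ (hr.rpow_mem hw hq0.le)]
    exact hπ.ge w hw hw0

end Density

/-! ### Moduli of continuity between `|x|` and its norming density. -/

section Estimates

open MeasureTheory

/-- Bernoulli at `-t / (1 + t)` gives `(1 + t)^q - 1 ≤ q t (1 + t)^q`; convexity on `[1, 2]` then
bounds `(1 + t)^q` by `1 + t (2^q - 1)`. -/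
theorem one_add_rpow_sub_one_le {q t : ℝ} (hq : 1 ≤ q) (ht0 : 0 ≤ t) (ht1 : t ≤ 1) :
    ((1 + t) ^ q - 1) / q ≤ t + 2 ^ q * t ^ 2 := by
  have hq0 : 0 < q := by linarith
  have h1t : 0 < 1 + t := by linarith
  have hpos : 0 < (1 + t) ^ q := Real.rpow_pos_of_pos h1t q
  have h1 : 1 - q * (t / (1 + t)) ≤ ((1 + t) ^ q)⁻¹ := by
    have := one_add_mul_self_le_rpow_one_add (s := -(t / (1 + t))) (by
      rw [neg_le_neg_iff, div_le_one h1t]; linarith) hq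
    have h2 : 1 + -(t / (1 + t)) = (1 + t)⁻¹ := by field_simp; ring
    rw [h2, Real.inv_rpow h1t.le] at this
    linarith
  have h2 : (1 + t) ^ q - 1 ≤ q * t * (1 + t) ^ q := by
    have h3 := mul_le_mul_of_nonneg_right h1 hpos.le
    rw [inv_mul_cancel₀ hpos.ne'] at h3
    have h4 : t / (1 + t) ≤ t := div_le_self ht0 (by linarith)
    have h5 : q * (t / (1 + t)) * (1 + t) ^ q ≤ q * t * (1 + t) ^ q := by gcongr
    nlinarith
  have h3 : (1 + t) ^ q ≤ 1 + t * (2 ^ q - 1) := by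
    have := (convexOn_rpow hq).2 (show (1 : ℝ) ∈ Set.Ici 0 by simp)
      (show (2 : ℝ) ∈ Set.Ici 0 by simp) (show 0 ≤ 1 - t by linarith) ht0 (by ring)
    simp only [smul_eq_mul, Real.one_rpow, mul_one] at this
    rw [show 1 - t + t * 2 = 1 + t by ring] at this
    linarith
  rw [div_le_iff₀ hq0]
  have h4 : q * t * (1 + t) ^ q ≤ q * t * (1 + t * (2 ^ q - 1)) := by gcongr
  nlinarith [mul_nonneg hq0.le (sq_nonneg t)]

variable {Ω X : Type*} [MeasurableSpace Ω] {μ : Measure Ω} [NormedAddCommGroup X]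
  [NormedSpace ℝ X] {T : (Ω → ℝ) →ₗ[ℝ] X} {q C : ℝ} {x y ρ σ : Ω → ℝ}

theorem integrable_mul_of_mem_boundedMeasurable {w : Ω → ℝ} (hρ : Integrable ρ μ)
    (hw : w ∈ boundedMeasurable Ω) : Integrable (fun ω => ρ ω * w ω) μ := by
  obtain ⟨hm, c, hc⟩ := hw
  exact hρ.mul_bdd hm.aestronglyMeasurable (Filter.Eventually.of_forall hc)

theorem div_mem_boundedMeasurable (hx : x ∈ boundedMeasurable Ω) (hy : y ∈ boundedMeasurable Ω)
    (hx0 : ∃ a > 0, ∀ ω, a ≤ |x ω|) : (fun ω => y ω / x ω) ∈ boundedMeasurable Ω := by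
  obtain ⟨a, ha, hax⟩ := hx0
  obtain ⟨hym, b, hb⟩ := hy
  refine ⟨hym.div hx.1, b / a, fun ω => ?_⟩
  rw [abs_div]
  have := hb ω
  have h0 : 0 ≤ b := (abs_nonneg _).trans this
  exact div_le_div₀ h0 this ha (hax ω)

theorem ne_zero_of_bounded_below (hx0 : ∃ a > 0, ∀ ω, a ≤ |x ω|) (ω : Ω) : x ω ≠ 0 := by
  obtain ⟨a, ha, hax⟩ := hx0
  exact abs_pos.1 (ha.trans_le (hax ω))

theorem IsMeasureRep.bmNorm_congr_abs (h : IsMeasureRep μ T q C) {f g : Ω → ℝ}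
    (hf : f ∈ boundedMeasurable Ω) (hg : g ∈ boundedMeasurable Ω) (hfg : ∀ ω, |f ω| = |g ω|) :
    bmNorm T q f = bmNorm T q g :=
  le_antisymm (h.isConcaveRep.concaveNorm_mono hg fun ω => (hfg ω).le)
    (h.isConcaveRep.concaveNorm_mono hf fun ω => (hfg ω).ge)

theorem IsNormingDensity.setIntegral_le_one (hρ : IsNormingDensity μ T q x ρ) (B : Set Ω) :
    ∫ ω in B, ρ ω ∂μ ≤ 1 := by
  rw [← hρ.integral_eq_one]
  exact setIntegral_le_integral hρ.integrable (Filter.Eventually.of_forall hρ.nonneg)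

theorem integral_mul_indicator {B : Set Ω} (hB : MeasurableSet B) :
    ∫ ω, ρ ω * B.indicator (fun _ => (1 : ℝ)) ω ∂μ = ∫ ω in B, ρ ω ∂μ := by
  rw [← integral_indicator hB]
  refine integral_congr_ae (Filter.Eventually.of_forall fun ω => ?_)
  by_cases hω : ω ∈ B <;> simp [hω]

/-- Upper estimate of the norm of a perturbation `y (1 + t 1_B)`. -/
theorem IsNormingDensity.bmNorm_perturb_le (h : IsMeasureRep μ T q C)
    (hσ : IsNormingDensity μ T q y σ) {B : Set Ω} (hB : MeasurableSet B) {t : ℝ} (ht0 : 0 ≤ t)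
    (ht1 : t ≤ 1) :
    bmNorm T q (y * fun ω => 1 + t * B.indicator (fun _ => 1) ω) ≤
      1 + t * ∫ ω in B, σ ω ∂μ + 2 ^ q * t ^ 2 := by
  have hr := h.isConcaveRep
  have hq := hr.one_le_q
  have hq0 := hr.q_pos
  have hI := indicator_mem_boundedMeasurable hB 1
  set w : Ω → ℝ := fun ω => 1 + t * B.indicator (fun _ => 1) ω with hw
  have hwA : w ∈ boundedMeasurable Ω :=
    Submodule.add_mem _ (hr.const_mem 1) (Submodule.smul_mem _ t hI)
  have hI0 : ∀ ω, 0 ≤ B.indicator (fun _ => (1 : ℝ)) ω := fun ω =>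
    Set.indicator_nonneg (by simp) ω
  have hw0 : ∀ ω, 0 ≤ w ω := fun ω => add_nonneg zero_le_one (mul_nonneg ht0 (hI0 ω))
  have h1 := hσ.ge w hwA hw0
  set s := ∫ ω in B, σ ω ∂μ with hs
  have hs0 : 0 ≤ s := setIntegral_nonneg hB fun ω _ => hσ.nonneg ω
  have hs1 : s ≤ 1 := hσ.setIntegral_le_one B
  have h2 : ∫ ω, σ ω * w ω ^ q ∂μ = 1 + ((1 + t) ^ q - 1) * s := by
    have h3 : (fun ω => σ ω * w ω ^ q) = fun ω => σ ω +
        ((1 + t) ^ q - 1) * (σ ω * B.indicator (fun _ => (1 : ℝ)) ω) := by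
      ext ω
      by_cases hω : ω ∈ B
      · simp [hw, hω]; ring
      · simp [hw, hω]
    rw [h3, integral_add hσ.integrable
      ((integrable_mul_of_mem_boundedMeasurable hσ.integrable hI).const_mul _),
      integral_const_mul, integral_mul_indicator hB, hσ.integral_eq_one]
  rw [h2] at h1
  have hone : 1 ≤ (1 + t) ^ q := Real.one_le_rpow (by linarith) hq0.le
  have hK : 0 ≤ ((1 + t) ^ q - 1) * s := mul_nonneg (by linarith) hs0
  have h3 := rpow_one_add_le_one_add_mul_self (s := ((1 + t) ^ q - 1) * s) (by linarith)
    (p := 1 / q) (by positivity) (by rw [div_le_one hq0]; exact hq)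
  have h4 : bmNorm T q (y * w) ≤ (1 + ((1 + t) ^ q - 1) * s) ^ (1 / q) := by
    rw [one_div, Real.le_rpow_inv_iff_of_pos (hr.concaveNorm_nonneg _) (by linarith) hq0]
    exact h1
  have h5 := one_add_rpow_sub_one_le hq ht0 ht1
  have h6 : ((1 + t) ^ q - 1) / q * s ≤ (t + 2 ^ q * t ^ 2) * s :=
    mul_le_mul_of_nonneg_right h5 hs0
  have h7 : 2 ^ q * t ^ 2 * s ≤ 2 ^ q * t ^ 2 := mul_le_of_le_one_right (by positivity) hs1
  have h8 : 1 / q * (((1 + t) ^ q - 1) * s) = ((1 + t) ^ q - 1) / q * s := by ring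
  rw [h8] at h3
  linarith

/-- Test with `y (1 + t 1_B)`. From above, `bmNorm_perturb_le` uses `σ`. From below, pairing with
`ρ` gives `∫ ρ |y/x| (1 + t 1_B)`; replacing `|y/x|` by `1` costs `2 ∫ ρ |1 - y/x| ≤ 2ε`, where `ε =
N(x - y)`. So the difference is at most `2^q t + 2ε/t`, and `t = √ε` is used for `0 < ε < 1`. For `ε
≥ 1` the claim is trivial as both masses lie in `[0, 1]`; for `ε = 0` let `t → 0`. -/
theorem IsNormingDensity.setIntegral_sub_le (h : IsMeasureRep μ T q C)
    (hx : x ∈ boundedMeasurable Ω) (hy : y ∈ boundedMeasurable Ω)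
    (hx0 : ∃ a > 0, ∀ ω, a ≤ |x ω|)
    (hρ : IsNormingDensity μ T q x ρ) (hσ : IsNormingDensity μ T q y σ) {B : Set Ω}
    (hB : MeasurableSet B) :
    ∫ ω in B, ρ ω ∂μ - ∫ ω in B, σ ω ∂μ ≤ (2 ^ q + 2) * √(bmNorm T q (x - y)) := by
  have hr := h.isConcaveRep
  have hI := indicator_mem_boundedMeasurable hB 1
  have hI0 : ∀ ω, 0 ≤ B.indicator (fun _ => (1 : ℝ)) ω := fun ω =>
    Set.indicator_nonneg (by simp) ω
  have hI1 : ∀ ω, B.indicator (fun _ => (1 : ℝ)) ω ≤ 1 := fun ω =>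
    Set.indicator_le_self' (by simp) ω
  set ε := bmNorm T q (x - y) with hε
  have hε0 : 0 ≤ ε := hr.concaveNorm_nonneg _
  have hxne := ne_zero_of_bounded_below hx0
  have hdiv := div_mem_boundedMeasurable hx hy hx0
  set r : Ω → ℝ := fun ω => |y ω / x ω| with hr_def
  have hrA : r ∈ boundedMeasurable Ω := hr.comp_one hdiv (Φ := fun a => |a|) continuous_abs
  set d : Ω → ℝ := fun ω => |1 - y ω / x ω| with hd
  have hdA : d ∈ boundedMeasurable Ω :=
    hr.comp_one hdiv (Φ := fun a => |1 - a|) (by fun_prop)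
  have hint := fun {w : Ω → ℝ} (hw : w ∈ boundedMeasurable Ω) =>
    integrable_mul_of_mem_boundedMeasurable hρ.integrable hw
  have hdle : ∫ ω, ρ ω * d ω ∂μ ≤ ε := by
    refine (hρ.le d hdA fun ω => abs_nonneg _).trans (le_of_eq ?_)
    refine h.bmNorm_congr_abs (hr.mul_mem hx hdA) (Submodule.sub_mem _ hx hy) fun ω => ?_
    rw [Pi.mul_apply, Pi.sub_apply, abs_mul, hd, abs_abs, ← abs_mul]
    congr 1
    have := hxne ω
    field_simp
  have key : ∀ t : ℝ, 0 < t → t ≤ 1 →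
      ∫ ω in B, ρ ω ∂μ - ∫ ω in B, σ ω ∂μ ≤ 2 ^ q * t + 2 * ε / t := by
    intro t ht0 ht1
    set w : Ω → ℝ := fun ω => 1 + t * B.indicator (fun _ => 1) ω with hw
    have hwA : w ∈ boundedMeasurable Ω :=
      Submodule.add_mem _ (hr.const_mem 1) (Submodule.smul_mem _ t hI)
    have hw0 : ∀ ω, 0 ≤ w ω := fun ω => add_nonneg zero_le_one (mul_nonneg ht0.le (hI0 ω))
    have hw2 : ∀ ω, w ω ≤ 2 := fun ω => by
      have := mul_le_mul ht1 (hI1 ω) (hI0 ω) zero_le_one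
      simp only [hw]; linarith
    have h1 := hσ.bmNorm_perturb_le h hB ht0.le ht1
    have h2 := hρ.le (r * w) (hr.mul_mem hrA hwA) fun ω => mul_nonneg (abs_nonneg _) (hw0 ω)
    have h3 : bmNorm T q (x * (r * w)) = bmNorm T q (y * w) := by
      refine h.bmNorm_congr_abs (hr.mul_mem hx (hr.mul_mem hrA hwA)) (hr.mul_mem hy hwA)
        fun ω => ?_
      simp only [Pi.mul_apply, abs_mul, hr_def, abs_abs, abs_div]
      have := abs_ne_zero.2 (hxne ω)
      field_simp
    rw [h3] at h2
    have h4 : ∫ ω, ρ ω * w ω ∂μ = 1 + t * ∫ ω in B, ρ ω ∂μ := by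
      have h5 : (fun ω => ρ ω * w ω) = fun ω => ρ ω +
          t * (ρ ω * B.indicator (fun _ => (1 : ℝ)) ω) := by
        ext ω; simp only [hw]; ring
      rw [h5, integral_add hρ.integrable ((hint hI).const_mul _), integral_const_mul,
        integral_mul_indicator hB, hρ.integral_eq_one]
    have h5 : ∫ ω, ρ ω * w ω ∂μ - 2 * ∫ ω, ρ ω * d ω ∂μ ≤ ∫ ω, ρ ω * (r * w) ω ∂μ := by
      rw [← integral_const_mul, ← integral_sub (hint hwA) ((hint hdA).const_mul _)]
      refine integral_mono ((hint hwA).sub ((hint hdA).const_mul _))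
        (hint (hr.mul_mem hrA hwA)) fun ω => ?_
      have h6 : 1 - d ω ≤ r ω := by
        simp only [hd, hr_def]
        have := abs_sub_abs_le_abs_sub 1 (y ω / x ω)
        rw [abs_one] at this
        linarith
      have h7 : w ω - 2 * d ω ≤ r ω * w ω := by
        have h8 := mul_le_mul_of_nonneg_right h6 (hw0 ω)
        have h9 := mul_le_mul_of_nonneg_left (hw2 ω) (abs_nonneg (1 - y ω / x ω))
        simp only [hd] at h8 ⊢
        linarith
      have h10 := mul_le_mul_of_nonneg_left h7 (hρ.nonneg ω)
      simp only [Pi.mul_apply]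
      linarith
    rw [h4] at h5
    have h6 : t * (∫ ω in B, ρ ω ∂μ - ∫ ω in B, σ ω ∂μ) ≤ t * (2 ^ q * t + 2 * ε / t) := by
      have : t * (2 ^ q * t + 2 * ε / t) = 2 ^ q * t ^ 2 + 2 * ε := by field_simp
      rw [this]
      linarith
    exact le_of_mul_le_mul_left h6 ht0
  have hσ0 : 0 ≤ ∫ ω in B, σ ω ∂μ := setIntegral_nonneg hB fun ω _ => hσ.nonneg ω
  have hρ1 := hρ.setIntegral_le_one B
  have h2q : (0 : ℝ) < 2 ^ q := by positivity
  rcases le_or_gt 1 ε with h1 | h1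
  · have : 1 ≤ √ε := Real.one_le_sqrt.2 h1
    nlinarith
  rcases hε0.eq_or_lt with h0 | h0
  · rw [← h0, Real.sqrt_zero, mul_zero]
    refine le_of_forall_pos_le_add fun η hη => ?_
    set t := min 1 (η / 2 ^ q) with ht
    have ht0 : 0 < t := lt_min one_pos (by positivity)
    have := key t ht0 (min_le_left _ _)
    rw [← h0, mul_zero, zero_div, add_zero] at this
    refine this.trans ?_
    rw [zero_add]
    calc 2 ^ q * t ≤ 2 ^ q * (η / 2 ^ q) := by gcongr; exact min_le_right _ _
      _ = η := by field_simp
  · have hs : 0 < √ε := Real.sqrt_pos.2 h0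
    have := key (√ε) hs (Real.sqrt_le_one.2 h1.le)
    have h3 : 2 * ε / √ε = 2 * √ε := by
      rw [div_eq_iff hs.ne', mul_assoc, Real.mul_self_sqrt hε0]
    rw [h3] at this
    linarith

theorem integral_abs_sub_le_of_setIntegral {c : ℝ} (hρm : Measurable ρ) (hσm : Measurable σ)
    (hρ : Integrable ρ μ) (hσ : Integrable σ μ)
    (h1 : ∀ B, MeasurableSet B → ∫ ω in B, ρ ω ∂μ - ∫ ω in B, σ ω ∂μ ≤ c)
    (h2 : ∀ B, MeasurableSet B → ∫ ω in B, σ ω ∂μ - ∫ ω in B, ρ ω ∂μ ≤ c) :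
    ∫ ω, |ρ ω - σ ω| ∂μ ≤ 2 * c := by
  set B : Set Ω := {ω | σ ω ≤ ρ ω} with hB
  have hBm : MeasurableSet B := measurableSet_le hσm hρm
  have hi : Integrable (fun ω => |ρ ω - σ ω|) μ := (hρ.sub hσ).abs
  rw [← integral_add_compl hBm hi]
  have h3 : ∫ ω in B, |ρ ω - σ ω| ∂μ = ∫ ω in B, ρ ω ∂μ - ∫ ω in B, σ ω ∂μ := by
    rw [← integral_sub hρ.integrableOn hσ.integrableOn]
    exact setIntegral_congr_fun hBm fun ω hω => abs_of_nonneg (sub_nonneg.2 hω)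
  have h4 : ∫ ω in Bᶜ, |ρ ω - σ ω| ∂μ = ∫ ω in Bᶜ, σ ω ∂μ - ∫ ω in Bᶜ, ρ ω ∂μ := by
    rw [← integral_sub hσ.integrableOn hρ.integrableOn]
    refine setIntegral_congr_fun hBm.compl fun ω hω => ?_
    have : ρ ω < σ ω := not_le.1 hω
    rw [abs_of_nonpos (by linarith), neg_sub]
  rw [h3, h4]
  linarith [h1 B hBm, h2 _ hBm.compl]

theorem IsNormingDensity.integral_abs_sub_le (h : IsMeasureRep μ T q C)
    (hx : x ∈ boundedMeasurable Ω) (hy : y ∈ boundedMeasurable Ω)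
    (hx0 : ∃ a > 0, ∀ ω, a ≤ |x ω|) (hy0 : ∃ a > 0, ∀ ω, a ≤ |y ω|)
    (hρ : IsNormingDensity μ T q x ρ) (hσ : IsNormingDensity μ T q y σ) :
    ∫ ω, |ρ ω - σ ω| ∂μ ≤ 2 * ((2 ^ q + 2) * √(bmNorm T q (x - y))) := by
  refine integral_abs_sub_le_of_setIntegral hρ.measurable hσ.measurable hρ.integrable hσ.integrable
    (fun B hB => hρ.setIntegral_sub_le h hx hy hx0 hσ hB) fun B hB => ?_
  have := hσ.setIntegral_sub_le h hy hx hy0 hρ hB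
  rwa [h.bmNorm_congr_abs (Submodule.sub_mem _ hy hx) (Submodule.sub_mem _ hx hy)
    fun ω => abs_sub_comm _ _] at this

theorem sq_posPart_one_sub_le {r : ℝ} (hr : 0 < r) : max (1 - r) 0 ^ 2 ≤ r + r⁻¹ - 2 := by
  have h1 : r + r⁻¹ - 2 = (1 - r) ^ 2 * r⁻¹ := by field_simp; ring
  rw [h1]
  rcases le_total r 1 with h | h
  · rw [max_eq_left (by linarith)]
    exact le_mul_of_one_le_right (sq_nonneg _) ((one_le_inv₀ hr).2 h)
  · rw [max_eq_right (by linarith), zero_pow two_ne_zero]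
    exact mul_nonneg (sq_nonneg _) (inv_nonneg.2 hr.le)

/-- Let `m = min ρ σ`, `r = |y/x|` and `δ = ‖ρ - σ‖₁`. Pairing `ρ` with `r` and `σ` with `1/r` gives
`∫ m r ≤ N(y) = 1` and `∫ m / r ≤ N(x) = 1`, while `∫ m = 1 - δ/2`. Hence `∫ m (r + 1/r - 2) ≤ δ`,
which dominates `∫ m f²` for `f = (1 - r)⁺`. Cauchy–Schwarz gives `∫ ρ f ≤ δ + √δ`; as `0 ≤ f ≤ 1`,
also `N(x f)^q ≤ ∫ ρ f^q ≤ ∫ ρ f`. -/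
theorem IsNormingDensity.bmNorm_posPart_le (h : IsMeasureRep μ T q C)
    (hx : x ∈ boundedMeasurable Ω) (hy : y ∈ boundedMeasurable Ω)
    (hx0 : ∃ a > 0, ∀ ω, a ≤ |x ω|) (hy0 : ∃ a > 0, ∀ ω, a ≤ |y ω|)
    (hNx : bmNorm T q x = 1) (hNy : bmNorm T q y = 1)
    (hρ : IsNormingDensity μ T q x ρ) (hσ : IsNormingDensity μ T q y σ) :
    bmNorm T q (x * fun ω => max (1 - |y ω / x ω|) 0) ≤
      (∫ ω, |ρ ω - σ ω| ∂μ + √(∫ ω, |ρ ω - σ ω| ∂μ)) ^ (1 / q) := by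
  have hr := h.isConcaveRep
  have hq0 := hr.q_pos
  have hxne := ne_zero_of_bounded_below hx0
  have hyne := ne_zero_of_bounded_below hy0
  have hdiv := div_mem_boundedMeasurable hx hy hx0
  have hdiv' := div_mem_boundedMeasurable hy hx hy0
  set r : Ω → ℝ := fun ω => |y ω / x ω| with hr_def
  have hrA : r ∈ boundedMeasurable Ω := hr.comp_one hdiv (Φ := fun a => |a|) continuous_abs
  have hrpos : ∀ ω, 0 < r ω := fun ω => abs_pos.2 (div_ne_zero (hyne ω) (hxne ω))
  have hrinv : (fun ω => (r ω)⁻¹) = fun ω => |x ω / y ω| := by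
    ext ω; simp only [hr_def]; rw [← abs_inv, inv_div]
  have hriA : (fun ω => (r ω)⁻¹) ∈ boundedMeasurable Ω := by
    rw [hrinv]; exact hr.comp_one hdiv' (Φ := fun a => |a|) continuous_abs
  set f : Ω → ℝ := fun ω => max (1 - r ω) 0 with hf
  have hfA : f ∈ boundedMeasurable Ω :=
    hr.comp_one hrA (Φ := fun a => max (1 - a) 0) (by fun_prop)
  have hf0 : ∀ ω, 0 ≤ f ω := fun ω => le_max_right _ _
  have hf1 : ∀ ω, f ω ≤ 1 := fun ω => max_le (by linarith [hrpos ω]) zero_le_one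
  set m : Ω → ℝ := fun ω => min (ρ ω) (σ ω) with hm
  have hmi : Integrable m μ := hρ.integrable.inf hσ.integrable
  have hm0 : ∀ ω, 0 ≤ m ω := fun ω => le_min (hρ.nonneg ω) (hσ.nonneg ω)
  set δ := ∫ ω, |ρ ω - σ ω| ∂μ with hδ
  have hδi : Integrable (fun ω => |ρ ω - σ ω|) μ := (hρ.integrable.sub hσ.integrable).abs
  have hδ0 : 0 ≤ δ := integral_nonneg fun ω => abs_nonneg _
  have hmint : ∫ ω, m ω ∂μ = 1 - δ / 2 := by
    have h1 : m = fun ω => (1 / 2 : ℝ) * (ρ ω + σ ω - |ρ ω - σ ω|) := by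
      ext ω
      simp only [hm]
      rcases le_total (ρ ω) (σ ω) with hle | hle
      · rw [min_eq_left hle, abs_of_nonpos (by linarith)]; ring
      · rw [min_eq_right hle, abs_of_nonneg (by linarith)]; ring
    rw [h1, integral_const_mul, integral_sub (f := fun ω => ρ ω + σ ω)
      (hρ.integrable.add hσ.integrable) hδi, integral_add hρ.integrable hσ.integrable, hρ.integral_eq_one, hσ.integral_eq_one]
    ring
  have hint := fun {k w : Ω → ℝ} (hk : Integrable k μ) (hw : w ∈ boundedMeasurable Ω) =>
    integrable_mul_of_mem_boundedMeasurable hk hw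
  have h1 : ∫ ω, m ω * r ω ∂μ ≤ 1 := by
    refine (integral_mono (hint hmi hrA) (hint hρ.integrable hrA) fun ω =>
      mul_le_mul_of_nonneg_right (min_le_left _ _) (hrpos ω).le).trans ?_
    refine (hρ.le r hrA fun ω => (hrpos ω).le).trans (le_of_eq ?_)
    rw [← hNy]
    refine h.bmNorm_congr_abs (hr.mul_mem hx hrA) hy fun ω => ?_
    simp only [Pi.mul_apply, abs_mul, hr_def, abs_abs, abs_div]
    have := abs_ne_zero.2 (hxne ω)
    field_simp
  have h2 : ∫ ω, m ω * (r ω)⁻¹ ∂μ ≤ 1 := by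
    refine (integral_mono (hint hmi hriA) (hint hσ.integrable hriA) fun ω =>
      mul_le_mul_of_nonneg_right (min_le_right _ _) (inv_nonneg.2 (hrpos ω).le)).trans ?_
    refine (hσ.le _ hriA fun ω => inv_nonneg.2 (hrpos ω).le).trans (le_of_eq ?_)
    rw [← hNx]
    refine h.bmNorm_congr_abs (hr.mul_mem hy hriA) hx fun ω => ?_
    rw [hrinv]
    simp only [Pi.mul_apply, abs_mul, abs_abs, abs_div]
    have := abs_ne_zero.2 (hyne ω)
    field_simp
  have hf2A : (fun ω => f ω ^ 2) ∈ boundedMeasurable Ω :=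
    hr.comp_one hfA (Φ := fun a => a ^ 2) (by fun_prop)
  have h3 : ∫ ω, m ω * f ω ^ 2 ∂μ ≤ δ := by
    have h4 : ∫ ω, m ω * f ω ^ 2 ∂μ ≤ ∫ ω, (m ω * r ω + m ω * (r ω)⁻¹ - 2 * m ω) ∂μ := by
      refine integral_mono (hint hmi hf2A)
        (((hint hmi hrA).add (hint hmi hriA)).sub (hmi.const_mul 2)) fun ω => ?_
      have := mul_le_mul_of_nonneg_left (sq_posPart_one_sub_le (hrpos ω)) (hm0 ω)
      dsimp only [hf]
      linarith
    rw [integral_sub (f := fun ω => m ω * r ω + m ω * (r ω)⁻¹)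
      ((hint hmi hrA).add (hint hmi hriA)) (hmi.const_mul 2), integral_add (hint hmi hrA) (hint hmi hriA), integral_const_mul, hmint] at h4
    linarith
  set I := ∫ ω, m ω * f ω ∂μ with hI
  have hI0 : 0 ≤ I := integral_nonneg fun ω => mul_nonneg (hm0 ω) (hf0 ω)
  have h4 : I ≤ √δ := by
    refine Real.le_sqrt_of_sq_le ?_
    -- Cauchy–Schwarz in the form `0 ≤ ∫ m (f - I)²`, combined with `∫ m ≤ 1`.
    have h5 : 2 * I * I ≤ ∫ ω, m ω * f ω ^ 2 ∂μ + I ^ 2 * ∫ ω, m ω ∂μ := by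
      have h6 : 2 * I * I = ∫ ω, 2 * I * (m ω * f ω) ∂μ := by rw [integral_const_mul]
      rw [h6, ← integral_const_mul (I ^ 2), ← integral_add (hint hmi hf2A) (hmi.const_mul _)]
      refine integral_mono ((hint hmi hfA).const_mul _) ((hint hmi hf2A).add (hmi.const_mul _))
        fun ω => ?_
      have := mul_nonneg (hm0 ω) (sq_nonneg (f ω - I))
      dsimp only
      nlinarith
    have h6 : I ^ 2 * ∫ ω, m ω ∂μ ≤ I ^ 2 :=
      mul_le_of_le_one_right (sq_nonneg _) (by rw [hmint]; linarith)
    nlinarith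
  have h5 : ∫ ω, ρ ω * f ω ∂μ ≤ δ + I := by
    rw [hδ, hI, ← integral_add hδi (hint hmi hfA)]
    refine integral_mono (hint hρ.integrable hfA) (hδi.add (hint hmi hfA)) fun ω => ?_
    have h6 : ρ ω ≤ |ρ ω - σ ω| + m ω := by
      simp only [hm]
      rcases le_total (ρ ω) (σ ω) with hle | hle
      · rw [min_eq_left hle]; linarith [abs_nonneg (ρ ω - σ ω)]
      · rw [min_eq_right hle]; linarith [le_abs_self (ρ ω - σ ω)]
    have h7 := mul_le_mul_of_nonneg_right h6 (hf0 ω)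
    have h8 := mul_le_of_le_one_right (abs_nonneg (ρ ω - σ ω)) (hf1 ω)
    dsimp only
    linarith
  have h6 : ∫ ω, ρ ω * f ω ^ q ∂μ ≤ ∫ ω, ρ ω * f ω ∂μ := by
    refine integral_mono (hint hρ.integrable (hr.rpow_mem hfA hq0.le)) (hint hρ.integrable hfA)
      fun ω => mul_le_mul_of_nonneg_left ?_ (hρ.nonneg ω)
    calc f ω ^ q ≤ f ω ^ (1 : ℝ) :=
          Real.rpow_le_rpow_of_exponent_ge_of_imp (hf0 ω) (hf1 ω) hr.one_le_q (by simp [hq0.ne'])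
      _ = f ω := Real.rpow_one _
  rw [one_div, Real.le_rpow_inv_iff_of_pos (hr.concaveNorm_nonneg _) (by positivity) hq0]
  exact (hρ.ge f hfA hf0).trans (by linarith)

end Estimates

/-! ### Restoring signs and passing to `L₂`. -/

section SignedEstimates

open MeasureTheory

variable {Ω X : Type*} [MeasurableSpace Ω] {μ : Measure Ω} [NormedAddCommGroup X]
  [NormedSpace ℝ X] {T : (Ω → ℝ) →ₗ[ℝ] X} {q C : ℝ} {x y ρ σ : Ω → ℝ}

open Classical in
/-- `ρ` with the signs of `x`. -/
noncomputable def withSign (x ρ : Ω → ℝ) : Ω → ℝ := fun ω => if 0 < x ω then ρ ω else -ρ ω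

/-- The set where `x` and `y` have different signs. -/
def signDiff (x y : Ω → ℝ) : Set Ω := {ω | ¬(0 < x ω ↔ 0 < y ω)}

theorem measurable_withSign (hx : Measurable x) (hρ : Measurable ρ) :
    Measurable (withSign x ρ) := by
  classical
  exact Measurable.ite (measurableSet_lt measurable_const hx) hρ hρ.neg

theorem measurableSet_signDiff (hx : Measurable x) (hy : Measurable y) :
    MeasurableSet (signDiff x y) := by
  have h1 : MeasurableSet {ω | 0 < x ω} := measurableSet_lt measurable_const hx
  have h2 : MeasurableSet {ω | 0 < y ω} := measurableSet_lt measurable_const hy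
  exact (h1.iff h2).compl

theorem withSign_of_pos {ω : Ω} (h : 0 < x ω) : withSign x ρ ω = ρ ω := if_pos h

theorem withSign_of_not_pos {ω : Ω} (h : ¬0 < x ω) : withSign x ρ ω = -ρ ω := if_neg h

theorem abs_withSign (ω : Ω) : |withSign x ρ ω| = |ρ ω| := by
  by_cases h : 0 < x ω
  · rw [withSign_of_pos h]
  · rw [withSign_of_not_pos h, abs_neg]

theorem abs_withSign_sub_of_not_mem {ω : Ω} (h : ω ∉ signDiff x y) :
    |withSign x ρ ω - withSign y σ ω| = |ρ ω - σ ω| := by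
  have h' : 0 < x ω ↔ 0 < y ω := not_not.1 h
  by_cases hx : 0 < x ω
  · rw [withSign_of_pos hx, withSign_of_pos (h'.1 hx)]
  · rw [withSign_of_not_pos hx, withSign_of_not_pos (fun hy => hx (h'.2 hy)), ← abs_neg]
    congr 1; ring

theorem abs_withSign_sub_of_mem {ω : Ω} (h : ω ∈ signDiff x y) :
    |withSign x ρ ω - withSign y σ ω| = |ρ ω + σ ω| := by
  have h' : ¬(0 < x ω ↔ 0 < y ω) := h
  by_cases hx : 0 < x ω
  · have hy : ¬0 < y ω := fun hy => h' ⟨fun _ => hy, fun _ => hx⟩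
    rw [withSign_of_pos hx, withSign_of_not_pos hy, sub_neg_eq_add]
  · have hy : 0 < y ω := by
      by_contra hy
      exact h' ⟨fun h => absurd h hx, fun h => absurd h hy⟩
    rw [withSign_of_not_pos hx, withSign_of_pos hy, ← abs_neg]
    congr 1; ring

theorem integrable_withSign (hx : Measurable x) (hρm : Measurable ρ) (hρ : Integrable ρ μ) :
    Integrable (withSign x ρ) μ :=
  hρ.mono (measurable_withSign hx hρm).aestronglyMeasurable
    (Filter.Eventually.of_forall fun ω => (abs_withSign ω).le)

/-- On the set `B` where signs differ, `ρ + σ ≤ |ρ - σ| + 2ρ`. There also `|x| ≤ |x - y|`, so `∫_B ρ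
≤ N(x 1_B) ≤ N(x - y)`; this and `∫_B ρ ≤ 1` give the square root. -/
theorem IsNormingDensity.integral_abs_withSign_sub_le (h : IsMeasureRep μ T q C)
    (hx : x ∈ boundedMeasurable Ω) (hy : y ∈ boundedMeasurable Ω)
    (hx0 : ∃ a > 0, ∀ ω, a ≤ |x ω|) (hy0 : ∃ a > 0, ∀ ω, a ≤ |y ω|)
    (hρ : IsNormingDensity μ T q x ρ) (hσ : IsNormingDensity μ T q y σ) :
    ∫ ω, |withSign x ρ ω - withSign y σ ω| ∂μ ≤ (2 * 2 ^ q + 6) * √(bmNorm T q (x - y)) := by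
  have hr := h.isConcaveRep
  set B := signDiff x y with hBdef
  have hB : MeasurableSet B := measurableSet_signDiff hx.1 hy.1
  have hI := indicator_mem_boundedMeasurable hB 1
  have hδi : Integrable (fun ω => |ρ ω - σ ω|) μ := (hρ.integrable.sub hσ.integrable).abs
  have hBi := (integrable_mul_of_mem_boundedMeasurable hρ.integrable hI)
  have h1 : ∫ ω, |withSign x ρ ω - withSign y σ ω| ∂μ ≤
      ∫ ω, |ρ ω - σ ω| ∂μ + 2 * ∫ ω in B, ρ ω ∂μ := by
    rw [← integral_mul_indicator hB, ← integral_const_mul,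
      ← integral_add hδi (hBi.const_mul 2)]
    refine integral_mono ((integrable_withSign hx.1 hρ.measurable hρ.integrable).sub
      (integrable_withSign hy.1 hσ.measurable hσ.integrable)).abs
      (hδi.add (hBi.const_mul 2)) fun ω => ?_
    dsimp only
    by_cases hω : ω ∈ B
    · rw [abs_withSign_sub_of_mem hω, Set.indicator_of_mem hω,
        abs_of_nonneg (add_nonneg (hρ.nonneg ω) (hσ.nonneg ω))]
      linarith [neg_abs_le (ρ ω - σ ω)]
    · rw [abs_withSign_sub_of_not_mem hω, Set.indicator_of_notMem hω]
      linarith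
  set ε := bmNorm T q (x - y) with hε
  have hε0 : 0 ≤ ε := hr.concaveNorm_nonneg _
  have h2 : ∫ ω in B, ρ ω ∂μ ≤ ε := by
    rw [← integral_mul_indicator hB]
    refine (hρ.le _ hI fun ω => Set.indicator_nonneg (by simp) ω).trans ?_
    refine hr.concaveNorm_mono (Submodule.sub_mem _ hx hy) fun ω => ?_
    rw [Pi.mul_apply, Pi.sub_apply]
    by_cases hω : ω ∈ B
    · rw [Set.indicator_of_mem hω, mul_one]
      have h' : ¬(0 < x ω ↔ 0 < y ω) := hω
      by_cases hxp : 0 < x ω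
      · have hy' : y ω ≤ 0 := not_lt.1 fun hy' => h' ⟨fun _ => hy', fun _ => hxp⟩
        rw [abs_of_pos hxp, abs_of_nonneg (by linarith)]; linarith
      · have hy' : 0 < y ω := by
          by_contra hy'
          exact h' ⟨fun h => absurd h hxp, fun h => absurd h hy'⟩
        rw [abs_of_nonpos (not_lt.1 hxp), abs_of_nonpos (by linarith)]; linarith
    · rw [Set.indicator_of_notMem hω, mul_zero, abs_zero]
      exact abs_nonneg _
  have h3 : ∫ ω in B, ρ ω ∂μ ≤ √ε := by
    rcases le_total ε 1 with h4 | h4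
    · refine h2.trans (Real.le_sqrt_of_sq_le ?_)
      nlinarith
    · exact (hρ.setIntegral_le_one B).trans (Real.one_le_sqrt.2 h4)
  have h4 := hρ.integral_abs_sub_le h hx hy hx0 hy0 hσ
  rw [← hε] at h4
  linarith

/-- Pointwise `|x - y| ≤ (|x| - |y|)⁺ + (|y| - |x|)⁺ + 2 |y| 1_B`, with `B` the set where signs
differ. The first two terms fall under `bmNorm_posPart_le`; for the third, `N(y 1_B)^q ≤ ∫_B σ`, and
`σ ≤ ρ + σ`, the signed difference on `B`. The factor `4` is `1 + 1 + 2`. -/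
theorem IsNormingDensity.bmNorm_sub_le (h : IsMeasureRep μ T q C)
    (hx : x ∈ boundedMeasurable Ω) (hy : y ∈ boundedMeasurable Ω)
    (hx0 : ∃ a > 0, ∀ ω, a ≤ |x ω|) (hy0 : ∃ a > 0, ∀ ω, a ≤ |y ω|)
    (hNx : bmNorm T q x = 1) (hNy : bmNorm T q y = 1)
    (hρ : IsNormingDensity μ T q x ρ) (hσ : IsNormingDensity μ T q y σ) :
    bmNorm T q (x - y) ≤ 4 * (∫ ω, |withSign x ρ ω - withSign y σ ω| ∂μ +
      √(∫ ω, |withSign x ρ ω - withSign y σ ω| ∂μ)) ^ (1 / q) := by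
  have hr := h.isConcaveRep
  have hq0 := hr.q_pos
  set B := signDiff x y with hBdef
  have hB : MeasurableSet B := measurableSet_signDiff hx.1 hy.1
  have hI := indicator_mem_boundedMeasurable hB 1
  have hδi : Integrable (fun ω => |ρ ω - σ ω|) μ := (hρ.integrable.sub hσ.integrable).abs
  have hΔi : Integrable (fun ω => |withSign x ρ ω - withSign y σ ω|) μ :=
    ((integrable_withSign hx.1 hρ.measurable hρ.integrable).sub
      (integrable_withSign hy.1 hσ.measurable hσ.integrable)).abs
  have hpt : ∀ ω, |ρ ω - σ ω| ≤ |withSign x ρ ω - withSign y σ ω| := fun ω => by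
    by_cases hω : ω ∈ B
    · rw [abs_withSign_sub_of_mem hω,
        abs_of_nonneg (add_nonneg (hρ.nonneg ω) (hσ.nonneg ω)), abs_le]
      constructor <;> linarith [hρ.nonneg ω, hσ.nonneg ω]
    · rw [abs_withSign_sub_of_not_mem hω]
  set Δ := ∫ ω, |withSign x ρ ω - withSign y σ ω| ∂μ with hΔ
  have hδΔ : ∫ ω, |ρ ω - σ ω| ∂μ ≤ Δ := integral_mono hδi hΔi hpt
  have hδ0 : 0 ≤ ∫ ω, |ρ ω - σ ω| ∂μ := integral_nonneg fun ω => abs_nonneg _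
  have hΔ0 : 0 ≤ Δ := hδ0.trans hδΔ
  have hroot : (∫ ω, |ρ ω - σ ω| ∂μ + √(∫ ω, |ρ ω - σ ω| ∂μ)) ^ (1 / q) ≤
      (Δ + √Δ) ^ (1 / q) := by
    gcongr
  have h1 := hρ.bmNorm_posPart_le h hx hy hx0 hy0 hNx hNy hσ
  have h2 := hσ.bmNorm_posPart_le h hy hx hy0 hx0 hNy hNx hρ
  have hcomm : ∫ ω, |σ ω - ρ ω| ∂μ = ∫ ω, |ρ ω - σ ω| ∂μ :=
    integral_congr_ae (Filter.Eventually.of_forall fun ω => abs_sub_comm _ _)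
  rw [hcomm] at h2
  have h3 : bmNorm T q (y * B.indicator fun _ => 1) ≤ (Δ + √Δ) ^ (1 / q) := by
    rw [one_div, Real.le_rpow_inv_iff_of_pos (hr.concaveNorm_nonneg _) (by positivity) hq0]
    refine (hσ.ge _ hI fun ω => Set.indicator_nonneg (by simp) ω).trans ?_
    have h4 : (fun ω => σ ω * B.indicator (fun _ => (1 : ℝ)) ω ^ q) =
        fun ω => σ ω * B.indicator (fun _ => (1 : ℝ)) ω := by
      ext ω
      by_cases hω : ω ∈ B <;> simp [hω, hq0.ne']
    rw [h4]
    refine le_trans ?_ (le_add_of_nonneg_right (Real.sqrt_nonneg Δ))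
    refine integral_mono (integrable_mul_of_mem_boundedMeasurable hσ.integrable hI) hΔi
      fun ω => ?_
    dsimp only
    by_cases hω : ω ∈ B
    · rw [abs_withSign_sub_of_mem hω, Set.indicator_of_mem hω, mul_one]
      exact le_trans (by linarith [hρ.nonneg ω]) (le_abs_self _)
    · rw [Set.indicator_of_notMem hω, mul_zero]
      exact abs_nonneg _
  have hxne := ne_zero_of_bounded_below hx0
  have hyne := ne_zero_of_bounded_below hy0
  set f : Ω → ℝ := x * fun ω => max (1 - |y ω / x ω|) 0 with hf
  set g : Ω → ℝ := y * fun ω => max (1 - |x ω / y ω|) 0 with hg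
  set k : Ω → ℝ := y * B.indicator fun _ => 1 with hk
  have hfA : f ∈ boundedMeasurable Ω := hr.mul_mem hx
    (hr.comp_one (div_mem_boundedMeasurable hx hy hx0) (Φ := fun a => max (1 - |a|) 0)
      (by fun_prop))
  have hgA : g ∈ boundedMeasurable Ω := hr.mul_mem hy
    (hr.comp_one (div_mem_boundedMeasurable hy hx hy0) (Φ := fun a => max (1 - |a|) 0)
      (by fun_prop))
  have hkA : k ∈ boundedMeasurable Ω := hr.mul_mem hy hI
  have habsA : ∀ {u : Ω → ℝ}, u ∈ boundedMeasurable Ω →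
      (fun ω => |u ω|) ∈ boundedMeasurable Ω := fun hu =>
    hr.comp_one hu (Φ := fun a => |a|) continuous_abs
  have habsN : ∀ {u : Ω → ℝ}, u ∈ boundedMeasurable Ω →
      bmNorm T q (fun ω => |u ω|) = bmNorm T q u := fun hu =>
    h.bmNorm_congr_abs (habsA hu) hu fun ω => abs_abs _
  have hval : ∀ {a b : ℝ}, a ≠ 0 → |a * max (1 - |b / a|) 0| = max (|a| - |b|) 0 := by
    intro a b ha
    have ha' : 0 < |a| := abs_pos.2 ha
    rw [abs_mul, abs_of_nonneg (le_max_right (1 - |b / a|) 0), mul_max_of_nonneg _ _ ha'.le,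
      mul_zero, abs_div, mul_sub, mul_one, mul_div_cancel₀ _ ha'.ne']
  have hmax : ∀ a b : ℝ, max (a - b) 0 + max (b - a) 0 = |a - b| := by
    intro a b
    rcases le_total a b with hle | hle
    · rw [max_eq_right (by linarith), max_eq_left (by linarith), abs_of_nonpos (by linarith)]
      ring
    · rw [max_eq_left (by linarith), max_eq_right (by linarith), abs_of_nonneg (by linarith)]
      ring
  have h5 : bmNorm T q (x - y) ≤
      bmNorm T q (((fun ω => |f ω|) + fun ω => |g ω|) + (2 : ℝ) • fun ω => |k ω|) := by
    refine hr.concaveNorm_mono (Submodule.add_mem _ (Submodule.add_mem _ (habsA hfA) (habsA hgA))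
      (Submodule.smul_mem _ _ (habsA hkA))) fun ω => ?_
    refine le_trans ?_ (le_abs_self _)
    simp only [Pi.add_apply, Pi.smul_apply, Pi.sub_apply, smul_eq_mul, hf, hg, hk, Pi.mul_apply]
    rw [hval (hxne ω), hval (hyne ω)]
    have h6 := hmax |x ω| |y ω|
    rw [h6]
    by_cases hω : ω ∈ B
    · rw [Set.indicator_of_mem hω, mul_one]
      have h7 := abs_sub (x ω) (y ω)
      linarith [le_abs_self (|x ω| - |y ω|)]
    · rw [Set.indicator_of_notMem hω, mul_zero, abs_zero, mul_zero, add_zero]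
      have h' : 0 < x ω ↔ 0 < y ω := not_not.1 hω
      by_cases hxp : 0 < x ω
      · rw [abs_of_pos hxp, abs_of_pos (h'.1 hxp)]
      · have hyp : ¬0 < y ω := fun hy' => hxp (h'.2 hy')
        rw [abs_of_nonpos (not_lt.1 hxp), abs_of_nonpos (not_lt.1 hyp), abs_sub_comm]
        apply le_of_eq
        congr 1; ring
  have h6 := hr.concaveNorm_add_le (Submodule.add_mem _ (habsA hfA) (habsA hgA))
    (Submodule.smul_mem _ (2 : ℝ) (habsA hkA))
  have h7 := hr.concaveNorm_add_le (habsA hfA) (habsA hgA)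
  have hkN := habsN hkA
  have hfN := habsN hfA
  have hgN := habsN hgA
  rw [hr.concaveNorm_smul (habsA hkA), abs_of_pos (two_pos : (0 : ℝ) < 2)] at h6
  unfold bmNorm at h1 h2 h3 h5 hkN hfN hgN ⊢
  linarith

theorem IsNormingDensity.memLp_withSign_sqrt (hx : x ∈ boundedMeasurable Ω)
    (hρ : IsNormingDensity μ T q x ρ) : MemLp (withSign x fun ω => √(ρ ω)) 2 μ := by
  rw [memLp_two_iff_integrable_sq
    (measurable_withSign hx.1 hρ.measurable.sqrt).aestronglyMeasurable]
  refine hρ.integrable.congr (Filter.Eventually.of_forall fun ω => ?_)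
  dsimp only
  rw [← sq_abs, abs_withSign, sq_abs, Real.sq_sqrt (hρ.nonneg ω)]

theorem norm_toLp_two_sq {f : Ω → ℝ} (hf : MemLp f 2 μ) : ‖hf.toLp f‖ ^ 2 = ∫ ω, f ω ^ 2 ∂μ := by
  rw [← real_inner_self_eq_norm_sq, L2.inner_def]
  refine integral_congr_ae ?_
  filter_upwards [hf.coeFn_toLp] with ω hω
  rw [hω, real_inner_self_eq_norm_sq, Real.norm_eq_abs, sq_abs]

theorem IsNormingDensity.norm_toLp_eq_one (hx : x ∈ boundedMeasurable Ω)
    (hρ : IsNormingDensity μ T q x ρ) :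
    ‖(hρ.memLp_withSign_sqrt hx).toLp (withSign x fun ω => √(ρ ω))‖ = 1 := by
  rw [← sq_eq_sq₀ (norm_nonneg _) zero_le_one, norm_toLp_two_sq, one_pow, ← hρ.integral_eq_one]
  refine integral_congr_ae (Filter.Eventually.of_forall fun ω => ?_)
  dsimp only
  rw [← sq_abs, abs_withSign, sq_abs, Real.sq_sqrt (hρ.nonneg ω)]

/-- `(√a - √b)² ≤ |a - b|` for equal signs, `(√a + √b)² ≤ 2 (a + b)` for opposite ones. -/
theorem sq_withSign_sqrt_sub_le (hρ : ∀ ω, 0 ≤ ρ ω) (hσ : ∀ ω, 0 ≤ σ ω) (ω : Ω) :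
    (withSign x (fun ω => √(ρ ω)) ω - withSign y (fun ω => √(σ ω)) ω) ^ 2 ≤
      2 * |withSign x ρ ω - withSign y σ ω| := by
  rw [← sq_abs]
  have ha := Real.sqrt_nonneg (ρ ω)
  have hb := Real.sqrt_nonneg (σ ω)
  have ha2 := Real.sq_sqrt (hρ ω)
  have hb2 := Real.sq_sqrt (hσ ω)
  by_cases hω : ω ∈ signDiff x y
  · rw [abs_withSign_sub_of_mem hω, abs_withSign_sub_of_mem hω, sq_abs,
      abs_of_nonneg (add_nonneg (hρ ω) (hσ ω))]
    nlinarith [sq_nonneg (√(ρ ω) - √(σ ω))]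
  · rw [abs_withSign_sub_of_not_mem hω, abs_withSign_sub_of_not_mem hω, sq_abs]
    rcases le_total (√(ρ ω)) (√(σ ω)) with hle | hle
    · have := neg_le_abs (ρ ω - σ ω)
      nlinarith
    · have := le_abs_self (ρ ω - σ ω)
      nlinarith

/-- The signed difference of densities is at most the difference `d` of signed roots times `s = √ρ +
√σ`. Then `2τ d s ≤ d² + τ² s²` and `s² ≤ 2 (ρ + σ)`. The free parameter replaces Cauchy–Schwarz
after integration. -/
theorem abs_withSign_sub_le (hρ : ∀ ω, 0 ≤ ρ ω) (hσ : ∀ ω, 0 ≤ σ ω) (ω : Ω) {τ : ℝ}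
    (hτ : 0 ≤ τ) :
    2 * τ * |withSign x ρ ω - withSign y σ ω| ≤
      (withSign x (fun ω => √(ρ ω)) ω - withSign y (fun ω => √(σ ω)) ω) ^ 2 +
        2 * τ ^ 2 * (ρ ω + σ ω) := by
  rw [← sq_abs (withSign x (fun ω => √(ρ ω)) ω - _)]
  have ha := Real.sqrt_nonneg (ρ ω)
  have hb := Real.sqrt_nonneg (σ ω)
  have ha2 := Real.sq_sqrt (hρ ω)
  have hb2 := Real.sq_sqrt (hσ ω)
  have hsq : (√(ρ ω) + √(σ ω)) ^ 2 ≤ 2 * (ρ ω + σ ω) := by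
    nlinarith [sq_nonneg (√(ρ ω) - √(σ ω))]
  have key : ∀ d : ℝ, 2 * τ * (d * (√(ρ ω) + √(σ ω))) ≤ d ^ 2 + 2 * τ ^ 2 * (ρ ω + σ ω) := by
    intro d
    nlinarith [sq_nonneg (d - τ * (√(ρ ω) + √(σ ω))), mul_le_mul_of_nonneg_left hsq (sq_nonneg τ)]
  by_cases hω : ω ∈ signDiff x y
  · rw [abs_withSign_sub_of_mem hω, abs_withSign_sub_of_mem hω,
      abs_of_nonneg (add_nonneg (hρ ω) (hσ ω)), abs_of_nonneg (add_nonneg ha hb)]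
    refine le_trans ?_ (key _)
    refine mul_le_mul_of_nonneg_left ?_ (by positivity)
    nlinarith
  · rw [abs_withSign_sub_of_not_mem hω, abs_withSign_sub_of_not_mem hω]
    refine le_trans (le_of_eq ?_) (key _)
    have : ρ ω - σ ω = (√(ρ ω) - √(σ ω)) * (√(ρ ω) + √(σ ω)) := by nlinarith
    rw [this, abs_mul, abs_of_nonneg (add_nonneg ha hb)]

section

variable (hx : x ∈ boundedMeasurable Ω) (hy : y ∈ boundedMeasurable Ω)
  (hρ : IsNormingDensity μ T q x ρ) (hσ : IsNormingDensity μ T q y σ)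

theorem norm_toLp_withSign_sub_sq :
    ‖(hρ.memLp_withSign_sqrt hx).toLp _ - (hσ.memLp_withSign_sqrt hy).toLp _‖ ^ 2 =
      ∫ ω, (withSign x (fun ω => √(ρ ω)) ω - withSign y (fun ω => √(σ ω)) ω) ^ 2 ∂μ := by
  rw [← MemLp.toLp_sub, norm_toLp_two_sq]
  rfl

theorem norm_toLp_withSign_sub_sq_le :
    ‖(hρ.memLp_withSign_sqrt hx).toLp _ - (hσ.memLp_withSign_sqrt hy).toLp _‖ ^ 2 ≤
      2 * ∫ ω, |withSign x ρ ω - withSign y σ ω| ∂μ := by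
  rw [norm_toLp_withSign_sub_sq hx hy hρ hσ, ← integral_const_mul]
  exact integral_mono ((hρ.memLp_withSign_sqrt hx).sub (hσ.memLp_withSign_sqrt hy)).integrable_sq
    (((integrable_withSign hx.1 hρ.measurable hρ.integrable).sub
      (integrable_withSign hy.1 hσ.measurable hσ.integrable)).abs.const_mul 2)
    fun ω => sq_withSign_sqrt_sub_le hρ.nonneg hσ.nonneg ω

theorem integral_abs_withSign_sub_le_norm :
    ∫ ω, |withSign x ρ ω - withSign y σ ω| ∂μ ≤
      2 * ‖(hρ.memLp_withSign_sqrt hx).toLp _ - (hσ.memLp_withSign_sqrt hy).toLp _‖ := by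
  set D := ‖(hρ.memLp_withSign_sqrt hx).toLp _ - (hσ.memLp_withSign_sqrt hy).toLp _‖ with hD
  set Δ := ∫ ω, |withSign x ρ ω - withSign y σ ω| ∂μ with hΔ
  have hΔ0 : 0 ≤ Δ := integral_nonneg fun ω => abs_nonneg _
  have hD0 : 0 ≤ D := norm_nonneg _
  have hΔi : Integrable (fun ω => |withSign x ρ ω - withSign y σ ω|) μ :=
    ((integrable_withSign hx.1 hρ.measurable hρ.integrable).sub
      (integrable_withSign hy.1 hσ.measurable hσ.integrable)).abs
  have hsi : Integrable (fun ω =>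
      (withSign x (fun ω => √(ρ ω)) ω - withSign y (fun ω => √(σ ω)) ω) ^ 2) μ :=
    ((hρ.memLp_withSign_sqrt hx).sub (hσ.memLp_withSign_sqrt hy)).integrable_sq
  have hsum : Integrable (fun ω => ρ ω + σ ω) μ := hρ.integrable.add hσ.integrable
  -- Integration gives `2τΔ ≤ D² + 4τ²`; `τ = Δ / 4` is optimal and yields `Δ² ≤ 4 D²`.
  have key : 2 * (Δ / 4) * Δ ≤ D ^ 2 + 2 * (Δ / 4) ^ 2 * 2 := by
    have h2 : ∫ ω, (ρ ω + σ ω) ∂μ = 2 := by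
      rw [integral_add hρ.integrable hσ.integrable, hρ.integral_eq_one, hσ.integral_eq_one]
      norm_num
    have h3 : 2 * (Δ / 4) * Δ = ∫ ω, 2 * (Δ / 4) * |withSign x ρ ω - withSign y σ ω| ∂μ := by
      rw [integral_const_mul]
    have h4 : D ^ 2 + 2 * (Δ / 4) ^ 2 * 2 = ∫ ω,
        ((withSign x (fun ω => √(ρ ω)) ω - withSign y (fun ω => √(σ ω)) ω) ^ 2 +
          2 * (Δ / 4) ^ 2 * (ρ ω + σ ω)) ∂μ := by
      rw [integral_add hsi (hsum.const_mul _), integral_const_mul, h2, hD,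
        norm_toLp_withSign_sub_sq hx hy hρ hσ]
    rw [h3, h4]
    exact integral_mono (hΔi.const_mul _) (hsi.add (hsum.const_mul _)) fun ω =>
      abs_withSign_sub_le hρ.nonneg hσ.nonneg ω (by positivity)
  nlinarith

end

end SignedEstimates

/-! ### Dense range, by entropy maximisation. -/

section DenseRange

open MeasureTheory

variable {Ω X : Type*} [MeasurableSpace Ω] {μ : Measure Ω} [NormedAddCommGroup X]
  [NormedSpace ℝ X] {T : (Ω → ℝ) →ₗ[ℝ] X} {q C : ℝ} {x y ρ σ k : Ω → ℝ}

/-- The positive functions of norm one that are bounded away from zero. -/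
def positiveSphere (T : (Ω → ℝ) →ₗ[ℝ] X) (q : ℝ) : Set (Ω → ℝ) :=
  {x | x ∈ boundedMeasurable Ω ∧ (∃ a > 0, ∀ ω, a ≤ x ω) ∧ bmNorm T q x = 1}

theorem log_mem_boundedMeasurable (hx : x ∈ boundedMeasurable Ω) (hx0 : ∃ a > 0, ∀ ω, a ≤ x ω) :
    (fun ω => Real.log (x ω)) ∈ boundedMeasurable Ω := by
  obtain ⟨a, ha, hax⟩ := hx0
  obtain ⟨hm, b, hb⟩ := hx
  refine ⟨hm.log, max (|Real.log a|) |Real.log b|, fun ω => ?_⟩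
  have hpos := ha.trans_le (hax ω)
  refine abs_le_max_abs_abs (Real.log_le_log ha (hax ω)) (Real.log_le_log hpos ?_)
  exact (le_abs_self _).trans (hb ω)

theorem IsMeasureRep.norm_pos [IsProbabilityMeasure μ] (h : IsMeasureRep μ T q C)
    (hx : x ∈ boundedMeasurable Ω) (hx0 : ∃ a > 0, ∀ ω, a ≤ |x ω|) : 0 < ‖T x‖ := by
  obtain ⟨a, ha, hax⟩ := hx0
  have h1 : a ≤ ∫ ω, |x ω| ∂μ := by
    have : ∫ _ : Ω, a ∂μ = a := by simp
    rw [← this]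
    exact integral_mono (integrable_const a) (integrable_of_mem_boundedMeasurable hx).abs hax
  have h2 := h.integral_le x hx
  have hC : 0 < C := zero_lt_one.trans_le h.isConcaveRep.one_le_C
  by_contra hcon
  have : ‖T x‖ = 0 := le_antisymm (not_lt.1 hcon) (norm_nonneg _)
  rw [this, mul_zero] at h2
  linarith

theorem IsMeasureRep.inv_smul_mem_positiveSphere [IsProbabilityMeasure μ]
    (h : IsMeasureRep μ T q C) (hx : x ∈ boundedMeasurable Ω) (hx0 : ∃ a > 0, ∀ ω, a ≤ x ω) :
    0 < bmNorm T q x ∧ (bmNorm T q x)⁻¹ • x ∈ positiveSphere T q := by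
  have hN : 0 < bmNorm T q x := by
    refine (h.norm_pos hx ?_).trans_le (h.isConcaveRep.le_concaveNorm hx)
    obtain ⟨a, ha, hax⟩ := hx0
    exact ⟨a, ha, fun ω => (hax ω).trans (le_abs_self _)⟩
  refine ⟨hN, Submodule.smul_mem _ _ hx, ?_, ?_⟩
  · obtain ⟨a, ha, hax⟩ := hx0
    refine ⟨(bmNorm T q x)⁻¹ * a, by positivity, fun ω => ?_⟩
    exact mul_le_mul_of_nonneg_left (hax ω) (inv_nonneg.2 hN.le)
  · rw [bmNorm, h.isConcaveRep.concaveNorm_smul hx, abs_of_pos (inv_pos.2 hN)]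
    exact inv_mul_cancel₀ hN.ne'

/-- The entropy functional is bounded above on the positive sphere, because `log x ≤ x` and the
`L_1`-norm is at most `C` there. -/
theorem IsMeasureRep.integral_mul_log_le [IsProbabilityMeasure μ] (h : IsMeasureRep μ T q C)
    {b : ℝ} (hk : k ∈ boundedMeasurable Ω) (hk0 : ∀ ω, 0 ≤ k ω) (hkb : ∀ ω, k ω ≤ b)
    (hb : 0 ≤ b) (hx : x ∈ positiveSphere T q) : ∫ ω, k ω * Real.log (x ω) ∂μ ≤ b * C := by
  obtain ⟨hxA, hx0, hN⟩ := hx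
  have hki := integrable_of_mem_boundedMeasurable (μ := μ) hk
  have hxi := integrable_of_mem_boundedMeasurable (μ := μ) hxA
  have h1 : ∫ ω, k ω * Real.log (x ω) ∂μ ≤ ∫ ω, b * |x ω| ∂μ := by
    refine integral_mono (integrable_mul_of_mem_boundedMeasurable hki
      (log_mem_boundedMeasurable hxA hx0)) (hxi.abs.const_mul b) fun ω => ?_
    obtain ⟨a, ha, hax⟩ := hx0
    have hpos := ha.trans_le (hax ω)
    have h2 : Real.log (x ω) ≤ |x ω| := by
      linarith [Real.log_le_sub_one_of_pos hpos, le_abs_self (x ω)]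
    exact (mul_le_mul_of_nonneg_left h2 (hk0 ω)).trans
      (mul_le_mul_of_nonneg_right (hkb ω) (abs_nonneg _))
  rw [integral_const_mul] at h1
  refine h1.trans (mul_le_mul_of_nonneg_left ((h.integral_le x hxA).trans ?_) hb)
  have := h.isConcaveRep.le_concaveNorm hxA
  have h3 : ‖T x‖ ≤ 1 := this.trans hN.le
  exact mul_le_of_le_one_right (zero_le_one.trans h.isConcaveRep.one_le_C) h3

/-- An approximate maximiser of the entropy functional `x ↦ ∫ k log x` on the positive sphere has
a norming density close to `k`. -/
theorem IsMeasureRep.exists_density_approx [IsProbabilityMeasure μ] (h : IsMeasureRep μ T q C)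
    (hk : k ∈ boundedMeasurable Ω) (hk0 : ∀ ω, 0 ≤ k ω) (hk1 : ∫ ω, k ω ∂μ = 1) {η : ℝ}
    (hη : 0 < η) :
    ∃ x ∈ positiveSphere T q, ∀ ρ, IsNormingDensity μ T q x ρ → ∫ ω, |k ω - ρ ω| ∂μ ≤ η := by
  have hr := h.isConcaveRep
  have hki := integrable_of_mem_boundedMeasurable (μ := μ) hk
  obtain ⟨b, hb⟩ := hk.2
  set E : (Ω → ℝ) → ℝ := fun x => ∫ ω, k ω * Real.log (x ω) ∂μ with hE
  have hne : (positiveSphere T q).Nonempty :=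
    ⟨_, (h.inv_smul_mem_positiveSphere (hr.const_mem 1) ⟨1, one_pos, fun _ => le_rfl⟩).2⟩
  have hbdd : BddAbove (E '' positiveSphere T q) := by
    refine ⟨|b| * C, ?_⟩
    rintro _ ⟨x, hx, rfl⟩
    exact h.integral_mul_log_le hk hk0
      (fun ω => (le_abs_self _).trans ((hb ω).trans (le_abs_self b))) (abs_nonneg b) hx
  have hP : (0 : ℝ) < 2 ^ q + 2 := by positivity
  set t : ℝ := min 1 (η / (2 * (2 ^ q + 2))) with ht
  have ht0 : 0 < t := lt_min one_pos (by positivity)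
  have ht1 : t ≤ 1 := min_le_left _ _
  have htη : 2 * ((2 ^ q + 2) * t) ≤ η := by
    have : t ≤ η / (2 * (2 ^ q + 2)) := min_le_right _ _
    rw [le_div_iff₀ (by positivity)] at this
    linarith
  -- A defect of `t²` is of second order against perturbations of size `t`, so no exact maximiser is
  -- needed.
  obtain ⟨_, ⟨x, hx, rfl⟩, hxs⟩ := exists_lt_of_lt_csSup (hne.image E)
    (show sSup (E '' positiveSphere T q) - t ^ 2 < _ by linarith [sq_pos_of_pos ht0])
  have hmax : ∀ z ∈ positiveSphere T q, E z ≤ E x + t ^ 2 := fun z hz => by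
    have := le_csSup hbdd ⟨z, hz, rfl⟩
    linarith
  refine ⟨x, hx, fun ρ hρ => ?_⟩
  obtain ⟨hxA, ⟨a, ha, hax⟩, hxN⟩ := hx
  have key : ∀ B, MeasurableSet B →
      ∫ ω in B, k ω ∂μ - ∫ ω in B, ρ ω ∂μ ≤ (2 ^ q + 2) * t := by
    intro B hB
    have hI := indicator_mem_boundedMeasurable hB (1 : ℝ)
    have hI0 : ∀ ω, 0 ≤ B.indicator (fun _ => (1 : ℝ)) ω := fun ω =>
      Set.indicator_nonneg (by simp) ω
    -- Compare `x` with the normalisation of `x w`: the entropy changes by `log(1 + t) ∫_B k - log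
    -- N`. Here `log(1 + t) ≥ t - t²` and `log N ≤ N - 1 ≤ t ∫_B ρ + 2^q t²`. Together with the
    -- defect `t²` the error is `(2^q + 2) t²`.
    set w : Ω → ℝ := fun ω => 1 + t * B.indicator (fun _ => 1) ω with hw
    have hw1 : ∀ ω, 1 ≤ w ω := fun ω => by
      have := mul_nonneg ht0.le (hI0 ω)
      simp only [hw]; linarith
    have hwA : w ∈ boundedMeasurable Ω :=
      Submodule.add_mem _ (hr.const_mem 1) (Submodule.smul_mem _ t hI)
    have hyA : x * w ∈ boundedMeasurable Ω := hr.mul_mem hxA hwA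
    have hxpos : ∀ ω, 0 < x ω := fun ω => ha.trans_le (hax ω)
    have hy0 : ∃ a > 0, ∀ ω, a ≤ (x * w) ω := ⟨a, ha, fun ω =>
      (hax ω).trans (le_mul_of_one_le_right (hxpos ω).le (hw1 ω))⟩
    obtain ⟨hN0, hmem⟩ := h.inv_smul_mem_positiveSphere hyA hy0
    set N := bmNorm T q (x * w) with hNdef
    have hlog : ∀ ω, Real.log ((N⁻¹ • (x * w)) ω) =
        Real.log (x ω) + Real.log (1 + t) * B.indicator (fun _ => 1) ω - Real.log N := by
      intro ω
      have hwlog : Real.log (w ω) = Real.log (1 + t) * B.indicator (fun _ => 1) ω := by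
        by_cases hω : ω ∈ B <;> simp [hw, hω]
      have hwpos : 0 < w ω := one_pos.trans_le (hw1 ω)
      rw [Pi.smul_apply, Pi.mul_apply, smul_eq_mul, Real.log_mul (inv_pos.2 hN0).ne'
        (mul_pos (hxpos ω) hwpos).ne', Real.log_mul (hxpos ω).ne' hwpos.ne', hwlog, Real.log_inv]
      ring
    have hEz : E (N⁻¹ • (x * w)) =
        E x + Real.log (1 + t) * ∫ ω in B, k ω ∂μ - Real.log N := by
      have i1 := integrable_mul_of_mem_boundedMeasurable hki
        (log_mem_boundedMeasurable hxA ⟨a, ha, hax⟩)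
      have i2 := (integrable_mul_of_mem_boundedMeasurable hki hI).const_mul (Real.log (1 + t))
      have i3 := hki.const_mul (Real.log N)
      have i12 : Integrable (fun ω => k ω * Real.log (x ω) +
          Real.log (1 + t) * (k ω * B.indicator (fun _ => 1) ω)) μ := i1.add i2
      have : E (N⁻¹ • (x * w)) = ∫ ω, (k ω * Real.log (x ω) +
          Real.log (1 + t) * (k ω * B.indicator (fun _ => 1) ω) - Real.log N * k ω) ∂μ := by
        refine integral_congr_ae (Filter.Eventually.of_forall fun ω => ?_)
        dsimp only
        rw [hlog ω]; ring
      rw [this, integral_sub i12 i3, integral_add i1 i2, integral_const_mul,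
        integral_const_mul, hk1, integral_mul_indicator hB, mul_one]
    have h1 := hmax _ hmem
    rw [hEz] at h1
    have h2 : N ≤ 1 + t * ∫ ω in B, ρ ω ∂μ + 2 ^ q * t ^ 2 :=
      hρ.bmNorm_perturb_le h hB ht0.le ht1
    have h3 := Real.log_le_sub_one_of_pos hN0
    have h4 : t - t ^ 2 ≤ Real.log (1 + t) := by
      have h5 := Real.one_sub_inv_le_log_of_pos (show (0 : ℝ) < 1 + t by linarith)
      refine le_trans ?_ h5
      rw [le_sub_iff_add_le, ← le_sub_iff_add_le', inv_le_iff_one_le_mul₀ (by linarith)]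
      nlinarith [mul_pos ht0 (sq_pos_of_pos ht0)]
    have hkB0 : 0 ≤ ∫ ω in B, k ω ∂μ := integral_nonneg hk0
    have hkB1 : ∫ ω in B, k ω ∂μ ≤ 1 := hk1 ▸
      setIntegral_le_integral hki (Filter.Eventually.of_forall hk0)
    have h6 := mul_le_mul_of_nonneg_right h4 hkB0
    have h7 : t * (∫ ω in B, k ω ∂μ - ∫ ω in B, ρ ω ∂μ) ≤ t * ((2 ^ q + 2) * t) := by
      nlinarith [mul_le_mul_of_nonneg_left hkB1 (sq_nonneg t)]
    exact le_of_mul_le_mul_left h7 ht0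
  refine (integral_abs_sub_le_of_setIntegral hk.1 hρ.measurable hki hρ.integrable key
    fun B hB => ?_).trans htη
  -- Both densities have mass one, so the reverse inequality on `B` is the same inequality on the
  -- complement.
  have h1 := key Bᶜ hB.compl
  have h2 := integral_add_compl hB hki
  have h3 := integral_add_compl hB hρ.integrable
  rw [hk1] at h2
  rw [hρ.integral_eq_one] at h3
  linarith

theorem withSign_mem_boundedMeasurable (hx : Measurable x) (hρ : ρ ∈ boundedMeasurable Ω) :
    withSign x ρ ∈ boundedMeasurable Ω := by
  obtain ⟨hm, b, hb⟩ := hρ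
  exact ⟨measurable_withSign hx hm, b, fun ω => (abs_withSign ω).trans_le (hb ω)⟩

theorem IsNormingDensity.congr_abs (h : IsMeasureRep μ T q C) (hx : x ∈ boundedMeasurable Ω)
    (hy : y ∈ boundedMeasurable Ω) (hxy : ∀ ω, |x ω| = |y ω|) (hρ : IsNormingDensity μ T q x ρ) :
    IsNormingDensity μ T q y ρ := by
  have key : ∀ w ∈ boundedMeasurable Ω, bmNorm T q (x * w) = bmNorm T q (y * w) := fun w hw =>
    h.bmNorm_congr_abs (h.isConcaveRep.mul_mem hx hw) (h.isConcaveRep.mul_mem hy hw) fun ω => by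
      rw [Pi.mul_apply, Pi.mul_apply, abs_mul, abs_mul, hxy]
  exact ⟨hρ.measurable, hρ.nonneg, hρ.integrable, hρ.integral_eq_one,
    fun w hw hw0 => key w hw ▸ hρ.le w hw hw0, fun w hw hw0 => key w hw ▸ hρ.ge w hw hw0⟩

theorem exists_boundedMeasurable_norm_toLp_sub_lt [IsProbabilityMeasure μ] (g : Lp ℝ 2 μ) {ε : ℝ}
    (hε : 0 < ε) : ∃ (f : Ω → ℝ) (hf : f ∈ boundedMeasurable Ω),
      ‖(memLp_of_mem_boundedMeasurable hf 2).toLp f - g‖ < ε := by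
  obtain ⟨s, hs, hsm⟩ := (Lp.memLp g).exists_simpleFunc_eLpNorm_sub_lt (by simp)
    (ε := ENNReal.ofReal ε) (by simpa using hε)
  have hsA : (s : Ω → ℝ) ∈ boundedMeasurable Ω := by
    obtain ⟨b, hb⟩ := s.exists_forall_norm_le
    exact ⟨s.measurable, b, hb⟩
  refine ⟨s, hsA, ?_⟩
  rw [← dist_eq_norm, dist_comm, Lp.dist_def]
  rw [← ENNReal.toReal_ofReal hε.le]
  refine (ENNReal.toReal_lt_toReal ?_ ENNReal.ofReal_ne_top).2 ?_
  all_goals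
    have hcongr : eLpNorm (⇑g - ⇑((memLp_of_mem_boundedMeasurable (μ := μ) hsA 2).toLp s)) 2 μ =
        eLpNorm (⇑g - ⇑s) 2 μ :=
      eLpNorm_congr_ae (Filter.EventuallyEq.rfl.sub (MemLp.coeFn_toLp _))
    rw [hcongr]
  · exact ((Lp.memLp g).sub hsm).2.ne
  · exact hs

/-- Approximate `g` by a bounded function `f` of norm one, find a positive `x` whose density is
close to `f²`, and give `x` the signs of `f`. -/
theorem IsMeasureRep.exists_norm_toLp_withSign_sub_le [IsProbabilityMeasure μ]
    (h : IsMeasureRep μ T q C) {g : Lp ℝ 2 μ} (hg : ‖g‖ = 1) {ε : ℝ} (hε : 0 < ε) :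
    ∃ (x : Ω → ℝ) (hx : x ∈ boundedMeasurable Ω), (∃ a > 0, ∀ ω, a ≤ |x ω|) ∧
      bmNorm T q x = 1 ∧ ∀ (ρ : Ω → ℝ) (hρ : IsNormingDensity μ T q x ρ),
        ‖(hρ.memLp_withSign_sqrt hx).toLp _ - g‖ ≤ ε := by
  have hr := h.isConcaveRep
  -- Approximating `g` and normalising each cost at most `ε / 4`; the bound `1 / 2` keeps the
  -- approximant nonzero.
  set δ := min (ε / 4) (1 / 2) with hδ
  have hδ0 : 0 < δ := lt_min (by positivity) (by norm_num)
  obtain ⟨f₀, hf₀, hf₀g⟩ := exists_boundedMeasurable_norm_toLp_sub_lt g hδ0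
  set F := (memLp_of_mem_boundedMeasurable (μ := μ) hf₀ 2).toLp f₀ with hF
  have hr1 : |‖F‖ - 1| < δ := by
    rw [← hg]; exact (abs_norm_sub_norm_le F g).trans_lt hf₀g
  have hF0 : 0 < ‖F‖ := by
    have := (abs_lt.1 hr1).1
    have h2 : δ ≤ 1 / 2 := min_le_right _ _
    linarith
  set f : Ω → ℝ := ‖F‖⁻¹ • f₀ with hfdef
  have hf : f ∈ boundedMeasurable Ω := Submodule.smul_mem _ _ hf₀
  have hfm := memLp_of_mem_boundedMeasurable (μ := μ) hf 2
  have hfF : hfm.toLp f = ‖F‖⁻¹ • F := rfl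
  have hf1 : ‖hfm.toLp f‖ = 1 := by
    rw [hfF, norm_smul, norm_inv, norm_norm, inv_mul_cancel₀ hF0.ne']
  have hfg : ‖hfm.toLp f - g‖ ≤ ε / 2 := by
    have h1 : ‖hfm.toLp f - F‖ ≤ δ := by
      have h2 : hfm.toLp f - F = (‖F‖⁻¹ - 1) • F := by rw [hfF, sub_smul, one_smul]
      rw [h2, norm_smul, Real.norm_eq_abs]
      nth_rewrite 2 [← abs_of_pos hF0]
      rw [← abs_mul, sub_mul, inv_mul_cancel₀ hF0.ne', one_mul, abs_sub_comm]
      exact hr1.le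
    have h2 := norm_sub_le_norm_sub_add_norm_sub (hfm.toLp f) F g
    have h3 : δ ≤ ε / 4 := min_le_left _ _
    linarith
  set k : Ω → ℝ := fun ω => f ω ^ 2 with hk
  have hkA : k ∈ boundedMeasurable Ω := hr.comp_one hf (Φ := fun a => a ^ 2) (by fun_prop)
  have hk0 : ∀ ω, 0 ≤ k ω := fun ω => sq_nonneg _
  have hk1 : ∫ ω, k ω ∂μ = 1 := by
    rw [hk, ← norm_toLp_two_sq hfm, hf1, one_pow]
  obtain ⟨x, ⟨hxA, ⟨a, ha, hax⟩, hxN⟩, hxρ⟩ :=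
    -- The squared `L₂`-distance is at most twice the `L_1`-distance of the densities, hence `2 η =
    -- (ε / 2)²`.
    h.exists_density_approx hkA hk0 hk1 (η := ε ^ 2 / 8) (by positivity)
  have hxs : withSign f x ∈ boundedMeasurable Ω := withSign_mem_boundedMeasurable hf.1 hxA
  have hxpos : ∀ ω, 0 < x ω := fun ω => ha.trans_le (hax ω)
  refine ⟨withSign f x, hxs, ⟨a, ha, fun ω => ?_⟩, ?_, fun ρ hρ => ?_⟩
  · rw [abs_withSign, abs_of_pos (hxpos ω)]; exact hax ω
  · rw [← hxN]; exact h.bmNorm_congr_abs hxs hxA abs_withSign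
  have hρ' := hxρ ρ (hρ.congr_abs h hxs hxA abs_withSign)
  have hsgn : ∀ ω, ω ∉ signDiff (withSign f x) f := by
    intro ω
    refine not_not.2 ?_
    by_cases hfω : 0 < f ω
    · rw [withSign_of_pos hfω]; exact iff_of_true (hxpos ω) hfω
    · rw [withSign_of_not_pos hfω]
      exact iff_of_false (by linarith [hxpos ω]) hfω
  have hfk : withSign f (fun ω => √(k ω)) = f := by
    ext ω
    by_cases hfω : 0 < f ω
    · rw [withSign_of_pos hfω, hk]; exact Real.sqrt_sq hfω.le
    · rw [withSign_of_not_pos hfω, hk]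
      simp only
      rw [Real.sqrt_sq_eq_abs, abs_of_nonpos (not_lt.1 hfω), neg_neg]
  have hnorm : ‖(hρ.memLp_withSign_sqrt hxs).toLp _ - hfm.toLp f‖ ^ 2 ≤ (ε / 2) ^ 2 := by
    rw [← MemLp.toLp_sub, norm_toLp_two_sq]
    have h1 : ∫ ω, (withSign (withSign f x) (fun ω => √(ρ ω)) - f) ω ^ 2 ∂μ ≤
        ∫ ω, 2 * |k ω - ρ ω| ∂μ := by
      refine integral_mono ((hρ.memLp_withSign_sqrt hxs).sub hfm).integrable_sq
        (((integrable_of_mem_boundedMeasurable hkA).sub hρ.integrable).abs.const_mul 2)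
        fun ω => ?_
      have h2 := sq_withSign_sqrt_sub_le (x := withSign f x) (y := f) hρ.nonneg hk0 ω
      rw [hfk, abs_withSign_sub_of_not_mem (hsgn ω), abs_sub_comm] at h2
      exact h2
    rw [integral_const_mul] at h1
    nlinarith
  have hnorm' := (sq_le_sq₀ (norm_nonneg _) (by positivity)).1 hnorm
  have := norm_sub_le_norm_sub_add_norm_sub ((hρ.memLp_withSign_sqrt hxs).toLp _)
    (hfm.toLp f) g
  linarith

end DenseRange

/-! ### Extension of maps between spheres, recognition of `ℓ₂`, and moduli. -/

section Spheres

open Metric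

theorem exists_modulus_lt {φ : ℝ≥0 → ℝ≥0} (hφ : Continuous φ) (hφ0 : φ 0 = 0) {ε : ℝ}
    (hε : 0 < ε) : ∃ δ > (0 : ℝ), ∀ t : ℝ≥0, (t : ℝ) < δ → (φ t : ℝ) < ε := by
  have h := (Metric.continuous_iff.1 hφ) 0 ε hε
  obtain ⟨δ, hδ, hφδ⟩ := h
  refine ⟨δ, hδ, fun t ht => ?_⟩
  have := hφδ t (by simpa [NNReal.dist_eq] using ht)
  simpa [NNReal.dist_eq, hφ0] using this

/-- Two maps with dense range into complete spaces that control each other extend to a uniform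
homeomorphism of the spaces, with the same moduli of continuity. -/
theorem exists_uniformEquiv_of_denseRange {D A B : Type*} [MetricSpace A] [CompleteSpace A]
    [MetricSpace B] [CompleteSpace B] {i : D → A} {j : D → B} (hi : DenseRange i)
    (hj : DenseRange j) {φ ψ : ℝ≥0 → ℝ≥0} (hφ : Continuous φ) (hφ0 : φ 0 = 0)
    (hψ : Continuous ψ) (hψ0 : ψ 0 = 0)
    (hij : ∀ x y, nndist (j x) (j y) ≤ φ (nndist (i x) (i y)))
    (hji : ∀ x y, nndist (i x) (i y) ≤ ψ (nndist (j x) (j y))) :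
    ∃ F : A ≃ᵤ B, IsModulusOfContinuity φ F ∧ IsModulusOfContinuity ψ F.symm := by
  -- With the metric pulled back along `i`, the two controls make `j` uniformly inducing as well. So
  -- `A` and `B` are completions of one uniform space, and the moduli extend by density.
  let _ : PseudoMetricSpace D := PseudoMetricSpace.induced i inferInstance
  have hjU : IsUniformInducing j := by
    refine Metric.isUniformInducing_iff.2 ⟨Metric.uniformContinuous_iff.2 fun ε hε => ?_,
      fun ε hε => ?_⟩
    · obtain ⟨δ, hδ, h⟩ := exists_modulus_lt hφ hφ0 hε
      exact ⟨δ, hδ, fun x y hxy => lt_of_le_of_lt (NNReal.coe_le_coe.2 (hij x y)) (h _ hxy)⟩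
    · obtain ⟨δ, hδ, h⟩ := exists_modulus_lt hψ hψ0 hε
      exact ⟨δ, hδ, fun hxy => lt_of_le_of_lt (NNReal.coe_le_coe.2 (hji _ _)) (h _ hxy)⟩
  let P : AbstractCompletion D := ⟨A, i, inferInstance, inferInstance, inferInstance, ⟨rfl⟩, hi⟩
  let Q : AbstractCompletion D := ⟨B, j, inferInstance, inferInstance, inferInstance, hjU, hj⟩
  let F : A ≃ᵤ B := P.compareEquiv Q
  have hF : ∀ x, F (i x) = j x := fun x => P.compare_coe Q x
  have hF' : ∀ x, F.symm (j x) = i x := fun x => Q.compare_coe P x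
  refine ⟨F, ⟨hφ, hφ0, fun a₁ a₂ => ?_⟩, ⟨hψ, hψ0, fun a₁ a₂ => ?_⟩⟩
  · refine hi.induction_on₂ (p := fun a₁ a₂ => nndist (F a₁) (F a₂) ≤ φ (nndist a₁ a₂))
      (isClosed_le ?_ ?_) (fun x y => ?_) a₁ a₂
    · exact (F.continuous.comp continuous_fst).nndist (F.continuous.comp continuous_snd)
    · exact hφ.comp (continuous_fst.nndist continuous_snd)
    · rw [hF, hF]; exact hij x y
  · refine hj.induction_on₂
      (p := fun a₁ a₂ => nndist (F.symm a₁) (F.symm a₂) ≤ ψ (nndist a₁ a₂))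
      (isClosed_le ?_ ?_) (fun x y => ?_) a₁ a₂
    · exact (F.symm.continuous.comp continuous_fst).nndist (F.symm.continuous.comp continuous_snd)
    · exact hψ.comp (continuous_fst.nndist continuous_snd)
    · rw [hF', hF']; exact hji x y

/-- The space is a continuous image of `ℝ × sphere`. Separability of `L₂(μ)` is deduced in this way
from that of `X`, through the sphere homeomorphism. -/
theorem separableSpace_of_sphere {E : Type*} [NormedAddCommGroup E] [NormedSpace ℝ E]
    [Nontrivial E] [TopologicalSpace.SeparableSpace (sphere (0 : E) 1)] :
    TopologicalSpace.SeparableSpace E := by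
  have hc : Continuous fun p : ℝ × sphere (0 : E) 1 => p.1 • (p.2 : E) := by fun_prop
  refine Function.Surjective.denseRange (f := fun p : ℝ × sphere (0 : E) 1 => p.1 • (p.2 : E))
    (fun x => ?_) |>.separableSpace hc
  rcases eq_or_ne x 0 with rfl | hx
  · obtain ⟨y, hy⟩ := NormedSpace.sphere_nonempty (E := E) (x := 0) (r := 1) |>.2 zero_le_one
    exact ⟨(0, ⟨y, hy⟩), zero_smul _ _⟩
  · have hx' : ‖x‖ ≠ 0 := norm_ne_zero_iff.2 hx
    refine ⟨(‖x‖, ⟨‖x‖⁻¹ • x, ?_⟩), ?_⟩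
    · rw [mem_sphere_zero_iff_norm, norm_smul, norm_inv, norm_norm, inv_mul_cancel₀ hx']
    · simp only [smul_smul, mul_inv_cancel₀ hx', one_smul]

/-- A compact sphere makes the closed ball compact, as the image of `[0, 1] × sphere`. Thus infinite
dimension is visible topologically on the sphere and passes along homeomorphisms. -/
theorem finiteDimensional_of_compactSpace_sphere {E : Type*} [NormedAddCommGroup E]
    [NormedSpace ℝ E] [CompactSpace (sphere (0 : E) 1)] : FiniteDimensional ℝ E := by
  rcases subsingleton_or_nontrivial E with hE | hE
  · infer_instance
  have hc : Continuous fun p : ℝ × E => p.1 • p.2 := by fun_prop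
  have hK : IsCompact ((fun p : ℝ × E => p.1 • p.2) '' (Set.Icc (0 : ℝ) 1 ×ˢ sphere (0 : E) 1)) :=
    (isCompact_Icc.prod (isCompact_iff_compactSpace.2 inferInstance)).image hc
  refine FiniteDimensional.of_isCompact_closedBall₀ ℝ zero_lt_one
    (hK.of_isClosed_subset isClosed_closedBall fun x hx => ?_)
  rw [mem_closedBall_zero_iff] at hx
  rcases eq_or_ne x 0 with rfl | hx0
  · obtain ⟨y, hy⟩ := NormedSpace.sphere_nonempty (E := E) (x := 0) (r := 1) |>.2 zero_le_one
    exact ⟨(0, y), ⟨by simp, hy⟩, zero_smul _ _⟩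
  · have hx' : ‖x‖ ≠ 0 := norm_ne_zero_iff.2 hx0
    refine ⟨(‖x‖, ‖x‖⁻¹ • x), ⟨⟨norm_nonneg _, hx⟩, ?_⟩, ?_⟩
    · rw [mem_sphere_zero_iff_norm, norm_smul, norm_inv, norm_norm, inv_mul_cancel₀ hx']
    · simp only [smul_smul, mul_inv_cancel₀ hx', one_smul]

/-- Distinct orthonormal vectors are at distance `√2 ≥ 1`, so balls of radius `1/2` about a Hilbert
basis are disjoint and separability makes the basis countable. -/
theorem nonempty_linearIsometryEquiv_l2 (H : Type*) [NormedAddCommGroup H]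
    [InnerProductSpace ℝ H] [CompleteSpace H] [TopologicalSpace.SeparableSpace H]
    (hH : ¬FiniteDimensional ℝ H) : Nonempty (H ≃ₗᵢ[ℝ] lp (fun _ : ℕ => ℝ) 2) := by
  obtain ⟨w, b, hb⟩ := exists_hilbertBasis ℝ H
  have hbo := b.orthonormal
  have hdist : ∀ u v : w, u ≠ v → (1 : ℝ) ≤ dist (b u) (b v) := by
    intro u v huv
    have h1 : ‖b u - b v‖ ^ 2 = 2 := by
      rw [@norm_sub_sq_real, hbo.1, hbo.1, hbo.2 huv]; norm_num
    rw [dist_eq_norm]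
    nlinarith [norm_nonneg (b u - b v)]
  have hcount : Countable w := by
    refine Pairwise.countable_of_isOpen_disjoint (s := fun u : w => ball (b u) (1 / 2)) ?_
      (fun u => isOpen_ball) fun u => ⟨b u, mem_ball_self (by norm_num)⟩
    intro u v huv
    exact ball_disjoint_ball (by linarith [hdist u v huv])
  have hinf : Infinite w := by
    by_contra hfin
    rw [not_infinite_iff_finite] at hfin
    have := Fintype.ofFinite w
    exact hH b.toOrthonormalBasis.toBasis.finiteDimensional_of_finite
  obtain ⟨e⟩ := nonempty_equiv_of_countable (α := ℕ) (β := w)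
  have hsp : ⊤ ≤ (Submodule.span ℝ (Set.range (b ∘ e))).topologicalClosure := by
    rw [e.surjective.range_comp, b.dense_span]
  exact ⟨(HilbertBasis.mk (hbo.comp e e.injective) hsp).repr⟩

/-- A linear isometry restricts to the unit spheres. -/
def LinearIsometryEquiv.sphereIsometryEquiv {E F : Type*} [NormedAddCommGroup E]
    [NormedSpace ℝ E] [NormedAddCommGroup F] [NormedSpace ℝ F] (e : E ≃ₗᵢ[ℝ] F) :
    sphere (0 : E) 1 ≃ᵢ sphere (0 : F) 1 where
  toFun x := ⟨e x, by simp⟩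
  invFun y := ⟨e.symm y, by simp⟩
  left_inv x := by simp
  right_inv y := by simp
  isometry_toFun := Isometry.of_dist_eq fun x y => e.dist_map x y

theorem IsModulusOfContinuity.isometry_comp {A B B' : Type*} [PseudoMetricSpace A]
    [PseudoMetricSpace B] [PseudoMetricSpace B'] {φ : ℝ≥0 → ℝ≥0} {F : A → B} {G : B → B'}
    (hF : IsModulusOfContinuity φ F) (hG : Isometry G) : IsModulusOfContinuity φ (G ∘ F) :=
  ⟨hF.1, hF.2.1, fun x y => (hG.nndist_eq _ _).trans_le (hF.2.2 x y)⟩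

theorem IsModulusOfContinuity.comp_isometry {A A' B : Type*} [PseudoMetricSpace A]
    [PseudoMetricSpace A'] [PseudoMetricSpace B] {φ : ℝ≥0 → ℝ≥0} {F : A → B} {G : A' → A}
    (hF : IsModulusOfContinuity φ F) (hG : Isometry G) : IsModulusOfContinuity φ (F ∘ G) :=
  ⟨hF.1, hF.2.1, fun x y => (hF.2.2 _ _).trans_eq (by rw [hG.nndist_eq])⟩

theorem IsModulusOfContinuity.comp {A B B' : Type*} [PseudoMetricSpace A]
    [PseudoMetricSpace B] [PseudoMetricSpace B'] {φ ψ : ℝ≥0 → ℝ≥0} {F : A → B} {G : B → B'}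
    (hG : IsModulusOfContinuity ψ G) (hF : IsModulusOfContinuity φ F) (hψ : Monotone ψ) :
    IsModulusOfContinuity (ψ ∘ φ) (G ∘ F) :=
  ⟨hG.1.comp hF.1, by simp [hF.2.1, hG.2.1],
    fun x y => (hG.2.2 _ _).trans (hψ (hF.2.2 x y))⟩

theorem IsModulusOfContinuity.mono {A B : Type*} [PseudoMetricSpace A] [PseudoMetricSpace B]
    {φ ψ : ℝ≥0 → ℝ≥0} {F : A → B} (hF : IsModulusOfContinuity φ F) (hψ : Continuous ψ)
    (hψ0 : ψ 0 = 0) (hle : φ ≤ ψ) : IsModulusOfContinuity ψ F :=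
  ⟨hψ, hψ0, fun x y => (hF.2.2 x y).trans (hle _)⟩

/-- Normalising costs at most `|‖u‖ - ‖v‖| ≤ ‖v - u‖` on top of `‖v - u‖`, all scaled by `‖u‖⁻¹`.
The vector `v` may be zero. -/
theorem norm_normalize_sub_le {E : Type*} [NormedAddCommGroup E] [NormedSpace ℝ E] {u : E}
    (v : E) (hu : u ≠ 0) : ‖‖v‖⁻¹ • v - ‖u‖⁻¹ • u‖ ≤ 2 * ‖u‖⁻¹ * ‖v - u‖ := by
  have hu' : 0 < ‖u‖ := norm_pos_iff.2 hu
  have hv : ‖v‖ • ‖v‖⁻¹ • v = v := by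
    rcases eq_or_ne v 0 with rfl | hv
    · simp
    · rw [smul_smul, mul_inv_cancel₀ (norm_ne_zero_iff.2 hv), one_smul]
  have h1 : ‖v‖⁻¹ • v - ‖u‖⁻¹ • u =
      ‖u‖⁻¹ • ((‖u‖ - ‖v‖) • ‖v‖⁻¹ • v + (v - u)) := by
    rw [sub_smul, hv, sub_add_sub_cancel, smul_sub, smul_smul ‖u‖⁻¹, inv_mul_cancel₀ hu'.ne',
      one_smul]
  have h2 : ‖‖v‖⁻¹ • v‖ ≤ 1 := by
    rw [norm_smul, norm_inv, norm_norm]; exact inv_mul_le_one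
  have h3 : ‖(‖u‖ - ‖v‖) • ‖v‖⁻¹ • v‖ ≤ ‖v - u‖ := by
    rw [norm_smul, Real.norm_eq_abs]
    refine (mul_le_of_le_one_right (abs_nonneg _) h2).trans ?_
    rw [← norm_sub_rev u v]; exact abs_norm_sub_norm_le u v
  rw [h1, norm_smul, norm_inv, norm_norm, mul_comm 2, mul_assoc]
  refine mul_le_mul_of_nonneg_left ?_ (inv_nonneg.2 hu'.le)
  linarith [norm_add_le ((‖u‖ - ‖v‖) • ‖v‖⁻¹ • v) (v - u)]

end Spheres

/-! ### The sphere of `X` and the sphere of `ℓ₂`. -/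

section Assembly

open MeasureTheory Metric

/-- The functions of norm one that are bounded away from zero. -/
def signedSphere {Ω X : Type*} [MeasurableSpace Ω] [NormedAddCommGroup X] [NormedSpace ℝ X]
    (T : (Ω → ℝ) →ₗ[ℝ] X) (q : ℝ) : Set (Ω → ℝ) :=
  {x | x ∈ boundedMeasurable Ω ∧ (∃ a > 0, ∀ ω, a ≤ |x ω|) ∧ bmNorm T q x = 1}

/-- A common modulus of continuity for the sphere map and its inverse. -/
noncomputable def sphereModulus (q : ℝ) (C t : ℝ≥0) : ℝ≥0 :=
  Real.toNNReal (√(2 * ((2 * 2 ^ q + 6) * √(2 * C * t)))) +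
    Real.toNNReal (8 * C * (2 * t + √(2 * t)) ^ (1 / q))

theorem continuous_sphereModulus {q : ℝ} (hq : 0 < q) (C : ℝ≥0) :
    Continuous (sphereModulus q C) := by
  have h1 : Continuous fun t : ℝ≥0 => (2 * (t : ℝ) + √(2 * t)) ^ (1 / q) :=
    Continuous.rpow_const (by fun_prop) fun _ => Or.inr (by positivity)
  unfold sphereModulus
  fun_prop

theorem sphereModulus_zero {q : ℝ} (hq : 0 < q) (C : ℝ≥0) : sphereModulus q C 0 = 0 := by
  have : (0 : ℝ) ^ (1 / q) = 0 := Real.zero_rpow (by positivity)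
  simp [sphereModulus, hq.ne']

theorem monotone_sphereModulus {q : ℝ} (hq : 0 < q) (C : ℝ≥0) : Monotone (sphereModulus q C) := by
  intro s t hst
  have hst' : (s : ℝ) ≤ t := hst
  have h1 : 0 ≤ 1 / q := by positivity
  unfold sphereModulus
  gcongr

variable {Ω X : Type*} [MeasurableSpace Ω] {μ : Measure Ω} [NormedAddCommGroup X]
  [NormedSpace ℝ X] {T : (Ω → ℝ) →ₗ[ℝ] X} {q C : ℝ} {x y : Ω → ℝ}

/-- This and the next lemma compare the unit sphere of `N` with that of `X` under radial projection.
Here `1 = N(y) ≤ C ‖T y‖` bounds the Lipschitz constant of the projection. -/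
theorem IsMeasureRep.norm_normalize_sub_le_bmNorm (h : IsMeasureRep μ T q C)
    (hx : x ∈ signedSphere T q) (hy : y ∈ signedSphere T q) :
    ‖‖T x‖⁻¹ • T x - ‖T y‖⁻¹ • T y‖ ≤ 2 * C * bmNorm T q (x - y) := by
  have hr := h.isConcaveRep
  have hC0 : 0 < C := zero_lt_one.trans_le hr.one_le_C
  have h1 : 1 ≤ C * ‖T y‖ := hy.2.2 ▸ hr.concaveNorm_le hy.1
  have hTy : 0 < ‖T y‖ := by
    by_contra hcon
    have : C * ‖T y‖ ≤ 0 := mul_nonpos_of_nonneg_of_nonpos hC0.le (not_lt.1 hcon)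
    linarith
  have h2 : ‖T y‖⁻¹ ≤ C := by
    rw [inv_le_iff_one_le_mul₀ hTy]; exact h1
  have h3 : ‖T x - T y‖ ≤ bmNorm T q (x - y) := by
    rw [← map_sub]; exact hr.le_concaveNorm (Submodule.sub_mem _ hx.1 hy.1)
  refine (norm_normalize_sub_le (T x) (norm_pos_iff.1 hTy)).trans ?_
  gcongr

/-- Let `a = ‖T x‖`, `b = ‖T y‖`, `u = x/a`, `v = y/b`, and write `x - y = a (u - v) + (a - b) v`.
Since `N(u) = 1/a` and `N(v) = 1/b`, the triangle inequality bounds `|1/a - 1/b|` by `N(u - v)`, so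
each term has norm at most `a N(u - v)`, where `a ≤ 1`. -/
theorem IsMeasureRep.bmNorm_sub_le_norm_normalize (h : IsMeasureRep μ T q C)
    (hx : x ∈ signedSphere T q) (hy : y ∈ signedSphere T q) :
    bmNorm T q (x - y) ≤ 2 * C * ‖‖T x‖⁻¹ • T x - ‖T y‖⁻¹ • T y‖ := by
  have hr := h.isConcaveRep
  have hC0 : 0 < C := zero_lt_one.trans_le hr.one_le_C
  have hpos : ∀ z ∈ signedSphere T q, 0 < ‖T z‖ ∧ ‖T z‖ ≤ 1 := by
    intro z hz
    have h1 : 1 ≤ C * ‖T z‖ := hz.2.2 ▸ hr.concaveNorm_le hz.1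
    refine ⟨?_, hz.2.2 ▸ hr.le_concaveNorm hz.1⟩
    by_contra hcon
    have : C * ‖T z‖ ≤ 0 := mul_nonpos_of_nonneg_of_nonpos hC0.le (not_lt.1 hcon)
    linarith
  obtain ⟨ha0, ha1⟩ := hpos x hx
  obtain ⟨hb0, -⟩ := hpos y hy
  set a := ‖T x‖ with ha
  set b := ‖T y‖ with hb
  set u : Ω → ℝ := a⁻¹ • x with hu
  set v : Ω → ℝ := b⁻¹ • y with hv
  have huA : u ∈ boundedMeasurable Ω := Submodule.smul_mem _ _ hx.1
  have hvA : v ∈ boundedMeasurable Ω := Submodule.smul_mem _ _ hy.1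
  have hNu : bmNorm T q u = a⁻¹ := by
    have := hr.concaveNorm_smul hx.1 a⁻¹
    rw [show concaveNorm _ T q x = 1 from hx.2.2, abs_of_pos (inv_pos.2 ha0), mul_one] at this
    exact this
  have hNv : bmNorm T q v = b⁻¹ := by
    have := hr.concaveNorm_smul hy.1 b⁻¹
    rw [show concaveNorm _ T q y = 1 from hy.2.2, abs_of_pos (inv_pos.2 hb0), mul_one] at this
    exact this
  set d := bmNorm T q (u - v) with hd
  have hsymm : bmNorm T q (v - u) = d :=
    h.bmNorm_congr_abs (Submodule.sub_mem _ hvA huA) (Submodule.sub_mem _ huA hvA)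
      fun ω => abs_sub_comm _ _
  have hdle : d ≤ C * ‖a⁻¹ • T x - b⁻¹ • T y‖ := by
    have := hr.concaveNorm_le (Submodule.sub_mem _ huA hvA)
    rwa [map_sub, hu, hv, map_smul, map_smul] at this
  have h1 : a⁻¹ ≤ b⁻¹ + d := by
    have := hr.concaveNorm_add_le hvA (Submodule.sub_mem _ huA hvA)
    rw [add_sub_cancel] at this
    rw [← hNu, ← hNv]; exact this
  have h2 : b⁻¹ ≤ a⁻¹ + d := by
    have := hr.concaveNorm_add_le huA (Submodule.sub_mem _ hvA huA)
    rw [add_sub_cancel] at this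
    rw [← hNu, ← hNv, ← hsymm]; exact this
  have h3 : x - y = a • (u - v) + (a - b) • v := by
    rw [hu, hv, smul_sub, sub_smul, smul_inv_smul₀ ha0.ne', smul_inv_smul₀ hb0.ne']
    abel
  have h4 : bmNorm T q (x - y) ≤ a * d + |a - b| * b⁻¹ := by
    rw [h3, ← hNv, hd]
    refine (hr.concaveNorm_add_le (Submodule.smul_mem _ _ (Submodule.sub_mem _ huA hvA))
      (Submodule.smul_mem _ _ hvA)).trans (le_of_eq ?_)
    rw [hr.concaveNorm_smul (Submodule.sub_mem _ huA hvA), hr.concaveNorm_smul hvA,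
      abs_of_pos ha0]
  have h5 : |a - b| * b⁻¹ ≤ a * d := by
    have h6 : |a - b| * b⁻¹ = a * |b⁻¹ - a⁻¹| := by
      nth_rewrite 2 [← abs_of_pos ha0]
      rw [← abs_of_pos (inv_pos.2 hb0), ← abs_mul, ← abs_mul, abs_of_pos (inv_pos.2 hb0)]
      congr 1
      field_simp
    rw [h6]
    refine mul_le_mul_of_nonneg_left (abs_le.2 ⟨?_, ?_⟩) ha0.le <;> linarith
  have hd0 : 0 ≤ d := hr.concaveNorm_nonneg _
  have h7 : a * d ≤ d := mul_le_of_le_one_left hd0 ha1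
  linarith

theorem IsMeasureRep.inv_smul_mem_signedSphere [IsProbabilityMeasure μ]
    (h : IsMeasureRep μ T q C) (hx : x ∈ boundedMeasurable Ω) (hx0 : ∃ a > 0, ∀ ω, a ≤ |x ω|) :
    0 < bmNorm T q x ∧ (bmNorm T q x)⁻¹ • x ∈ signedSphere T q := by
  have hN : 0 < bmNorm T q x := (h.norm_pos hx hx0).trans_le (h.isConcaveRep.le_concaveNorm hx)
  refine ⟨hN, Submodule.smul_mem _ _ hx, ?_, ?_⟩
  · obtain ⟨a, ha, hax⟩ := hx0
    refine ⟨(bmNorm T q x)⁻¹ * a, by positivity, fun ω => ?_⟩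
    rw [Pi.smul_apply, smul_eq_mul, abs_mul, abs_of_pos (inv_pos.2 hN)]
    exact mul_le_mul_of_nonneg_left (hax ω) (inv_nonneg.2 hN.le)
  · rw [bmNorm, h.isConcaveRep.concaveNorm_smul hx, abs_of_pos (inv_pos.2 hN)]
    exact inv_mul_cancel₀ hN.ne'

/-- Approximate `u` by some `T f`, then raise `|f|` to at least a small `a` keeping signs. This
moves `f` by at most `a` pointwise, hence `T f` by at most `a ‖T 1‖`. Normalisation doubles the
total error. -/
theorem IsMeasureRep.exists_signedSphere_norm_sub_lt [IsProbabilityMeasure μ]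
    (h : IsMeasureRep μ T q C) {u : X} (hu : ‖u‖ = 1) {ε : ℝ} (hε : 0 < ε) :
    ∃ x ∈ signedSphere T q, ‖‖T x‖⁻¹ • T x - u‖ < ε := by
  have hr := h.isConcaveRep
  obtain ⟨_, hfu, f, hf, rfl⟩ := Metric.dense_iff.1 h.dense u (ε / 4) (by positivity)
  rw [mem_ball, dist_eq_norm] at hfu
  set c := ‖T fun _ => 1‖ with hc
  have hc0 : 0 ≤ c := norm_nonneg _
  set a := ε / (4 * (c + 1)) with ha
  have ha0 : 0 < a := by positivity
  have hac : a * c ≤ ε / 4 := by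
    have : a * (c + 1) = ε / 4 := by rw [ha]; field_simp
    linarith
  set g : Ω → ℝ := withSign f fun ω => max |f ω| a with hg
  have hgA : g ∈ boundedMeasurable Ω := withSign_mem_boundedMeasurable hf.1
    (hr.comp_one hf (Φ := fun s => max |s| a) (by fun_prop))
  have hg0 : ∃ a > 0, ∀ ω, a ≤ |g ω| := ⟨a, ha0, fun ω => by
    rw [hg, abs_withSign]; exact (le_max_right _ _).trans (le_abs_self _)⟩
  have hgf : ‖T g - T f‖ ≤ ε / 4 := by
    rw [← map_sub]
    have h1 : ‖T (g - f)‖ ≤ ‖T (a • fun _ => 1)‖ := by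
      refine hr.mono _ (Submodule.sub_mem _ hgA hf) _
        (Submodule.smul_mem _ _ (hr.const_mem 1)) fun ω => ?_
      simp only [Pi.sub_apply, Pi.smul_apply, smul_eq_mul, mul_one, abs_of_pos ha0]
      by_cases hω : 0 < f ω
      · rw [hg, withSign_of_pos hω, abs_of_pos hω, abs_le]
        constructor
        · linarith [le_max_left (f ω) a]
        · linarith [max_le_add_of_nonneg hω.le ha0.le]
      · rw [hg, withSign_of_not_pos hω, abs_of_nonpos (not_lt.1 hω), abs_le]
        constructor
        · linarith [max_le_add_of_nonneg (neg_nonneg.2 (not_lt.1 hω)) ha0.le]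
        · linarith [le_max_left (-f ω) a]
    rw [map_smul, norm_smul, Real.norm_eq_abs, abs_of_pos ha0] at h1
    exact h1.trans hac
  obtain ⟨hN, hmem⟩ := h.inv_smul_mem_signedSphere hgA hg0
  refine ⟨_, hmem, ?_⟩
  have hnorm : ‖T ((bmNorm T q g)⁻¹ • g)‖⁻¹ • T ((bmNorm T q g)⁻¹ • g) = ‖T g‖⁻¹ • T g := by
    rw [map_smul, norm_smul, norm_inv, Real.norm_eq_abs, abs_of_pos hN, smul_smul]
    congr 1
    field_simp
  rw [hnorm]
  have hu0 : u ≠ 0 := by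
    rintro rfl
    simp at hu
  have h1 := norm_normalize_sub_le (T g) hu0
  rw [hu, inv_one, one_smul, mul_one] at h1
  have h2 := norm_sub_le_norm_sub_add_norm_sub (T g) (T f) u
  linarith

/-- Functions of `N`-norm one bounded away from zero index dense subsets of both spheres: by radial
projection in `X`, by signed roots of norming densities in `L₂`. A density is chosen for each
function; uniqueness is not needed, as the estimates hold for every choice. -/
theorem IsMeasureRep.exists_uniformEquiv_sphere_Lp [IsProbabilityMeasure μ] [CompleteSpace X]
    {C : ℝ≥0} (h : IsMeasureRep μ T q C) :
    ∃ F : sphere (0 : X) 1 ≃ᵤ sphere (0 : Lp ℝ 2 μ) 1,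
      IsModulusOfContinuity (sphereModulus q C) F ∧
        IsModulusOfContinuity (sphereModulus q C) F.symm := by
  have hr := h.isConcaveRep
  have hq0 := hr.q_pos
  have hd : ∀ x : signedSphere T q, ∃ ρ, IsNormingDensity μ T q x.1 ρ := fun x =>
    h.exists_isNormingDensity x.2.1 x.2.2.2
  choose ρ hρ using hd
  have hne : ∀ x : signedSphere T q, ‖T x.1‖ ≠ 0 := fun x => (h.norm_pos x.2.1 x.2.2.1).ne'
  let i : signedSphere T q → sphere (0 : X) 1 := fun x => ⟨‖T x.1‖⁻¹ • T x.1, by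
    rw [mem_sphere_zero_iff_norm, norm_smul, norm_inv, norm_norm, inv_mul_cancel₀ (hne x)]⟩
  let j : signedSphere T q → sphere (0 : Lp ℝ 2 μ) 1 := fun x =>
    ⟨((hρ x).memLp_withSign_sqrt x.2.1).toLp _,
      mem_sphere_zero_iff_norm.2 ((hρ x).norm_toLp_eq_one x.2.1)⟩
  have hi : DenseRange i := by
    refine Metric.denseRange_iff.2 fun u ε hε => ?_
    obtain ⟨x, hx, hxu⟩ := h.exists_signedSphere_norm_sub_lt (mem_sphere_zero_iff_norm.1 u.2) hε
    refine ⟨⟨x, hx⟩, ?_⟩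
    rw [dist_comm, Subtype.dist_eq, dist_eq_norm]
    exact hxu
  have hj : DenseRange j := by
    refine Metric.denseRange_iff.2 fun g ε hε => ?_
    obtain ⟨x, hx, hx0, hxN, hxg⟩ := h.exists_norm_toLp_withSign_sub_le
      (mem_sphere_zero_iff_norm.1 g.2) (half_pos hε)
    refine ⟨⟨x, hx, hx0, hxN⟩, ?_⟩
    rw [dist_comm, Subtype.dist_eq, dist_eq_norm]
    exact (hxg _ (hρ ⟨x, hx, hx0, hxN⟩)).trans_lt (half_lt_self hε)
  have hcX : CompleteSpace (sphere (0 : X) 1) := isClosed_sphere.completeSpace_coe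
  have hcL : CompleteSpace (sphere (0 : Lp ℝ 2 μ) 1) := isClosed_sphere.completeSpace_coe
  refine exists_uniformEquiv_of_denseRange hi hj (continuous_sphereModulus hq0 C)
    (sphereModulus_zero hq0 C) (continuous_sphereModulus hq0 C) (sphereModulus_zero hq0 C)
    (fun x y => ?_) fun x y => ?_
  · have h1 := norm_toLp_withSign_sub_sq_le x.2.1 y.2.1 (hρ x) (hρ y)
    have h2 := (hρ x).integral_abs_withSign_sub_le h x.2.1 y.2.1 x.2.2.1 y.2.2.1 (hρ y)
    have h3 := h.bmNorm_sub_le_norm_normalize x.2 y.2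
    -- The inner square root comes from continuity of the density in `L_1`, the outer one from
    -- passing to `L₂`.
    have h4 : dist (j x) (j y) ≤ √(2 * ((2 * 2 ^ q + 6) * √(2 * C * dist (i x) (i y)))) := by
      refine Real.le_sqrt_of_sq_le ?_
      rw [Subtype.dist_eq, dist_eq_norm]
      refine h1.trans ?_
      refine mul_le_mul_of_nonneg_left (h2.trans ?_) two_pos.le
      refine mul_le_mul_of_nonneg_left (Real.sqrt_le_sqrt ?_) (by positivity)
      rw [Subtype.dist_eq, dist_eq_norm]
      exact h3
    refine le_trans ?_ (le_add_of_nonneg_right zero_le)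
    rw [← NNReal.coe_le_coe, Real.coe_toNNReal _ (Real.sqrt_nonneg _)]
    exact h4
  · have h1 := integral_abs_withSign_sub_le_norm x.2.1 y.2.1 (hρ x) (hρ y)
    have h2 := (hρ x).bmNorm_sub_le h x.2.1 y.2.1 x.2.2.1 y.2.2.1 x.2.2.2 y.2.2.2 (hρ y)
    have h3 := h.norm_normalize_sub_le_bmNorm x.2 y.2
    set Δ := ∫ ω, |withSign x.1 (ρ x) ω - withSign y.1 (ρ y) ω| ∂μ with hΔ
    have hΔ0 : 0 ≤ Δ := integral_nonneg fun ω => abs_nonneg _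
    have h1' : Δ ≤ 2 * dist (j x) (j y) := by
      rw [Subtype.dist_eq, dist_eq_norm]; exact h1
    have h4 : dist (i x) (i y) ≤
        8 * C * (2 * dist (j x) (j y) + √(2 * dist (j x) (j y))) ^ (1 / q) := by
      rw [Subtype.dist_eq (i x), dist_eq_norm]
      refine h3.trans ?_
      have h5 : (Δ + √Δ) ^ (1 / q) ≤
          (2 * dist (j x) (j y) + √(2 * dist (j x) (j y))) ^ (1 / q) := by
        gcongr
      have h6 : bmNorm T q (x.1 - y.1) ≤
          4 * (2 * dist (j x) (j y) + √(2 * dist (j x) (j y))) ^ (1 / q) := by linarith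
      have h7 := mul_le_mul_of_nonneg_left h6 (show (0 : ℝ) ≤ 2 * C by positivity)
      linarith
    refine le_trans ?_ (le_add_of_nonneg_left zero_le)
    rw [← NNReal.coe_le_coe, Real.coe_toNNReal _ (by positivity)]
    exact h4

/-- A finite-dimensional `L₂(μ)` would have compact sphere, and then so would `X`; separability also
comes from `X`. So `L₂(μ)` is isometric to `ℓ₂`. -/
theorem exists_uniformEquiv_sphere_l2 (X : Type*) [NormedAddCommGroup X] [NormedSpace ℝ X]
    [CompleteSpace X] [Lattice X] [IsOrderedAddMonoid X] [HasSolidNorm X] [IsOrderedModule ℝ X]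
    [TopologicalSpace.SeparableSpace X] (hX : ¬FiniteDimensional ℝ X) {q : ℝ} (hq : 1 ≤ q)
    {C : ℝ≥0} (hC1 : 1 ≤ C) (hC : IsConcaveWith q X C) :
    ∃ F : sphere (0 : X) 1 ≃ᵤ sphere (0 : lp (fun _ : ℕ => ℝ) 2) 1,
      IsModulusOfContinuity (sphereModulus q C) F ∧
        IsModulusOfContinuity (sphereModulus q C) F.symm := by
  have hnt : Nontrivial X := by
    by_contra hnt
    rw [not_nontrivial_iff_subsingleton] at hnt
    exact hX inferInstance
  obtain ⟨Ω, _, μ, _, T, h⟩ := exists_isMeasureRep X hq hC1 hC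
  obtain ⟨F, hF, hF'⟩ := h.exists_uniformEquiv_sphere_Lp
  have hfin : ¬FiniteDimensional ℝ (Lp ℝ 2 μ) := by
    intro hfin
    have := FiniteDimensional.proper ℝ (Lp ℝ 2 μ)
    have : CompactSpace (sphere (0 : Lp ℝ 2 μ) 1) :=
      isCompact_iff_compactSpace.1 (isCompact_sphere _ _)
    have : CompactSpace (sphere (0 : X) 1) := F.toHomeomorph.symm.compactSpace
    exact hX finiteDimensional_of_compactSpace_sphere
  have hnt' : Nontrivial (Lp ℝ 2 μ) := by
    by_contra hnt
    rw [not_nontrivial_iff_subsingleton] at hnt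
    exact hfin inferInstance
  have : SecondCountableTopology X := UniformSpace.secondCountable_of_separable X
  have : TopologicalSpace.SeparableSpace (sphere (0 : Lp ℝ 2 μ) 1) :=
    F.surjective.denseRange.separableSpace F.continuous
  have := separableSpace_of_sphere (E := Lp ℝ 2 μ)
  obtain ⟨e⟩ := nonempty_linearIsometryEquiv_l2 (Lp ℝ 2 μ) hfin
  exact ⟨F.trans ⟨e.sphereIsometryEquiv.toEquiv, e.sphereIsometryEquiv.isometry.uniformContinuous,
      e.sphereIsometryEquiv.symm.isometry.uniformContinuous⟩,
    hF.isometry_comp e.sphereIsometryEquiv.isometry,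
    hF'.comp_isometry e.sphereIsometryEquiv.symm.isometry⟩

/-- The slack `+ 1` avoids showing that the infimum is attained, and makes the constant at least
`1`, as the renorming requires. -/
theorem IsConcaveWith.of_concavityConstant_eq {X : Type*} [NormedAddCommGroup X]
    [NormedSpace ℝ X] [CompleteSpace X] [Lattice X] [IsOrderedAddMonoid X] [HasSolidNorm X]
    [IsOrderedModule ℝ X] {q : ℝ} {M : ℝ≥0} (h : concavityConstant q X = M) :
    IsConcaveWith q X (M + 1) := by
  have h1 : concavityConstant q X < ((M + 1 : ℝ≥0) : ℝ≥0∞) := by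
    rw [h, ENNReal.coe_lt_coe]
    exact lt_add_of_pos_right _ one_pos
  rw [concavityConstant] at h1
  simp only [iInf_lt_iff] at h1
  obtain ⟨C, hC, hlt⟩ := h1
  intro n x
  refine (hC n x).trans (mul_le_mul_of_nonneg_right ?_ (norm_nonneg _))
  exact_mod_cast (ENNReal.coe_lt_coe.1 hlt).le

end Assembly

theorem theorem2p2 (q q' : ℝ) (hq : 1 ≤ q) (hq' : 1 ≤ q') (M M' : ℝ≥0) :
    ∃ α : ℝ≥0 → ℝ≥0,
      ∀ (X : Type*) [NormedAddCommGroup X] [NormedSpace ℝ X] [CompleteSpace X]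
        [Lattice X] [IsOrderedAddMonoid X] [HasSolidNorm X] [IsOrderedModule ℝ X]
        (Y : Type*) [NormedAddCommGroup Y] [NormedSpace ℝ Y] [CompleteSpace Y]
        [Lattice Y] [IsOrderedAddMonoid Y] [HasSolidNorm Y] [IsOrderedModule ℝ Y],
        TopologicalSpace.SeparableSpace X → TopologicalSpace.SeparableSpace Y →
        ¬ FiniteDimensional ℝ X → ¬ FiniteDimensional ℝ Y →
        concavityConstant q X = M → concavityConstant q' Y = M' →
        ∃ F : Metric.sphere (0 : X) 1 ≃ᵤ Metric.sphere (0 : Y) 1,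
          IsModulusOfContinuity α F ∧ IsModulusOfContinuity α F.symm := by
  have hq0 : 0 < q := by linarith
  have hq0' : 0 < q' := by linarith
  have hc := continuous_sphereModulus hq0 (M + 1)
  have hc' := continuous_sphereModulus hq0' (M' + 1)
  have h0 := sphereModulus_zero hq0 (M + 1)
  have h0' := sphereModulus_zero hq0' (M' + 1)
  -- Going through `ℓ₂` composes the two moduli, in opposite orders for the map and for its inverse;
  -- the sum dominates both.
  refine ⟨fun t => sphereModulus q' (M' + 1) (sphereModulus q (M + 1) t) +
    sphereModulus q (M + 1) (sphereModulus q' (M' + 1) t), ?_⟩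
  intro X _ _ _ _ _ _ _ Y _ _ _ _ _ _ _ _ _ hX hY hMX hMY
  obtain ⟨F, hF, hF'⟩ := exists_uniformEquiv_sphere_l2 X hX hq (le_add_of_nonneg_left zero_le)
    (IsConcaveWith.of_concavityConstant_eq hMX)
  obtain ⟨G, hG, hG'⟩ := exists_uniformEquiv_sphere_l2 Y hY hq' (le_add_of_nonneg_left zero_le)
    (IsConcaveWith.of_concavityConstant_eq hMY)
  refine ⟨F.trans G.symm, (hG'.comp hF (monotone_sphereModulus hq0' _)).mono (by fun_prop)
    (by simp [h0, h0']) fun t => ?_, (hF'.comp hG (monotone_sphereModulus hq0 _)).mono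
    (by fun_prop) (by simp [h0, h0']) fun t => ?_⟩
  · exact le_add_of_nonneg_right zero_le
  · exact le_add_of_nonneg_left zero_le
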